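/- Let $[m]=(q^m-q^{-m})/(q-q^{-1})\in\mathbb{C}(q)$. For $n\ge 0$ let $\mathrm{TL}^D_{n+1}$ be the Temperley--Lieb algebra of type $D_{n+1}$, i.e. the unital $\mathbb{C}(q)$-algebra with generators $E_0,\dots,E_n$ and relations $E_i^2=-[2]E_i$; $E_iE_jE_i=E_i$ if $i,j$ are adjacent in the Dynkin diagram $D_{n+1}$; $E_iE_j=E_jE_i$ if they are not adjacent. Here the nodes of $D_{n+1}$ are $0,1,\dots,n$, the nodes $0$ and $1$ are both joined to $2$, and $i$ is joined to $i+1$ for $2\le i<n$. Elements of $\mathrm{TL}^D_{i+1}$, $i\le n$, are regarded as elements of $\mathrm{TL}^D_{n+1}$ via $E_k\mapsto E_k$. There is a unique family $(Q_n)_{n\ge0}$, $Q_n\in\mathrm{TL}^D_{n+1}$ (the Jones--Wenzl projections of type $D$), such that for all $n\ge 0$: $Q_n\ne0$; $Q_nQ_i=Q_iQ_n=Q_n$ for $0\le i\le n$; and $E_iQ_n=Q_nE_i=0$ for $0\le i\le n$. A product $E_{s_1}\cdots E_{s_l}$ of generators is called reduced if it is not a scalar multiple of a product of fewer generators. For every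 $n\ge 3$, the product $E_0E_1E_3$ is reduced, $Q_n$ is a linear combination of (pairwise distinct) reduced products, and in every such expression the coefficient of $E_0E_1E_3$ is $$\mathrm{coef}^{n}(E_0E_1E_3)=\frac{[n-1]^3[n-2][2]^2}{[2n-2][n+1][n]}+2\,\frac{[n][n-1]^3[n-2][2]}{[2n][2n-2][n+1]}.$$ -/

import Mathlib

noncomputable section

/-- The base field `ℂ(q)`; the indeterminate `q` is `RatFunc.X`. -/
abbrev Cq : Type := RatFunc ℂ

/-- The `q`-integer `[m] = (q ^ m - q ^ (-m)) / (q - q ^ (-1))`. -/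
def qInt (m : ℤ) : Cq :=
  ((RatFunc.X : Cq) ^ m - (RatFunc.X : Cq) ^ (-m)) / ((RatFunc.X : Cq) - (RatFunc.X : Cq)⁻¹)

namespace TypeD

/-- Adjacency in the Dynkin diagram of type `D` with nodes `0, 1, 2, …`:
`0` and `1` are both joined to `2`, and `i` is joined to `i + 1` for `i ≥ 2`. -/
def Adj (i j : ℕ) : Prop :=
  (1 ≤ i ∧ j = i + 1) ∨ (1 ≤ j ∧ i = j + 1) ∨ (i = 0 ∧ j = 2) ∨ (i = 2 ∧ j = 0)

/-- The defining relations of the Temperley–Lieb algebra of type `D_{n+1}`, in the free algebra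
on the nodes `0, 1, …, n`. -/
inductive Rel (n : ℕ) :
    FreeAlgebra Cq (Fin (n + 1)) → FreeAlgebra Cq (Fin (n + 1)) → Prop
  | sq (i : Fin (n + 1)) :
      Rel n (FreeAlgebra.ι Cq i * FreeAlgebra.ι Cq i) ((-qInt 2) • FreeAlgebra.ι Cq i)
  | braid (i j : Fin (n + 1)) (h : Adj i j) :
      Rel n (FreeAlgebra.ι Cq i * FreeAlgebra.ι Cq j * FreeAlgebra.ι Cq i) (FreeAlgebra.ι Cq i)
  | comm (i j : Fin (n + 1)) (h : ¬ Adj i j) :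
      Rel n (FreeAlgebra.ι Cq i * FreeAlgebra.ι Cq j) (FreeAlgebra.ι Cq j * FreeAlgebra.ι Cq i)

/-- The Temperley–Lieb algebra of type `D_{n+1}`, the unital associative `ℂ(q)`-algebra with
generators `E_0, …, E_n`. -/
abbrev TL (n : ℕ) : Type := RingQuot (Rel n)

/-- The generator `E_i`. -/
def E {n : ℕ} (i : Fin (n + 1)) : TL n :=
  RingQuot.mkAlgHom Cq (Rel n) (FreeAlgebra.ι Cq i)

theorem E_sq {n : ℕ} (i : Fin (n + 1)) : E i * E i = (-qInt 2) • E i := by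
  have h := RingQuot.mkAlgHom_rel Cq (Rel.sq i)
  rw [map_mul, map_smul] at h
  exact h

theorem E_braid {n : ℕ} (i j : Fin (n + 1)) (hij : Adj i j) : E i * E j * E i = E i := by
  have h := RingQuot.mkAlgHom_rel Cq (Rel.braid i j hij)
  rw [map_mul, map_mul] at h
  exact h

theorem E_comm {n : ℕ} (i j : Fin (n + 1)) (hij : ¬ Adj i j) : E i * E j = E j * E i := by
  have h := RingQuot.mkAlgHom_rel Cq (Rel.comm i j hij)
  rw [map_mul, map_mul] at h
  exact h

/-- For `m ≤ n`, the algebra homomorphism `TL m → TL n` with `E_i ↦ E_i`, through which elements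
of `TL m` are regarded as elements of `TL n`. -/
def incl {m n : ℕ} (h : m ≤ n) : TL m →ₐ[Cq] TL n :=
  RingQuot.liftAlgHom Cq
    ⟨FreeAlgebra.lift Cq fun i : Fin (m + 1) => E (Fin.castLE (Nat.succ_le_succ h) i), by
      intro x y hxy
      cases hxy with
      | sq i =>
        simp only [map_mul, map_smul, FreeAlgebra.lift_ι_apply]
        exact E_sq _
      | braid i j hij =>
        simp only [map_mul, FreeAlgebra.lift_ι_apply]
        exact E_braid _ _ hij
      | comm i j hij =>
        simp only [map_mul, FreeAlgebra.lift_ι_apply]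
        exact E_comm _ _ hij⟩

theorem incl_E {m n : ℕ} (h : m ≤ n) (i : Fin (m + 1)) :
    incl h (E i) = E (Fin.castLE (Nat.succ_le_succ h) i) := by
  simp [incl, E]

/-- A family `Q_0, Q_1, Q_2, …` with `Q_n ∈ TL n` consists of the Jones–Wenzl projections of
type `D`. -/
structure IsJonesWenzl (Q : (n : ℕ) → TL n) : Prop where
  ne_zero : ∀ n, Q n ≠ 0
  mul_incl : ∀ (n i : ℕ) (h : i ≤ n), Q n * incl h (Q i) = Q n
  incl_mul : ∀ (n i : ℕ) (h : i ≤ n), incl h (Q i) * Q n = Q n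
  E_mul : ∀ (n : ℕ) (i : Fin (n + 1)), E i * Q n = 0
  mul_E : ∀ (n : ℕ) (i : Fin (n + 1)), Q n * E i = 0

/-- The word `E_w = E_{s_1} ⋯ E_{s_l}` for `w = (s_1, …, s_l)`. -/
def word {n : ℕ} (w : List (Fin (n + 1))) : TL n := (w.map E).prod

/-- `w` is a reduced expression: `E_w` is not, up to a scalar factor, a word in fewer
generators. (The scalar matters: `E_i * E_i = -[2] E_i` is to count as non-reduced.) -/
def IsReduced {n : ℕ} (w : List (Fin (n + 1))) : Prop :=
  ∀ (w' : List (Fin (n + 1))) (c : Cq), word w = c • word w' → w.length ≤ w'.length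

/-- The elements of `TL n` given by reduced expressions (the monomial basis). -/
def monomials (n : ℕ) : Set (TL n) := {x | ∃ w : List (Fin (n + 1)), IsReduced w ∧ word w = x}

/-- `c` gives an expansion `x = ∑ c_b b` of `x` as a linear combination of monomials `b`. -/
def IsExpansion {n : ℕ} (x : TL n) (c : TL n →₀ Cq) : Prop :=
  (c.support : Set (TL n)) ⊆ monomials n ∧ (c.sum fun b a => a • b) = x

/-- `a` is the coefficient of the monomial `m` in `x`: `x` is a linear combination of monomials,
and in every such expression of `x` the coefficient of `m` is `a`. -/
def IsCoeff {n : ℕ} (m x : TL n) (a : Cq) : Prop :=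
  m ∈ monomials n ∧ (∃ c, IsExpansion x c) ∧ ∀ c, IsExpansion x c → c m = a

end TypeD

end

/-! Uniqueness is the usual argument. An element killed by all generators on one side multiplies
through the augmentation on that side, so two candidates for the projection absorb each other
(`IsJonesWenzl.unique`).

Existence comes from a recursion Q_n = Q_{n-1} · `wenzl` n. Every word in E_0, …, E_n is a scalar
times a word in E_0, …, E_{n-1} times one of finitely many representatives u (`IsTL.exists_coset`),
and `wenzl` is a weighted sum of these u. In Q_{n-1} · `wenzl` n · E_i, each term in which a lower
word splits off on the left dies against Q_{n-1}. The other terms cancel by the three-term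
recurrences of [m] and of q^m + q^{-m} (`IsTL.mul_wenzl_eq_zero`).

The coefficient of z = E_0 E_1 E_3 is followed through this recursion without using linear
independence of the monomials. The defining relations equate words up to scalars only, so a
homogeneous function restricted to words extends to a linear functional (`linearize`). Applied to
"the scalar c such that the image of x is c times the image of z", this yields the functionals
`coefFun`. The representation used is a pair `eT` = (`eA`, `eB`) on a spin chain. In `eA` the
generators E_0 and E_1 coincide. In `eB` they differ by conjugation with a bit flip and E_0 E_1 = 0.
A word whose image is a nonzero multiple of that of z is that multiple of z itself
(`isFaithful_zA`), so the functional reads off the coefficient in every expansion (`isCoeff_zB`).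

Right descents (letters j with x E_j = δ x) show that y · u can be a multiple of the target for very
few u. The recursion closes on three targets: E_0 E_1 E_3, the word `zB` ending in E_n, and the
zigzag `zC`. The representatives containing E_0 E_1, the "dotted loop", vanish in `eB` and are δ
times loop-free words in `eA`. Their contribution to the `eT`-coefficients is therefore given by
`eA`-coefficients. The resulting triangular system of recurrences is solved by the closed forms
`aBVal`, `aCVal`, `tBVal`, `tCVal`, `tAVal`, and the last of these is the asserted formula. -/

noncomputable section

namespace TypeD

/-! ### Nonvanishing and recurrences of q-integers -/

theorem X_pow_ne_one {k : ℕ} (hk : 0 < k) : (RatFunc.X : Cq) ^ k ≠ 1 := by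
  intro h
  have h2 : algebraMap (Polynomial ℂ) Cq (Polynomial.X ^ k) = algebraMap (Polynomial ℂ) Cq 1 := by
    simpa [RatFunc.algebraMap_X] using h
  have h3 := congrArg Polynomial.natDegree (RatFunc.algebraMap_injective ℂ h2)
  simp at h3
  omega

theorem X_ne_zero : (RatFunc.X : Cq) ≠ 0 := RatFunc.X_ne_zero

/-- `q ^ m + q ^ (-m)`. -/
def pInt (m : ℤ) : Cq := (RatFunc.X : Cq) ^ m + (RatFunc.X : Cq) ^ (-m)

theorem X_sub_inv_ne_zero : (RatFunc.X : Cq) - (RatFunc.X : Cq)⁻¹ ≠ 0 := by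
  intro h
  have hX := X_ne_zero
  apply X_pow_ne_one (k := 2) (by norm_num)
  field_simp at h
  linear_combination h

theorem qInt_ne_zero {m : ℤ} (hm : 0 < m) : qInt m ≠ 0 := by
  lift m to ℕ using hm.le
  have hX := X_ne_zero
  refine div_ne_zero (fun h => ?_) X_sub_inv_ne_zero
  apply X_pow_ne_one (k := 2 * m) (by omega)
  rw [zpow_neg, zpow_natCast] at h
  field_simp at h
  linear_combination h

theorem pInt_ne_zero {m : ℤ} (hm : 0 < m) : pInt m ≠ 0 := by
  lift m to ℕ using hm.le
  have hX := X_ne_zero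
  intro h
  apply X_pow_ne_one (k := 4 * m) (by omega)
  rw [pInt, zpow_neg, zpow_natCast] at h
  field_simp at h
  have h' : (RatFunc.X : Cq) ^ (2 * m) = -1 := by linear_combination h
  rw [show 4 * m = 2 * m + 2 * m by ring, pow_add, h']
  norm_num

theorem qInt_one : qInt 1 = 1 := by
  simp [qInt, X_sub_inv_ne_zero]

theorem qInt_zero : qInt 0 = 0 := by
  simp [qInt]

theorem pInt_zero : pInt 0 = 2 := by
  norm_num [pInt]

theorem qInt_two : qInt 2 = pInt 1 := by
  have hX := X_ne_zero
  have h := X_sub_inv_ne_zero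
  rw [qInt, pInt, div_eq_iff h]
  simp [zpow_neg]
  field_simp
  ring

theorem qInt_two_sq_ne_one : qInt 2 * qInt 2 ≠ 1 := by
  intro h
  have hX := X_ne_zero
  -- From [2]² = 1 follows q⁴ + q² + 1 = 0, and multiplication by q² - 1 gives q⁶ = 1.
  apply X_pow_ne_one (k := 6) (by norm_num)
  rw [qInt_two, pInt] at h
  simp at h
  field_simp at h
  linear_combination (RatFunc.X ^ 2 - 1) * h

theorem qInt_rec (m : ℤ) : qInt (m + 1) + qInt (m - 1) = qInt 2 * qInt m := by
  have hX := X_ne_zero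
  have h := X_sub_inv_ne_zero
  rw [qInt_two, pInt, qInt, qInt, qInt]
  simp only [zpow_add₀ hX, zpow_sub₀ hX, zpow_neg, zpow_one]
  field_simp
  ring

theorem pInt_rec (m : ℤ) : pInt (m + 1) + pInt (m - 1) = qInt 2 * pInt m := by
  have hX := X_ne_zero
  rw [qInt_two, pInt, pInt, pInt, pInt]
  simp only [zpow_add₀ hX, zpow_sub₀ hX, zpow_neg, zpow_one]
  field_simp
  ring

/-- The parameter `δ = -[2]`. -/
abbrev dl : Cq := -qInt 2

theorem dl_ne_zero : dl ≠ 0 := neg_ne_zero.mpr (qInt_ne_zero (by norm_num))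

/-- This inequality excludes impossible descents: braid relations turn them into δ² z = z. -/
theorem dl_sq_ne_one : dl * dl ≠ 1 := by
  simpa [dl] using qInt_two_sq_ne_one

/-! ### Words in the relations of type D and their representatives -/

/-- The elements `e 0, …, e n` satisfy the defining relations of type `D_{n+1}`. -/
structure IsTL {A : Type*} [Ring A] [Algebra Cq A] (e : ℕ → A) (n : ℕ) : Prop where
  sq : ∀ i, i ≤ n → e i * e i = dl • e i
  braid : ∀ i j, i ≤ n → j ≤ n → Adj i j → e i * e j * e i = e i
  comm : ∀ i j, i ≤ n → j ≤ n → ¬ Adj i j → e i * e j = e j * e i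

section Relations

variable {A : Type*} [Ring A] {e : ℕ → A} {n : ℕ}

/-- The word `e_{i_1} ⋯ e_{i_l}`. -/
def wd (e : ℕ → A) (l : List ℕ) : A := (l.map e).prod

@[simp] theorem wd_nil : wd e [] = 1 := rfl

theorem wd_append (l l' : List ℕ) : wd e (l ++ l') = wd e l * wd e l' := by
  simp [wd]

theorem wd_cons (i : ℕ) (l : List ℕ) : wd e (i :: l) = e i * wd e l := by
  simp [wd]

theorem wd_singleton (i : ℕ) : wd e [i] = e i := by
  simp [wd]

/-- The words of positive length in `e 0, …, e m`. -/
def IsWord (e : ℕ → A) (m : ℕ) (x : A) : Prop :=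
  ∃ l : List ℕ, (∀ i ∈ l, i ≤ m) ∧ l ≠ [] ∧ x = wd e l

theorem isWord_gen {m i : ℕ} (hi : i ≤ m) : IsWord e m (e i) :=
  ⟨[i], by simpa using hi, by simp, by simp [wd]⟩

theorem IsWord.mul {m : ℕ} {x y : A} (hx : IsWord e m x) (hy : IsWord e m y) :
    IsWord e m (x * y) := by
  obtain ⟨l, h1, h2, rfl⟩ := hx
  obtain ⟨l', h1', -, rfl⟩ := hy
  refine ⟨l ++ l', ?_, by simp [h2], (wd_append _ _).symm⟩
  intro i hi
  rcases List.mem_append.1 hi with hi | hi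
  exacts [h1 i hi, h1' i hi]

theorem IsWord.mono {m m' : ℕ} (hm : m ≤ m') {x : A} (hx : IsWord e m x) : IsWord e m' x := by
  obtain ⟨l, h1, h2, rfl⟩ := hx
  exact ⟨l, fun i hi => (h1 i hi).trans hm, h2, rfl⟩

/-- `e_n e_{n-1} ⋯`, with `k` factors. -/
def down (e : ℕ → A) (n : ℕ) : ℕ → A
  | 0 => 1
  | k + 1 => down e n k * e (n - k)

/-- `e_0 e_1 ⋯ e_j`. -/
def up (e : ℕ → A) : ℕ → A
  | 0 => e 0
  | j + 1 => up e j * e (j + 1)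

theorem down_succ (k : ℕ) : down e n (k + 1) = down e n k * e (n - k) := rfl

theorem up_succ (j : ℕ) : up e (j + 1) = up e j * e (j + 1) := rfl

theorem isWord_up (j : ℕ) : IsWord e j (up e j) := by
  induction j with
  | zero => exact isWord_gen le_rfl
  | succ j ih => exact (ih.mono (Nat.le_succ j)).mul (isWord_gen le_rfl)

/-- `e_n ⋯ e_2 e_0 e_1 ⋯ e_j`. -/
def vee (e : ℕ → A) (n j : ℕ) : A := down e n (n - 1) * up e j

theorem vee_succ (j : ℕ) : vee e n (j + 1) = vee e n j * e (j + 1) := by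
  rw [vee, vee, up_succ, mul_assoc]

/-- The representatives: `e_n e_{n-1} ⋯ e_{j+1}` for `j ≥ 1`, the words `e_n ⋯ e_2 e_a` for
`a = 0, 1`, and the words `e_n ⋯ e_2 e_0 e_1 ⋯ e_j` for `j ≥ 1`. -/
inductive IsCoset (e : ℕ → A) (n : ℕ) : A → Prop
  | down (k : ℕ) (hk : k < n) : IsCoset e n (down e n k)
  | fork (a : ℕ) (ha : a ≤ 1) : IsCoset e n (TypeD.down e n (n - 1) * e a)
  | vee (j : ℕ) (h1 : 1 ≤ j) (hj : j ≤ n) : IsCoset e n (vee e n j)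

variable [Algebra Cq A]

theorem IsTL.mono {m : ℕ} (h : IsTL e n) (hm : m ≤ n) : IsTL e m :=
  ⟨fun i hi => h.sq i (hi.trans hm), fun i j hi hj => h.braid i j (hi.trans hm) (hj.trans hm),
    fun i j hi hj => h.comm i j (hi.trans hm) (hj.trans hm)⟩

theorem IsTL.down_comm (h : IsTL e n) {k i : ℕ} (h1 : i + k < n) (h2 : k + 1 < n) :
    down e n k * e i = e i * down e n k := by
  induction k with
  | zero => simp [down]
  | succ k ih =>
    rw [down_succ, mul_assoc, h.comm (n - k) i (by omega) (by omega) (by unfold Adj; omega),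
      ← mul_assoc, ih (by omega) (by omega), mul_assoc]

theorem IsTL.down_comm_wd (h : IsTL e n) {k m : ℕ} {x : A} (hx : IsWord e m x) (h1 : m + k < n)
    (h2 : k + 1 < n) : down e n k * x = x * down e n k := by
  obtain ⟨l, hl, -, rfl⟩ := hx
  induction l with
  | nil => simp
  | cons i l ih =>
    have hi : i ≤ m := hl i (by simp)
    rw [wd_cons, ← mul_assoc, h.down_comm (by omega) h2, mul_assoc,
      ih (fun j hj => hl j (by simp [hj])), mul_assoc]

theorem IsTL.down_stay (h : IsTL e n) (k : ℕ) :
    down e n (k + 1) * e (n - k) = dl • down e n (k + 1) := by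
  rw [down_succ, mul_assoc, h.sq _ (by omega), mul_smul_comm]

theorem IsTL.down_back (h : IsTL e n) {k : ℕ} (hk : k + 3 ≤ n) :
    down e n (k + 2) * e (n - k) = down e n (k + 1) := by
  rw [down_succ, down_succ, mul_assoc, mul_assoc, ← mul_assoc (e (n - k)),
    h.braid _ _ (by omega) (by omega) (by unfold Adj; omega)]

/-- The new letter commutes back to its neighbour `e (n - (a + 1))` and the braid relation removes
the pair. The letters from `e (n - (a + 2))` on are now detached from the rest, commute to the left
end and form `t`. -/
theorem IsTL.down_far (h : IsTL e n) {a k : ℕ} (hk : a + 3 ≤ k) (hkn : k < n) :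
    ∃ t, IsWord e (n - 2) t ∧ down e n k * e (n - a) = t * down e n (a + 1) := by
  induction k, hk using Nat.le_induction with
  | base =>
    refine ⟨e (n - (a + 2)), isWord_gen (by omega), ?_⟩
    rw [down_succ, mul_assoc,
      h.comm (n - (a + 2)) (n - a) (by omega) (by omega) (by unfold Adj; omega), ← mul_assoc,
      h.down_back (by omega), h.down_comm (by omega) (by omega)]
  | succ k hk ih =>
    obtain ⟨t, ht, h'⟩ := ih (by omega)
    refine ⟨t * e (n - k), ht.mul (isWord_gen (by omega)), ?_⟩
    rw [down_succ, mul_assoc, h.comm (n - k) (n - a) (by omega) (by omega) (by unfold Adj; omega),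
      ← mul_assoc, h', mul_assoc, h.down_comm (by omega) (by omega), mul_assoc]

theorem IsTL.down_full_far (h : IsTL e n) {i : ℕ} (hi : 3 ≤ i) (hin : i ≤ n) :
    ∃ t, (t = 1 ∨ IsWord e (n - 2) t) ∧
      down e n (n - 1) * e i = t * down e n (n + 1 - i) := by
  rcases hi.eq_or_lt with rfl | hi
  · refine ⟨1, .inl rfl, ?_⟩
    obtain ⟨k, rfl⟩ : ∃ k, n = k + 3 := ⟨n - 3, by omega⟩
    have := h.down_back (k := k) (by omega)
    simpa using this
  · obtain ⟨a, rfl⟩ : ∃ a, i = n - a := ⟨n - i, by omega⟩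
    obtain ⟨t, ht, h'⟩ := h.down_far (a := a) (k := n - 1) (by omega) (by omega)
    refine ⟨t, .inr ht, ?_⟩
    rw [h']
    congr 2
    omega

theorem IsTL.up_stay (h : IsTL e n) {j : ℕ} (hj : j ≤ n) : up e j * e j = dl • up e j := by
  cases j with
  | zero => exact h.sq 0 hj
  | succ j => rw [up_succ, mul_assoc, h.sq _ hj, mul_smul_comm]

theorem IsTL.comm01 (h : IsTL e n) (hn : 1 ≤ n) : e 0 * e 1 = e 1 * e 0 :=
  h.comm 0 1 (by omega) hn (by unfold Adj; omega)

theorem IsTL.up_one_zero (h : IsTL e n) (hn : 1 ≤ n) : up e 1 * e 0 = dl • up e 1 := by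
  change e 0 * e 1 * e 0 = dl • (e 0 * e 1)
  rw [mul_assoc, ← h.comm01 hn, ← mul_assoc, h.sq 0 (by omega), smul_mul_assoc]

theorem IsTL.up_two_zero (h : IsTL e n) (hn : 2 ≤ n) : up e 2 * e 0 = up e 1 := by
  change e 0 * e 1 * e 2 * e 0 = e 0 * e 1
  rw [h.comm01 (by omega), mul_assoc, mul_assoc, ← mul_assoc (e 0),
    h.braid 0 2 (by omega) hn (by unfold Adj; omega)]

theorem IsTL.up_back (h : IsTL e n) {j : ℕ} (hj : j + 2 ≤ n) :
    up e (j + 2) * e (j + 1) = up e (j + 1) := by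
  rw [up_succ, up_succ, mul_assoc, mul_assoc, ← mul_assoc (e (j + 1)),
    h.braid _ _ (by omega) (by omega) (by unfold Adj; omega)]

theorem IsTL.wd_comm (h : IsTL e n) {m i : ℕ} {x : A} (hx : IsWord e m x) (h1 : m + 2 ≤ i)
    (h2 : 3 ≤ i) (hi : i ≤ n) : x * e i = e i * x := by
  obtain ⟨l, hl, -, rfl⟩ := hx
  induction l with
  | nil => simp
  | cons j l ih =>
    have hj : j ≤ m := hl j (by simp)
    rw [wd_cons, mul_assoc, ih (fun j hj => hl j (by simp [hj])), ← mul_assoc,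
      h.comm j i (by omega) hi (by unfold Adj; omega), mul_assoc]

/-- Multiplying `e_n ⋯ e_2 x`, where `x` is a word in `e_0, …, e_m`, by a generator with a much
larger index. -/
theorem IsTL.down_mul_far (h : IsTL e n) {m i : ℕ} {x : A} (hx : IsWord e m x) (h1 : m + 2 ≤ i)
    (h2 : 3 ≤ i) (hi : i ≤ n) :
    ∃ t, IsWord e (n - 1) t ∧ down e n (n - 1) * x * e i = t * down e n (n + 1 - i) := by
  obtain ⟨t, ht, h'⟩ := h.down_full_far h2 hi
  refine ⟨t * x, ?_, ?_⟩
  · rcases ht with rfl | ht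
    · simpa using hx.mono (by omega)
    · exact (ht.mono (by omega)).mul (hx.mono (by omega))
  · rw [mul_assoc, h.wd_comm hx h1 h2 hi, ← mul_assoc, h', mul_assoc,
      h.down_comm_wd hx (by omega) (by omega), mul_assoc]

theorem IsTL.vee_low (h : IsTL e n) {i j : ℕ} (h1 : i + 2 ≤ j) (h2 : 3 ≤ j) (hj : j ≤ n) :
    ∃ t, IsWord e (n - 1) t ∧ vee e n j * e i = t * down e n (n + 1 - j) := by
  -- The nodes 0 and 1 have the same single larger neighbour 2, so i = 0 is treated like i = 1. At
  -- the smallest j the braid relation removes `e (j - 1)`, and the stranded letter `e j` cuts the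
  -- descending part. Each further letter then shortens that part by one.
  have key : ∀ j, max i 1 + 2 ≤ j → j ≤ n →
      ∃ t, IsWord e (n - 1) t ∧ vee e n j * e i = t * down e n (n + 1 - j) := by
    intro j hj
    induction j, hj using Nat.le_induction with
    | base =>
      intro hn
      have h3 : vee e n (max i 1 + 2) * e i
          = down e n (n - 1) * up e (max i 1) * e (max i 1 + 2) := by
        rw [vee_succ, mul_assoc, ← h.comm i _ (by omega) hn (by unfold Adj; omega), ← mul_assoc]
        congr 1
        rw [vee, mul_assoc]
        congr 1
        rcases Nat.eq_zero_or_pos i with rfl | hi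
        · exact h.up_two_zero (by omega)
        · obtain ⟨a, rfl⟩ : ∃ a, i = a + 1 := ⟨i - 1, by omega⟩
          rw [show max (a + 1) 1 = a + 1 by omega]
          exact h.up_back (by omega)
      rw [h3]
      exact h.down_mul_far (isWord_up _) le_rfl (by omega) hn
    | succ j hj ih =>
      intro hn
      obtain ⟨t, ht, h'⟩ := ih (by omega)
      refine ⟨t, ht, ?_⟩
      rw [vee_succ, mul_assoc, ← h.comm i _ (by omega) hn (by unfold Adj; omega), ← mul_assoc, h',
        mul_assoc]
      congr 1
      obtain ⟨k, rfl⟩ : ∃ k, n = k + (j + 1) := ⟨n - (j + 1), by omega⟩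
      have := h.down_back (k := k) (by omega)
      rw [show k + (j + 1) + 1 - j = k + 2 by omega,
        show k + (j + 1) + 1 - (j + 1) = k + 1 by omega, ← this]
      congr 2
      omega
  exact key j (by omega) hj

theorem IsTL.vee_high (h : IsTL e n) {i j : ℕ} (h1 : j + 2 ≤ i) (h2 : 3 ≤ i) (hi : i ≤ n) :
    ∃ t, IsWord e (n - 1) t ∧ vee e n j * e i = t * down e n (n + 1 - i) :=
  h.down_mul_far (isWord_up j) h1 h2 hi

theorem IsTL.fork_two (h : IsTL e n) (hn : 2 ≤ n) {a : ℕ} (ha : a ≤ 1) :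
    down e n (n - 1) * e a * e 2 = down e n (n - 1) := by
  obtain ⟨k, rfl⟩ : ∃ k, n = k + 2 := ⟨n - 2, by omega⟩
  rw [show k + 2 - 1 = k + 1 by omega, down_succ, show k + 2 - k = 2 by omega, mul_assoc,
    mul_assoc, ← mul_assoc (e 2), h.braid 2 a hn (by omega) (by unfold Adj; omega)]

/-- Stability of the representatives under right multiplication, up to a scalar or a lower word on
the left. Reading a word letter by letter then factors it. -/
theorem IsTL.coset_mul (h : IsTL e n) (hn : 2 ≤ n) {u : A} (hu : IsCoset e n u) {i : ℕ}
    (hi : i ≤ n) :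
    ∃ u', IsCoset e n u' ∧ ((∃ c : Cq, u * e i = c • u') ∨
      ∃ t, IsWord e (n - 1) t ∧ u * e i = t * u') := by
  cases hu with
  | down k hk =>
    rcases lt_or_ge (i + k) n with h1 | h1
    · rcases lt_or_ge (k + 1) n with h2 | h2
      · exact ⟨_, .down k hk, .inr ⟨e i, isWord_gen (by omega), h.down_comm h1 h2⟩⟩
      · obtain rfl : i = 0 := by omega
        obtain rfl : k = n - 1 := by omega
        exact ⟨_, .fork 0 (by omega), .inl ⟨1, by rw [one_smul]⟩⟩
    · obtain ⟨a, rfl⟩ : ∃ a, i = n - a := ⟨n - i, by omega⟩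
      have ha : a ≤ n := by omega
      rcases lt_trichotomy a k with h2 | h2 | h2
      · rcases lt_or_ge (a + 2) k with h3 | h3
        · obtain ⟨t, ht, h4⟩ := h.down_far h3 hk
          exact ⟨_, .down (a + 1) (by omega), .inr ⟨t, ht.mono (by omega), h4⟩⟩
        · rcases h3.eq_or_lt with rfl | h3
          · exact ⟨_, .down (a + 1) (by omega), .inl ⟨1, by rw [h.down_back (by omega), one_smul]⟩⟩
          · obtain rfl : k = a + 1 := by omega
            exact ⟨_, .down (a + 1) (by omega), .inl ⟨dl, h.down_stay a⟩⟩
      · subst h2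
        rcases lt_or_ge (a + 1) n with h3 | h3
        · exact ⟨_, .down (a + 1) (by omega), .inl ⟨1, by rw [one_smul]; rfl⟩⟩
        · obtain rfl : a = n - 1 := by omega
          exact ⟨_, .fork 1 (by omega), .inl ⟨1, by rw [one_smul]; congr 2; omega⟩⟩
      · omega
  | fork a ha =>
    rcases lt_or_ge i 3 with h1 | h1
    · rcases lt_or_ge i 2 with h2 | h2
      · by_cases h3 : i = a
        · subst h3
          exact ⟨_, .fork i ha, .inl ⟨dl, by rw [mul_assoc, h.sq i hi, mul_smul_comm]⟩⟩
        · refine ⟨_, .vee 1 le_rfl (by omega), .inl ⟨1, ?_⟩⟩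
          rw [one_smul, mul_assoc, vee]
          congr 1
          have : (i = 0 ∧ a = 1) ∨ (i = 1 ∧ a = 0) := by omega
          rcases this with ⟨rfl, rfl⟩ | ⟨rfl, rfl⟩
          · exact (h.comm01 (by omega)).symm
          · rfl
      · obtain rfl : i = 2 := by omega
        exact ⟨_, .down (n - 1) (by omega), .inl ⟨1, by rw [one_smul, h.fork_two hn ha]⟩⟩
    · obtain ⟨t, ht, h4⟩ := h.down_mul_far (isWord_gen ha) (by omega) h1 hi
      exact ⟨_, .down _ (by omega), .inr ⟨t, ht, h4⟩⟩
  | vee j h1 hj =>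
    rcases lt_or_ge i (j + 2) with h2 | h2
    · rcases lt_or_ge (i + 1) j with h3 | h3
      · rcases lt_or_ge j 3 with h4 | h4
        · obtain rfl : i = 0 := by omega
          obtain rfl : j = 2 := by omega
          refine ⟨_, .vee 1 le_rfl (by omega), .inl ⟨1, ?_⟩⟩
          rw [one_smul, TypeD.vee, mul_assoc, h.up_two_zero hn, TypeD.vee]
        · obtain ⟨t, ht, h5⟩ := h.vee_low (i := i) h3 h4 hj
          exact ⟨_, .down _ (by omega), .inr ⟨t, ht, h5⟩⟩
      · have : i = j ∨ i = j + 1 ∨ (i = 0 ∧ j = 1) ∨ (1 ≤ i ∧ j = i + 1) := by omega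
        rcases this with rfl | rfl | ⟨rfl, rfl⟩ | ⟨h4, rfl⟩
        · exact ⟨_, .vee i h1 hj, .inl ⟨dl, by
            rw [TypeD.vee, mul_assoc, h.up_stay hi, mul_smul_comm]⟩⟩
        · exact ⟨_, .vee (j + 1) (by omega) hi, .inl ⟨1, by rw [one_smul, vee_succ]⟩⟩
        · exact ⟨_, .vee 1 le_rfl hj, .inl ⟨dl, by
            rw [TypeD.vee, mul_assoc, h.up_one_zero (by omega), mul_smul_comm]⟩⟩
        · obtain ⟨b, rfl⟩ : ∃ b, i = b + 1 := ⟨i - 1, by omega⟩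
          exact ⟨_, .vee (b + 1) h4 hi, .inl ⟨1, by
            rw [one_smul, TypeD.vee, mul_assoc, h.up_back (by omega), TypeD.vee]⟩⟩
    · obtain ⟨t, ht, h4⟩ := h.vee_high (i := i) h2 (by omega) hi
      exact ⟨_, .down _ (by omega), .inr ⟨t, ht, h4⟩⟩

theorem IsTL.exists_coset (h : IsTL e n) (hn : 2 ≤ n) (l : List ℕ) (hl : ∀ i ∈ l, i ≤ n) :
    ∃ (c : Cq) (l' : List ℕ) (u : A), (∀ i ∈ l', i ≤ n - 1) ∧ IsCoset e n u ∧
      wd e l = c • (wd e l' * u) := by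
  induction l using List.reverseRecOn with
  | nil => exact ⟨1, [], _, by simp, .down 0 (by omega), by simp [down]⟩
  | append_singleton l i ih =>
    obtain ⟨c, l', u, h1, h2, h3⟩ := ih fun j hj => hl j (by simp [hj])
    obtain ⟨u', hu', h4⟩ := h.coset_mul hn h2 (hl i (by simp))
    rw [wd_append, h3, wd_singleton, smul_mul_assoc, mul_assoc]
    rcases h4 with ⟨c', h4⟩ | ⟨t, ⟨l'', h5, -, rfl⟩, h4⟩
    · exact ⟨c * c', l', u', h1, hu', by rw [h4, mul_smul_comm, smul_smul]⟩
    · refine ⟨c, l' ++ l'', u', ?_, hu', by rw [h4, wd_append, mul_assoc]⟩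
      intro j hj
      rcases List.mem_append.1 hj with hj | hj
      exacts [h1 j hj, h5 j hj]

end Relations

/-! ### Moving the dotted loop -/

section Loop

variable {A : Type*} [Ring A] {e : ℕ → A} {n : ℕ}

/-- The word `e_j ⋯ e_2 e_0 e_1 e_2 ⋯ e_j`, with `e_0 e_1` for `j = 0, 1`. -/
def lam (e : ℕ → A) : ℕ → A
  | 0 => e 0 * e 1
  | 1 => e 0 * e 1
  | j + 2 => e (j + 2) * lam e (j + 1) * e (j + 2)

theorem lam_succ_succ (j : ℕ) : lam e (j + 2) = e (j + 2) * lam e (j + 1) * e (j + 2) := rfl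

theorem isWord_lam {j m : ℕ} (h1 : 1 ≤ m) (hj : j ≤ m) : IsWord e m (lam e j) := by
  induction j using Nat.strong_induction_on with
  | _ j ih =>
    match j with
    | 0 => exact (isWord_gen (Nat.zero_le m)).mul (isWord_gen h1)
    | 1 => exact (isWord_gen (by omega)).mul (isWord_gen h1)
    | j + 2 =>
      exact ((isWord_gen hj).mul (ih (j + 1) (by omega) (by omega))).mul (isWord_gen hj)

theorem down_succ_left (n k : ℕ) : down e (n + 1) (k + 1) = e (n + 1) * down e n k := by
  induction k with
  | zero => simp [down]
  | succ k ih =>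
    rw [down_succ, ih, down_succ, mul_assoc]
    congr 3
    omega

theorem vee_self (n : ℕ) : vee e (n + 1) (n + 1) = lam e (n + 1) := by
  induction n with
  | zero => simp [vee, down, up, lam]
  | succ n ih =>
    rw [lam_succ_succ, ← ih, vee, vee, show n + 1 + 1 - 1 = n + 1 by omega, down_succ_left,
      show n + 1 - 1 = n by omega, up_succ]
    simp only [mul_assoc]

variable [Algebra Cq A]

theorem IsTL.lam_comm (h : IsTL e n) {i j : ℕ} (h1 : i + 2 ≤ j) (h2 : 3 ≤ j) (hj : j ≤ n) :
    lam e i * e j = e j * lam e i :=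
  h.wd_comm (isWord_lam (m := max i 1) (by omega) (by omega)) (by omega) h2 hj

theorem IsTL.mul_lam_low (h : IsTL e n) (hn : 1 ≤ n) {i j : ℕ} (hi : i ≤ 1) (hj : j ≤ 1) :
    e i * lam e j = dl • (e 0 * e 1) := by
  have h0 : lam e j = e 0 * e 1 := by
    interval_cases j <;> rfl
  rw [h0]
  interval_cases i
  · rw [← mul_assoc, h.sq 0 (by omega), smul_mul_assoc]
  · rw [h.comm01 hn, ← mul_assoc, h.sq 1 hn, smul_mul_assoc]

theorem IsTL.lam_mul_low (h : IsTL e n) (hn : 1 ≤ n) {i j : ℕ} (hi : i ≤ 1) (hj : j ≤ 1) :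
    lam e i * e j = dl • (e 0 * e 1) := by
  have h0 : lam e i = e 0 * e 1 := by
    interval_cases i <;> rfl
  rw [h0]
  interval_cases j
  · rw [h.comm01 hn, mul_assoc, h.sq 0 (by omega), mul_smul_comm]
  · rw [mul_assoc, h.sq 1 hn, mul_smul_comm]

/-- The dotted loop can be moved along a word. -/
theorem IsTL.mul_lam (h : IsTL e n) (hn : 1 ≤ n) {i j : ℕ} (hi : i ≤ n) (hj : j ≤ n) :
    e i * lam e j = lam e i * e j := by
  have sq : ∀ {i}, i ≤ n → e i * lam e i = lam e i * e i := by
    intro i hi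
    rcases lt_or_ge i 2 with h2 | h2
    · rw [h.mul_lam_low hn (by omega) (by omega), h.lam_mul_low hn (by omega) (by omega)]
    · obtain ⟨a, rfl⟩ : ∃ a, i = a + 2 := ⟨i - 2, by omega⟩
      rw [lam_succ_succ, mul_assoc (_ * _) (e (a + 2)) (e (a + 2)), h.sq _ hi, ← mul_assoc,
        ← mul_assoc, h.sq _ hi]
      simp only [smul_mul_assoc, mul_smul_comm]
  -- neighbours
  have adj : ∀ {i j}, i ≤ n → j ≤ n → Adj i j → i < j →
      e i * lam e j = lam e i * e j ∧ e j * lam e i = lam e j * e i := by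
    intro i j hi hj hij hlt
    -- Since `lam e 0 = lam e 1`, the pair (0, 2) has the same shape as the pairs (i, i + 1).
    have hl : lam e j = e j * lam e i * e j := by
      rcases hij with ⟨h1, rfl⟩ | ⟨h1, rfl⟩ | ⟨rfl, rfl⟩ | ⟨rfl, rfl⟩
      · obtain ⟨a, rfl⟩ : ∃ a, i = a + 1 := ⟨i - 1, by omega⟩
        rfl
      · omega
      · rfl
      · omega
    have hr : ∃ x, lam e i = e i * x ∧ ∃ y, lam e i = y * e i := by
      rcases lt_or_ge i 2 with h2 | h2
      · interval_cases i
        · exact ⟨e 1, rfl, e 1, h.comm01 hn⟩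
        · exact ⟨e 0, h.comm01 hn, e 0, rfl⟩
      · obtain ⟨a, rfl⟩ : ∃ a, i = a + 2 := ⟨i - 2, by omega⟩
        exact ⟨lam e (a + 1) * e (a + 2), by rw [lam_succ_succ, mul_assoc],
          e (a + 2) * lam e (a + 1), rfl⟩
    obtain ⟨x, hx, y, hy⟩ := hr
    have hb := h.braid i j hi hj hij
    constructor
    · rw [hl, ← mul_assoc, ← mul_assoc]
      nth_rw 1 [hx]
      rw [← mul_assoc, hb, ← hx]
    · rw [hl, mul_assoc, mul_assoc]
      nth_rw 2 [hy]
      rw [mul_assoc y, ← mul_assoc (e i), hb, ← hy]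
  -- distant indices
  have far : ∀ j i, i < j → j ≤ n →
      e i * lam e j = lam e i * e j ∧ e j * lam e i = lam e j * e i := by
    intro j
    induction j using Nat.strong_induction_on with
    | _ j ih =>
      intro i hlt hj
      by_cases hij : Adj i j
      · exact adj (by omega) hj hij hlt
      rcases lt_or_ge j 2 with h2 | h2
      · rw [h.mul_lam_low hn (by omega) (by omega), h.lam_mul_low hn (by omega) (by omega),
          h.mul_lam_low hn (by omega) (by omega), h.lam_mul_low hn (by omega) (by omega)]
        exact ⟨rfl, rfl⟩
      have h3 : 3 ≤ j ∧ i + 2 ≤ j := by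
        unfold Adj at hij
        omega
      obtain ⟨b, rfl⟩ : ∃ b, j = b + 2 := ⟨j - 2, by omega⟩
      obtain ⟨ih1, ih2⟩ := ih (b + 1) (by omega) i (by omega) (by omega)
      have hc := h.comm i (b + 2) (by omega) hj hij
      have hb := h.braid (b + 2) (b + 1) hj (by omega) (by unfold Adj; omega)
      have hl := h.lam_comm h3.2 h3.1 hj
      constructor
      · rw [lam_succ_succ, ← mul_assoc, ← mul_assoc, hc, mul_assoc _ (e i), ih1, mul_assoc,
          mul_assoc, ← mul_assoc, ← hl, mul_assoc, ← mul_assoc (e (b + 2)), hb]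
      · rw [lam_succ_succ, mul_assoc, ← hc, mul_assoc, ← mul_assoc (lam e (b + 1)), ← ih2,
          mul_assoc, hl, ← mul_assoc, ← mul_assoc, hb]
  rcases lt_trichotomy i j with h1 | rfl | h1
  · exact (far j i h1 hj).1
  · exact sq hi
  · exact (far i j h1 hi).2

/-- The identity `vee e n j = lam e n * down e (n - 1) (n - j)` puts the loop at the left end.
`IsTL.mul_lam` then carries it through a nonempty word `y` to the first letter of `y`, where it
belongs to the lower level. A loop-free representative remains. For empty `y` there is nowhere to
move the loop. -/
theorem IsTL.word_mul_vee (h : IsTL e n) (hn : 2 ≤ n) {y : A} (hy : IsWord e (n - 1) y) :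
    ∃ y', IsWord e (n - 1) y' ∧ ∀ j, 1 ≤ j → j ≤ n →
      y * vee e n j = y' * down e n (n + 1 - j) := by
  obtain ⟨m, rfl⟩ : ∃ m, n = m + 1 := ⟨n - 1, by omega⟩
  obtain ⟨l, hl, hne, rfl⟩ := hy
  have key : ∀ (l : List ℕ) (s : ℕ), (∀ i ∈ s :: l, i ≤ m) →
      wd e (s :: l) * lam e (m + 1) = lam e s * wd e l * e (m + 1) := by
    intro l
    induction l with
    | nil =>
      intro s hs
      have := hs s (by simp)
      rw [wd_cons, wd_nil, mul_one, mul_one, h.mul_lam (by omega) (by omega) le_rfl]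
    | cons r l ih =>
      intro s hs
      have := hs s (by simp)
      have := hs r (by simp)
      rw [wd_cons, mul_assoc, ih r (fun i hi => hs i (List.mem_cons_of_mem _ hi)), ← mul_assoc,
        ← mul_assoc, h.mul_lam (by omega) (by omega) (by omega), wd_cons, ← mul_assoc]
  obtain ⟨s, l, rfl⟩ := List.exists_cons_of_ne_nil hne
  have hs : s ≤ m := hl s (by simp)
  refine ⟨lam e s * wd e l, ?_, ?_⟩
  · have h1 : IsWord e m (lam e s) := isWord_lam (by omega) hs
    cases l with
    | nil => simpa using h1
    | cons r l =>
      exact h1.mul ⟨r :: l, fun i hi => hl i (List.mem_cons_of_mem _ hi), by simp, rfl⟩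
  · intro j h1 hj
    have h2 : vee e (m + 1) j = lam e (m + 1) * down e m (m + 1 - j) := by
      obtain ⟨k, hk, rfl⟩ : ∃ k, k ≤ m ∧ j = m + 1 - k := ⟨m + 1 - j, by omega, by omega⟩
      clear h1 hj
      induction k with
      | zero => simp [down, vee_self]
      | succ k ih =>
        obtain ⟨a, rfl⟩ : ∃ a, m = k + (a + 1) := ⟨m - (k + 1), by omega⟩
        have h3 := ih (by omega)
        have h4 := h.up_back (j := a) (by omega)
        rw [show k + (a + 1) + 1 - (k + (a + 1) + 1 - (k + 1)) = k + 1 by omega, down_succ,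
          show k + (a + 1) - k = a + 1 by omega, ← mul_assoc]
        rw [show k + (a + 1) + 1 - (k + (a + 1) + 1 - k) = k by omega,
          show k + (a + 1) + 1 - k = a + 2 by omega] at h3
        rw [← h3, show k + (a + 1) + 1 - (k + 1) = a + 1 by omega, vee, vee, mul_assoc, h4]
    rw [h2, ← mul_assoc, key l s hl, show m + 1 + 1 - j = (m + 1 - j) + 1 by omega,
      down_succ_left, ← mul_assoc]

end Loop

/-! ### The algebras by generators and relations -/

/-- The generator `E_i` of `TL n`, indexed by a natural number `i ≤ n`. -/
def gen (n i : ℕ) : TL n := E (Fin.ofNat (n + 1) i)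

theorem gen_val {n : ℕ} (i : Fin (n + 1)) : gen n i = E i := by
  simp [gen]

theorem gen_eq {n i : ℕ} (hi : i < n + 1) : gen n i = E ⟨i, hi⟩ := gen_val ⟨i, hi⟩

theorem val_ofNat {n i : ℕ} (hi : i ≤ n) : ((Fin.ofNat (n + 1) i : Fin (n + 1)) : ℕ) = i := by
  simp [Nat.mod_eq_of_lt (Nat.lt_succ_of_le hi)]

theorem isTL_gen (n : ℕ) : IsTL (gen n) n where
  sq i _ := E_sq _
  braid i j hi hj h := E_braid _ _ (by rwa [val_ofNat hi, val_ofNat hj])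
  comm i j hi hj h := E_comm _ _ (by rwa [val_ofNat hi, val_ofNat hj])

theorem word_eq_wd {n : ℕ} (w : List (Fin (n + 1))) : word w = wd (gen n) (w.map (↑)) := by
  rw [word, wd, List.map_map]
  congr 2
  funext i
  exact (gen_val i).symm

theorem wd_eq_word {n : ℕ} (l : List ℕ) : wd (gen n) l = word (l.map (Fin.ofNat (n + 1))) := by
  rw [word, wd, List.map_map]
  rfl

theorem wd_congr {A : Type*} [Ring A] {e e' : ℕ → A} {l : List ℕ} (h : ∀ i ∈ l, e i = e' i) :
    wd e l = wd e' l := by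
  rw [wd, wd, List.map_congr_left h]

section Hom

variable {A : Type*} [Ring A] [Algebra Cq A]

/-- The homomorphism given by elements satisfying the defining relations. -/
def lift {e : ℕ → A} {n : ℕ} (h : IsTL e n) : TL n →ₐ[Cq] A :=
  RingQuot.liftAlgHom Cq
    ⟨FreeAlgebra.lift Cq fun i : Fin (n + 1) => e i, by
      intro x y hxy
      cases hxy with
      | sq i =>
        simp only [map_mul, map_smul, FreeAlgebra.lift_ι_apply]
        exact h.sq _ (by omega)
      | braid i j hij =>
        simp only [map_mul, FreeAlgebra.lift_ι_apply]
        exact h.braid _ _ (by omega) (by omega) hij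
      | comm i j hij =>
        simp only [map_mul, FreeAlgebra.lift_ι_apply]
        exact h.comm _ _ (by omega) (by omega) hij⟩

theorem lift_gen {e : ℕ → A} {n : ℕ} (h : IsTL e n) {i : ℕ} (hi : i ≤ n) :
    lift h (gen n i) = e i := by
  have : lift h (E (Fin.ofNat (n + 1) i)) = e (Fin.ofNat (n + 1) i : Fin (n + 1)) := by
    simp [lift, E]
  rw [gen, this, val_ofNat hi]

theorem map_wd {B : Type*} [Ring B] [Algebra Cq B] (f : A →ₐ[Cq] B) (e : ℕ → A) (l : List ℕ) :
    f (wd e l) = wd (fun i => f (e i)) l := by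
  rw [wd, map_list_prod, List.map_map]
  rfl

theorem lift_wd {e : ℕ → A} {n : ℕ} (h : IsTL e n) {l : List ℕ} (hl : ∀ i ∈ l, i ≤ n) :
    lift h (wd (gen n) l) = wd e l := by
  rw [map_wd]
  exact wd_congr fun i hi => lift_gen h (hl i hi)

theorem incl_gen {m n : ℕ} (h : m ≤ n) {i : ℕ} (hi : i ≤ m) : incl h (gen m i) = gen n i := by
  rw [gen, incl_E, ← gen_val]
  congr 1
  exact val_ofNat hi

theorem incl_wd {m n : ℕ} (h : m ≤ n) {l : List ℕ} (hl : ∀ i ∈ l, i ≤ m) :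
    incl h (wd (gen m) l) = wd (gen n) l := by
  rw [map_wd]
  exact wd_congr fun i hi => incl_gen h (hl i hi)

theorem hom_ext {n : ℕ} {f g : TL n →ₐ[Cq] A} (h : ∀ i ≤ n, f (gen n i) = g (gen n i)) : f = g := by
  apply RingQuot.ringQuot_ext'
  apply FreeAlgebra.hom_ext
  funext i
  simpa [gen_val, E] using h i (by omega)

theorem lift_incl {e : ℕ → A} {m n : ℕ} (h : IsTL e n) (hm : m ≤ n) (x : TL m) :
    lift h (incl hm x) = lift (h.mono hm) x := by
  have : (lift h).comp (incl hm) = lift (h.mono hm) := hom_ext fun i hi => by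
    rw [AlgHom.comp_apply, incl_gen hm hi, lift_gen _ (hi.trans hm), lift_gen _ hi]
  exact DFunLike.congr_fun this x

end Hom

/-- The words span. -/
theorem induction_word {n : ℕ} {p : TL n → Prop}
    (hw : ∀ l : List ℕ, (∀ i ∈ l, i ≤ n) → p (wd (gen n) l))
    (hadd : ∀ x y, p x → p y → p (x + y)) (hsmul : ∀ (c : Cq) x, p x → p (c • x)) (x : TL n) :
    p x := by
  let S : Submodule Cq (TL n) :=
    Submodule.span Cq {x | ∃ l : List ℕ, (∀ i ∈ l, i ≤ n) ∧ x = wd (gen n) l}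
  have hp : ∀ x ∈ S, p x := by
    intro x hx
    induction hx using Submodule.span_induction with
    | mem x hx =>
      obtain ⟨l, hl, rfl⟩ := hx
      exact hw l hl
    | zero => simpa using hsmul 0 _ (hw [] (by simp))
    | add x y _ _ h1 h2 => exact hadd x y h1 h2
    | smul c x _ h => exact hsmul c x h
  apply hp
  obtain ⟨a, rfl⟩ := RingQuot.mkAlgHom_surjective Cq (Rel n) x
  have hmul : ∀ x ∈ S, ∀ y ∈ S, x * y ∈ S := by
    intro x hx y hy
    induction hx, hy using Submodule.span_induction₂ with
    | mem_mem x y hx hy =>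
      obtain ⟨l, hl, rfl⟩ := hx
      obtain ⟨l', hl', rfl⟩ := hy
      refine Submodule.subset_span ⟨l ++ l', ?_, (wd_append _ _).symm⟩
      intro i hi
      rcases List.mem_append.1 hi with hi | hi
      exacts [hl i hi, hl' i hi]
    | zero_left y hy => simp
    | zero_right x hx => simp
    | add_left x y z _ _ _ h1 h2 => rw [add_mul]; exact S.add_mem h1 h2
    | add_right x y z _ _ _ h1 h2 => rw [mul_add]; exact S.add_mem h1 h2
    | smul_left r x y _ _ h => rw [smul_mul_assoc]; exact S.smul_mem _ h
    | smul_right r x y _ _ h => rw [mul_smul_comm]; exact S.smul_mem _ h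
  have hone : (1 : TL n) ∈ S := Submodule.subset_span ⟨[], by simp, rfl⟩
  induction a using FreeAlgebra.induction with
  | grade0 r =>
    rw [AlgHom.commutes, Algebra.algebraMap_eq_smul_one]
    exact S.smul_mem _ hone
  | grade1 i =>
    exact Submodule.subset_span ⟨[(i : ℕ)], by simp; omega, by rw [wd_singleton, gen_val]; rfl⟩
  | mul a b ha hb => rw [map_mul]; exact hmul _ ha _ hb
  | add a b ha hb => rw [map_add]; exact S.add_mem ha hb

/-! ### Augmentation, reversal, and uniqueness of the projections -/

/-- The augmentation, which sends every `E_i` to `0`. -/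
def aug (n : ℕ) : TL n →ₐ[Cq] Cq :=
  lift (e := fun _ => 0) ⟨by simp, by simp, by simp⟩

theorem aug_gen {n i : ℕ} (hi : i ≤ n) : aug n (gen n i) = 0 := lift_gen _ hi

theorem aug_incl {m n : ℕ} (h : m ≤ n) (x : TL m) : aug n (incl h x) = aug m x :=
  lift_incl _ h x

theorem aug_wd {n : ℕ} {l : List ℕ} (hl : ∀ i ∈ l, i ≤ n) (hne : l ≠ []) :
    aug n (wd (gen n) l) = 0 := by
  obtain ⟨i, l, rfl⟩ := List.exists_cons_of_ne_nil hne
  rw [wd_cons, map_mul, aug_gen (hl i (by simp)), zero_mul]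

/-- Every nonempty word starts with a letter that kills `y`, so only the scalar part of `x`
survives. -/
theorem mul_of_mul_gen {n : ℕ} {y : TL n} (hy : ∀ i ≤ n, y * gen n i = 0) (x : TL n) :
    y * x = aug n x • y := by
  induction x using induction_word with
  | hw l hl =>
    rcases eq_or_ne l [] with rfl | hne
    · simp
    · rw [aug_wd hl hne, zero_smul]
      obtain ⟨i, l, rfl⟩ := List.exists_cons_of_ne_nil hne
      rw [wd_cons, ← mul_assoc, hy i (hl i (by simp)), zero_mul]
  | hadd x z hx hz => rw [mul_add, hx, hz, map_add, add_smul]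
  | hsmul c x hx => rw [mul_smul_comm, hx, map_smul, smul_eq_mul, smul_smul]

/-- The anti-automorphism fixing the generators. -/
def rev (n : ℕ) : TL n →ₐ[Cq] (TL n)ᵐᵒᵖ :=
  lift (e := fun i => MulOpposite.op (gen n i))
    ⟨fun i hi => by
      rw [← MulOpposite.op_mul, (isTL_gen n).sq i hi, MulOpposite.op_smul],
    fun i j hi hj h => by
      rw [← MulOpposite.op_mul, ← MulOpposite.op_mul, ← mul_assoc, (isTL_gen n).braid i j hi hj h],
    fun i j hi hj h => by
      rw [← MulOpposite.op_mul, ← MulOpposite.op_mul, (isTL_gen n).comm i j hi hj h]⟩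

theorem rev_gen {n i : ℕ} (hi : i ≤ n) : rev n (gen n i) = MulOpposite.op (gen n i) :=
  lift_gen _ hi

theorem aug_rev {n : ℕ} (x : TL n) : aug n (rev n x).unop = aug n x := by
  induction x using induction_word with
  | hw l hl =>
    rcases eq_or_ne l [] with rfl | hne
    · simp
    · obtain ⟨i, l, rfl⟩ := List.exists_cons_of_ne_nil hne
      have hi := hl i (by simp)
      rw [wd_cons, map_mul, MulOpposite.unop_mul, map_mul, map_mul, rev_gen hi,
        MulOpposite.unop_op, aug_gen hi, zero_mul, mul_zero]
  | hadd x z hx hz => rw [map_add, MulOpposite.unop_add, map_add, hx, hz, map_add]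
  | hsmul c x hx => rw [map_smul, MulOpposite.unop_smul, map_smul, hx, map_smul]

theorem mul_of_gen_mul {n : ℕ} {y : TL n} (hy : ∀ i ≤ n, gen n i * y = 0) (x : TL n) :
    x * y = aug n x • y := by
  induction x using induction_word with
  | hw l hl =>
    rcases eq_or_ne l [] with rfl | hne
    · simp
    · rw [aug_wd hl hne, zero_smul]
      obtain ⟨l, i, rfl⟩ := List.eq_nil_or_concat' l |>.resolve_left hne
      rw [wd_append, wd_singleton, mul_assoc, hy i (hl i (by simp)), mul_zero]
  | hadd x z hx hz => rw [add_mul, hx, hz, map_add, add_smul]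
  | hsmul c x hx => rw [smul_mul_assoc, hx, map_smul, smul_eq_mul, smul_smul]

/-- Let y' be the reversal of y. It is killed from the left, so y y' equals y by the first one-sided
rule and y' by the second. Hence y = y'. -/
theorem gen_mul_of_mul_gen {n : ℕ} {y : TL n} (hy : ∀ i ≤ n, y * gen n i = 0)
    (h1 : aug n y = 1) : ∀ i ≤ n, gen n i * y = 0 := by
  have h2 : ∀ i ≤ n, gen n i * (rev n y).unop = 0 := by
    intro i hi
    have := congrArg (fun z => (rev n z).unop) (hy i hi)
    simpa [rev_gen hi] using this
  have h3 : y = (rev n y).unop := by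
    have h4 := mul_of_mul_gen hy (rev n y).unop
    have h5 := mul_of_gen_mul h2 y
    rw [aug_rev, h1, one_smul] at h4
    rw [h1, one_smul] at h5
    exact h4.symm.trans h5
  intro i hi
  have h6 := h2 i hi
  rwa [← h3] at h6

/-- A family is a family of Jones–Wenzl projections as soon as its members are normalized and
annihilated by right multiplication with the generators. -/
theorem isJonesWenzl_of_mul_gen {Q : (n : ℕ) → TL n} (h : ∀ n i, i ≤ n → Q n * gen n i = 0)
    (h1 : ∀ n, aug n (Q n) = 1) : IsJonesWenzl Q where
  ne_zero n h0 := by simpa [h0] using h1 n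
  mul_incl n i hi := by
    rw [mul_of_mul_gen (h n), aug_incl, h1, one_smul]
  incl_mul n i hi := by
    rw [mul_of_gen_mul (gen_mul_of_mul_gen (h n) (h1 n)), aug_incl, h1, one_smul]
  E_mul n i := by
    rw [← gen_val]
    exact gen_mul_of_mul_gen (h n) (h1 n) _ (by omega)
  mul_E n i := by
    rw [← gen_val]
    exact h n _ (by omega)

theorem IsJonesWenzl.aug_eq {Q : (n : ℕ) → TL n} (h : IsJonesWenzl Q) (n : ℕ) :
    aug n (Q n) = 1 := by
  have h1 : ∀ i ≤ n, Q n * gen n i = 0 := fun i hi => h.mul_E n _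
  -- The axiom with i = n is idempotency, which becomes aug(Q_n) Q_n = Q_n.
  have h2 : Q n * Q n = Q n := by
    have h3 := h.mul_incl n n le_rfl
    rwa [show incl le_rfl (Q n) = Q n from
      DFunLike.congr_fun (hom_ext (g := AlgHom.id Cq (TL n)) fun i hi => incl_gen le_rfl hi)
        (Q n)] at h3
  rw [mul_of_mul_gen h1] at h2
  have h3 : aug n (Q n) ≠ 0 := by
    intro h0
    rw [h0, zero_smul] at h2
    exact h.ne_zero n h2.symm
  have h4 := congrArg (aug n) h2
  rw [map_smul, smul_eq_mul] at h4
  exact mul_right_cancel₀ h3 (h4.trans (one_mul _).symm)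

theorem IsJonesWenzl.unique {Q Q' : (n : ℕ) → TL n} (h : IsJonesWenzl Q) (h' : IsJonesWenzl Q') :
    Q = Q' := by
  funext n
  have h1 := mul_of_mul_gen (fun i _ => h.mul_E n (Fin.ofNat (n + 1) i)) (Q' n)
  have h2 := mul_of_gen_mul (fun i _ => h'.E_mul n (Fin.ofNat (n + 1) i)) (Q n)
  rw [h'.aug_eq, one_smul] at h1
  rw [h.aug_eq, one_smul] at h2
  rw [← h1, h2]

/-! ### Two representations on a spin chain -/

/-- Configurations of bits. -/
abbrev Conf : Type := ℕ → Bool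

/-- The configuration `x` with the bits `i` and `i + 1` replaced. -/
def put (x : Conf) (i : ℕ) (a b : Bool) : Conf :=
  fun k => if k = i then a else if k = i + 1 then b else x k

theorem put_left (x : Conf) (i : ℕ) (a b : Bool) : put x i a b i = a := by simp [put]

theorem put_right (x : Conf) (i : ℕ) (a b : Bool) : put x i a b (i + 1) = b := by simp [put]

theorem put_other (x : Conf) {i k : ℕ} (a b : Bool) (h1 : k ≠ i) (h2 : k ≠ i + 1) :
    put x i a b k = x k := by simp [put, h1, h2]

theorem put_put (x : Conf) (i : ℕ) (a b c d : Bool) : put (put x i a b) i c d = put x i c d := by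
  funext k
  simp only [put]
  split_ifs <;> rfl

theorem put_comm (x : Conf) {i j : ℕ} (h : i + 2 ≤ j) (a b c d : Bool) :
    put (put x i a b) j c d = put (put x j c d) i a b := by
  funext k
  simp only [put]
  split_ifs <;> first | rfl | omega

theorem put_put_succ_put {x : Conf} {i : ℕ} {v : Bool} (h : x (i + 2) = v) (a b c a' b' : Bool) :
    put (put (put x i a b) (i + 1) c v) i a' b' = put x i a' b' := by
  funext k
  simp only [put]
  split_ifs <;> simp_all

theorem put_succ_put_put_succ {x : Conf} {i : ℕ} {v : Bool} (h : x i = v) (a b c a' b' : Bool) :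
    put (put (put x (i + 1) a b) i v c) (i + 1) a' b' = put x (i + 1) a' b' := by
  funext k
  simp only [put]
  split_ifs <;> simp_all

/-- The coefficients of the cup vector. -/
def cup : Bool → Bool → Cq
  | false, true => 1
  | true, false => -RatFunc.X
  | _, _ => 0

theorem cup_ft : cup false true = 1 := rfl

theorem cup_tf : cup true false = -RatFunc.X := rfl

theorem cup_self (a : Bool) : cup a a = 0 := by cases a <;> rfl

abbrev Op : Type := Module.End Cq (Conf → Cq)

/-- The Temperley–Lieb operator on the tensor factors `i` and `i + 1`. -/
def opU (i : ℕ) : Op where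
  toFun f x := cup (x i) (x (i + 1)) *
    (-(RatFunc.X : Cq)⁻¹ * f (put x i false true) + f (put x i true false))
  map_add' f g := by funext x; simp only [Pi.add_apply]; ring
  map_smul' c f := by funext x; simp only [Pi.smul_apply, smul_eq_mul, RingHom.id_apply]; ring

theorem opU_apply (i : ℕ) (f : Conf → Cq) (x : Conf) : opU i f x = cup (x i) (x (i + 1)) *
    (-(RatFunc.X : Cq)⁻¹ * f (put x i false true) + f (put x i true false)) := rfl

/-- The operator flipping bit `1`. -/
def opB : Op where
  toFun f x := f (Function.update x 1 (!x 1))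
  map_add' _ _ := rfl
  map_smul' _ _ := rfl

theorem opB_apply (f : Conf → Cq) (x : Conf) : opB f x = f (Function.update x 1 (!x 1)) := rfl

theorem opB_mul_self : opB * opB = 1 := by
  ext f x
  simp [Module.End.mul_apply, opB_apply]

theorem opU_sq (i : ℕ) : opU i * opU i = dl • opU i := by
  refine LinearMap.ext fun f => funext fun x => ?_
  have hX := X_ne_zero
  simp only [Module.End.mul_apply, LinearMap.smul_apply, Pi.smul_apply, opU_apply, put_put,
    put_left, put_right, cup_ft, cup_tf, smul_eq_mul, dl, qInt_two, pInt, zpow_one, zpow_neg]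
  field_simp
  ring

theorem opU_braid (i : ℕ) : opU i * opU (i + 1) * opU i = opU i := by
  refine LinearMap.ext fun f => funext fun x => ?_
  have hX := X_ne_zero
  obtain ⟨v, hv⟩ : ∃ v, x (i + 2) = v := ⟨_, rfl⟩
  have h1 : ∀ a b, put x i a b (i + 1 + 1) = v := fun a b => by
    rw [put_other _ _ _ (by omega) (by omega), hv]
  have h2 : ∀ a b c d, put (put x i a b) (i + 1) c d i = a := fun a b c d => by
    rw [put_other _ _ _ (by omega) (by omega), put_left]
  simp only [Module.End.mul_apply, opU_apply, put_left, put_right, h1, h2]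
  cases v <;> simp only [put_put_succ_put hv, cup_ft, cup_tf, cup_self] <;> field_simp <;> ring

theorem opU_braid' (i : ℕ) : opU (i + 1) * opU i * opU (i + 1) = opU (i + 1) := by
  refine LinearMap.ext fun f => funext fun x => ?_
  have hX := X_ne_zero
  obtain ⟨v, hv⟩ : ∃ v, x i = v := ⟨_, rfl⟩
  have h1 : ∀ a b, put x (i + 1) a b i = v := fun a b => by
    rw [put_other _ _ _ (by omega) (by omega), hv]
  have h2 : ∀ a b c d, put (put x (i + 1) a b) i c d (i + 1 + 1) = b := fun a b c d => by
    rw [put_other _ _ _ (by omega) (by omega), put_right]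
  simp only [Module.End.mul_apply, opU_apply, put_left, put_right, h1, h2]
  cases v <;> simp only [put_succ_put_put_succ hv, cup_ft, cup_tf, cup_self] <;> field_simp <;> ring

theorem opU_comm {i j : ℕ} (h : i + 2 ≤ j) : opU i * opU j = opU j * opU i := by
  refine LinearMap.ext fun f => funext fun x => ?_
  have h1 : ∀ a b, put x i a b j = x j := fun a b => put_other _ _ _ (by omega) (by omega)
  have h2 : ∀ a b, put x i a b (j + 1) = x (j + 1) := fun a b =>
    put_other _ _ _ (by omega) (by omega)
  have h3 : ∀ a b, put x j a b i = x i := fun a b => put_other _ _ _ (by omega) (by omega)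
  have h4 : ∀ a b, put x j a b (i + 1) = x (i + 1) := fun a b =>
    put_other _ _ _ (by omega) (by omega)
  simp only [Module.End.mul_apply, opU_apply, h1, h2, h3, h4, put_comm x h]
  ring

theorem opB_comm {i : ℕ} (h : 2 ≤ i) : opB * opU i = opU i * opB := by
  refine LinearMap.ext fun f => funext fun x => ?_
  have h1 : ∀ a b, put x i a b 1 = x 1 := fun a b => put_other _ _ _ (by omega) (by omega)
  have h2 : ∀ a b, put (Function.update x 1 (!x 1)) i a b =
      Function.update (put x i a b) 1 (!x 1) := fun a b => by
    funext k
    simp only [put, Function.update_apply]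
    split_ifs <;> first | rfl | omega
  simp only [Module.End.mul_apply, opU_apply, opB_apply, h1, h2]
  rw [Function.update_of_ne (by omega), Function.update_of_ne (by omega)]

/-- The image of `opU 1` lives on configurations with different bits 1 and 2, and `opU 1` only looks
at such configurations. Flipping bit 1 makes the two bits equal. This kills the dotted loop in `eB`.
-/
theorem opU_opB_opU : opU 1 * opB * opU 1 = 0 := by
  refine LinearMap.ext fun f => funext fun x => ?_
  have h1 : ∀ a b v, Function.update (put x 1 a b) 1 v (1 + 1) = b := fun a b v => by
    rw [Function.update_of_ne (by omega), put_right]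
  simp only [Module.End.mul_apply, opU_apply, opB_apply, put_left, h1, Function.update_self]
  simp [cup_self]

/-- The images of the generators in the representation that does not see the dots. -/
def eA (i : ℕ) : Op := opU (max i 1)

/-- The images of the generators in the representation in which dotted loops vanish. -/
def eB (i : ℕ) : Op := if i = 0 then opB * opU 1 * opB else opU i

theorem eA_zero : eA 0 = opU 1 := rfl

theorem eA_pos {i : ℕ} (h : 1 ≤ i) : eA i = opU i := by
  rw [eA, max_eq_left h]

theorem eB_zero : eB 0 = opB * opU 1 * opB := rfl

theorem eB_pos {i : ℕ} (h : 1 ≤ i) : eB i = opU i := by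
  rw [eB, if_neg (by omega)]

theorem isTL_eA (n : ℕ) : IsTL eA n where
  sq i _ := opU_sq _
  braid i j _ _ h := by
    rcases h with ⟨h1, rfl⟩ | ⟨h1, rfl⟩ | ⟨rfl, rfl⟩ | ⟨rfl, rfl⟩
    · rw [eA_pos h1, eA_pos (by omega), opU_braid]
    · rw [eA_pos h1, eA_pos (by omega), opU_braid']
    · exact opU_braid 1
    · exact opU_braid' 1
  comm i j _ _ h := by
    have : max i 1 = max j 1 ∨ max i 1 + 2 ≤ max j 1 ∨ max j 1 + 2 ≤ max i 1 := by
      unfold Adj at h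
      omega
    rcases this with h1 | h1 | h1
    · rw [eA, eA, h1]
    · exact opU_comm h1
    · exact (opU_comm h1).symm

theorem eB_zero_mul_one : eB 0 * eB 1 = 0 := by
  rw [eB_zero, eB_pos le_rfl, mul_assoc, mul_assoc, ← mul_assoc (opU 1), opU_opB_opU, mul_zero]

theorem eB_one_mul_zero : eB 1 * eB 0 = 0 := by
  rw [eB_zero, eB_pos le_rfl, ← mul_assoc, ← mul_assoc, opU_opB_opU, zero_mul]

theorem opB_conj (x : Op) : opB * (opB * x) = x := by
  rw [← mul_assoc, opB_mul_self, one_mul]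

theorem isTL_eB (n : ℕ) : IsTL eB n where
  sq i _ := by
    rcases Nat.eq_zero_or_pos i with rfl | hi
    · rw [eB_zero]
      simp only [mul_assoc, opB_conj]
      rw [← mul_assoc (opU 1), opU_sq, smul_mul_assoc, mul_smul_comm]
    · rw [eB_pos hi, opU_sq]
  braid i j _ _ h := by
    rcases h with ⟨h1, rfl⟩ | ⟨h1, rfl⟩ | ⟨rfl, rfl⟩ | ⟨rfl, rfl⟩
    · rw [eB_pos h1, eB_pos (by omega), opU_braid]
    · rw [eB_pos h1, eB_pos (by omega), opU_braid']
    · rw [eB_zero, eB_pos (by omega), mul_assoc _ opB (opU 2), opB_comm le_rfl]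
      simp only [mul_assoc, opB_conj]
      rw [← mul_assoc (opU 2), ← mul_assoc (opU 1), ← mul_assoc (opU 1), opU_braid 1]
    · have h1 : opU 2 * (opU 1 * opU 2) = opU 2 := (mul_assoc _ _ _).symm.trans (opU_braid' 1)
      have h2 := opB_comm (le_refl 2)
      rw [eB_zero, eB_pos (by omega)]
      calc opU 2 * (opB * opU 1 * opB) * opU 2 = (opU 2 * opB) * opU 1 * (opB * opU 2) := by
            simp only [mul_assoc]
        _ = (opB * opU 2) * opU 1 * (opU 2 * opB) := by rw [h2]
        _ = opB * (opU 2 * (opU 1 * opU 2)) * opB := by simp only [mul_assoc]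
        _ = opU 2 := by rw [h1, h2, mul_assoc, opB_mul_self, mul_one]
  comm i j _ _ h := by
    have aux : ∀ j, ¬ Adj 0 j → eB 0 * eB j = eB j * eB 0 := by
      intro j hj
      have : j = 0 ∨ j = 1 ∨ 3 ≤ j := by
        unfold Adj at hj
        omega
      rcases this with rfl | rfl | h1
      · rfl
      · rw [eB_zero_mul_one, eB_one_mul_zero]
      · have c1 : Commute opB (opU j) := opB_comm (by omega)
        have c2 : Commute (opU 1) (opU j) := opU_comm h1
        rw [eB_zero, eB_pos (i := j) (by omega)]
        exact (c1.mul_left c2).mul_left c1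
    rcases Nat.eq_zero_or_pos i with rfl | hi
    · exact aux j h
    rcases Nat.eq_zero_or_pos j with rfl | hj
    · exact (aux i (by unfold Adj at h ⊢; omega)).symm
    rw [eB_pos hi, eB_pos hj]
    have : i = j ∨ i + 2 ≤ j ∨ j + 2 ≤ i := by
      unfold Adj at h
      omega
    rcases this with rfl | h1 | h1
    · rfl
    · exact opU_comm h1
    · exact (opU_comm h1).symm

/-- The operators on functions of the configuration that act on the bit `k` only, as the
composition of a substitution and the multiplication by a function. -/
def opT (k : ℕ) (a : Bool → Cq) (s : Bool → Bool) : Op where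
  toFun f x := a (x k) * f (Function.update x k (s (x k)))
  map_add' f g := by funext x; simp only [Pi.add_apply]; ring
  map_smul' c f := by funext x; simp only [Pi.smul_apply, smul_eq_mul, RingHom.id_apply]; ring

theorem opT_apply (k : ℕ) (a : Bool → Cq) (s : Bool → Bool) (f : Conf → Cq) (x : Conf) :
    opT k a s f x = a (x k) * f (Function.update x k (s (x k))) := rfl

theorem opT_comm_opU {i k : ℕ} (h : i + 2 ≤ k) (a : Bool → Cq) (s : Bool → Bool) :
    Commute (opT k a s) (opU i) := by
  refine LinearMap.ext fun f => funext fun x => ?_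
  have h1 : ∀ a b, put x i a b k = x k := fun a b => put_other _ _ _ (by omega) (by omega)
  have h2 : ∀ v a b, put (Function.update x k v) i a b = Function.update (put x i a b) k v :=
    fun v a b => by
      funext k
      simp only [put, Function.update_apply]
      split_ifs <;> first | rfl | omega
  simp only [Module.End.mul_apply, opU_apply, opT_apply, h1, h2]
  rw [Function.update_of_ne (by omega), Function.update_of_ne (by omega)]
  ring

theorem opT_comm_opB {k : ℕ} (h : 2 ≤ k) (a : Bool → Cq) (s : Bool → Bool) :
    Commute (opT k a s) opB := by
  refine LinearMap.ext fun f => funext fun x => ?_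
  simp only [Module.End.mul_apply, opB_apply, opT_apply]
  rw [Function.update_of_ne (by omega), Function.update_of_ne (by omega),
    Function.update_comm (by omega)]

theorem opT_comm_eA {i k : ℕ} (h : i + 2 ≤ k) (h3 : 3 ≤ k) (a : Bool → Cq) (s : Bool → Bool) :
    Commute (opT k a s) (eA i) :=
  opT_comm_opU (by omega) a s

theorem opT_comm_eB {i k : ℕ} (h : i + 2 ≤ k) (h3 : 3 ≤ k) (a : Bool → Cq) (s : Bool → Bool) :
    Commute (opT k a s) (eB i) := by
  rcases Nat.eq_zero_or_pos i with rfl | hi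
  · exact ((opT_comm_opB (by omega) a s).mul_right (opT_comm_opU (by omega) a s)).mul_right
      (opT_comm_opB (by omega) a s)
  · rw [eB_pos hi]
    exact opT_comm_opU h a s

/-- An operator that only acts on the bits below `n + 1` is determined by its product with
`opU n`. -/
theorem eq_zero_of_mul_opU {n : ℕ} {y : Op} (hy : ∀ a s, Commute (opT (n + 1) a s) y)
    (h : y * opU n = 0) : y = 0 := by
  refine LinearMap.ext fun f => ?_
  have hX := X_ne_zero
  have hc : ∀ a, cup a (!a) ≠ 0 := by
    intro a
    cases a
    · exact one_ne_zero
    · exact neg_ne_zero.mpr hX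
  -- Every function is a sum of terms t (`opU n` g) with t acting on bit n + 1 only. Indeed `opU n`
  -- (g a b) is the cup in the bits n, n + 1 times f with these bits fixed to a, b. Setting bit n +
  -- 1 to the negation of a inside the cup selects bit n equal to a, and the factor in t selects bit
  -- n + 1 equal to b. As y commutes with t, it kills each term.
  let g : Bool → Bool → Conf → Cq := fun a b x =>
    if x n = true ∧ x (n + 1) = false then f (put x n a b) else 0
  let t : Bool → Bool → Op := fun a b =>
    opT (n + 1) (fun v => if v = b then (cup a (!a))⁻¹ else 0) (fun _ => !a)
  have key : f = ∑ a : Bool, ∑ b : Bool, t a b (opU n (g a b)) := by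
    funext x
    have h1 : ∀ v a b, put (put (Function.update x (n + 1) v) n true false) n a b = put x n a b :=
      fun v a b => by
        funext k
        simp only [put, Function.update_apply]
        split_ifs <;> rfl
    have h2 : put x n (x n) (x (n + 1)) = x := by
      funext k
      simp only [put]
      split_ifs <;> simp_all
    simp only [Finset.sum_apply, t, g, opT_apply, opU_apply, Function.update_self,
      Function.update_of_ne (show n ≠ n + 1 by omega), put_left, put_right, h1]
    cases hx : x n <;> cases hx' : x (n + 1) <;> rw [hx, hx'] at h2 <;>
      simp [cup_self, cup_ft, cup_tf, h2] <;> field_simp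
  rw [key, LinearMap.zero_apply]
  simp only [map_sum]
  refine Finset.sum_eq_zero fun a _ => Finset.sum_eq_zero fun b _ => ?_
  have h1 := LinearMap.congr_fun (hy (fun v => if v = b then (cup a (!a))⁻¹ else 0) (fun _ => !a))
    (opU n (g a b))
  have h2 := LinearMap.congr_fun h (g a b)
  simp only [Module.End.mul_apply, LinearMap.zero_apply] at h1 h2 ⊢
  rw [← h1, h2, map_zero]

theorem opU_ne_zero (i : ℕ) : opU i ≠ 0 := by
  intro h
  have h1 := congrFun (LinearMap.congr_fun h fun _ => 1) (put (fun _ => false) i false true)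
  simp only [opU_apply, put_left, put_right, cup_ft, LinearMap.zero_apply, Pi.zero_apply] at h1
  have hX := X_ne_zero
  apply X_pow_ne_one (k := 1) one_pos
  field_simp at h1
  linear_combination h1

/-! ### The two auxiliary families of words -/

section

variable {A : Type*} [Ring A]

/-- The words `e_0 e_1 e_3 e_4 ⋯ e_{k+2}`. -/
def zB (e : ℕ → A) : ℕ → A
  | 0 => e 0 * e 1
  | k + 1 => zB e k * e (k + 3)

/-- The words `e_0 e_1 (e_3 e_2) (e_4 e_3) ⋯ (e_{k+2} e_{k+1})`. -/
def zC (e : ℕ → A) : ℕ → A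
  | 0 => e 0 * e 1
  | k + 1 => zC e k * e (k + 3) * e (k + 2)

variable {e : ℕ → A}

theorem zB_succ (k : ℕ) : zB e (k + 1) = zB e k * e (k + 3) := rfl

theorem zC_succ (k : ℕ) : zC e (k + 1) = zC e k * e (k + 3) * e (k + 2) := rfl

theorem isWord_zB (k : ℕ) : IsWord e (k + 2) (zB e k) := by
  induction k with
  | zero => exact (isWord_gen (by omega)).mul (isWord_gen (by omega))
  | succ k ih => exact (ih.mono (by omega)).mul (isWord_gen (by omega))

theorem isWord_zC (k : ℕ) : IsWord e (k + 2) (zC e k) := by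
  induction k with
  | zero => exact (isWord_gen (by omega)).mul (isWord_gen (by omega))
  | succ k ih =>
    exact ((ih.mono (by omega)).mul (isWord_gen (by omega))).mul (isWord_gen (by omega))

theorem IsWord.down {n k : ℕ} (hk : k ≠ 0) : IsWord e n (down e n k) := by
  obtain ⟨k, rfl⟩ := Nat.exists_eq_succ_of_ne_zero hk
  clear hk
  induction k with
  | zero => simpa [TypeD.down] using isWord_gen le_rfl
  | succ k ih => exact ih.mul (isWord_gen (by omega))

end

section Images

variable {A B : Type*} [Ring A] [Algebra Cq A] [Ring B] [Algebra Cq B]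

theorem map_down (f : A →ₐ[Cq] B) {e : ℕ → A} {e' : ℕ → B} {n k : ℕ}
    (h : ∀ i ≤ n, f (e i) = e' i) : f (down e n k) = down e' n k := by
  induction k with
  | zero => simp [down]
  | succ k ih => rw [down_succ, map_mul, ih, h _ (by omega), down_succ]

theorem map_up (f : A →ₐ[Cq] B) {e : ℕ → A} {e' : ℕ → B} {j : ℕ}
    (h : ∀ i ≤ j, f (e i) = e' i) : f (up e j) = up e' j := by
  induction j with
  | zero => exact h 0 le_rfl
  | succ j ih => rw [up_succ, map_mul, ih fun i hi => h i (by omega), h _ le_rfl, up_succ]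

theorem map_vee (f : A →ₐ[Cq] B) {e : ℕ → A} {e' : ℕ → B} {n j : ℕ} (hj : j ≤ n)
    (h : ∀ i ≤ n, f (e i) = e' i) : f (vee e n j) = vee e' n j := by
  rw [vee, map_mul, map_down f h, map_up f fun i hi => h i (hi.trans hj), vee]

theorem map_zB (f : A →ₐ[Cq] B) {e : ℕ → A} {e' : ℕ → B} {k : ℕ}
    (h : ∀ i ≤ k + 2, f (e i) = e' i) : f (zB e k) = zB e' k := by
  induction k with
  | zero => rw [zB, map_mul, h 0 (by omega), h 1 (by omega), zB]
  | succ k ih => rw [zB_succ, map_mul, ih fun i hi => h i (by omega), h _ le_rfl, zB_succ]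

theorem map_zC (f : A →ₐ[Cq] B) {e : ℕ → A} {e' : ℕ → B} {k : ℕ}
    (h : ∀ i ≤ k + 2, f (e i) = e' i) : f (zC e k) = zC e' k := by
  induction k with
  | zero => rw [zC, map_mul, h 0 (by omega), h 1 (by omega), zC]
  | succ k ih =>
    rw [zC_succ, map_mul, map_mul, ih fun i hi => h i (by omega), h _ le_rfl, h _ (by omega),
      zC_succ]

end Images

/-! ### Cancellation and right descents in a representation -/

section Separated

variable {B : Type*} [Ring B] [Algebra Cq B]

/-- The subalgebra generated by `ε 0, …, ε m`, as the image of `TL m`. -/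
def levelAlg {ε : ℕ → B} (h : ∀ n, IsTL ε n) (m : ℕ) : Subalgebra Cq B := (lift (h m)).range

/-- A representation of the Temperley–Lieb algebras of all types `D_{n+1}` in which
right multiplication by `ε n` is injective on the image of `TL (n - 1)`. -/
structure IsSeparated (ε : ℕ → B) : Prop where
  isTL : ∀ n, IsTL ε n
  cancel : ∀ {n : ℕ}, ∀ {y : B}, y ∈ levelAlg isTL (n + 1) → y * ε (n + 2) = 0 → y = 0

variable {ε : ℕ → B}

theorem wd_mem (h : ∀ n, IsTL ε n) {m : ℕ} {l : List ℕ} (hl : ∀ i ∈ l, i ≤ m) :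
    wd ε l ∈ levelAlg h m := ⟨wd (gen m) l, lift_wd _ hl⟩

theorem IsWord.mem (h : ∀ n, IsTL ε n) {m : ℕ} {x : B} (hx : IsWord ε m x) :
    x ∈ levelAlg h m := by
  obtain ⟨l, hl, -, rfl⟩ := hx
  exact wd_mem h hl

theorem levelAlg_mono (h : ∀ n, IsTL ε n) {m m' : ℕ} (hm : m ≤ m') :
    levelAlg h m ≤ levelAlg h m' := by
  rintro _ ⟨x, rfl⟩
  exact ⟨incl hm x, lift_incl (h m') hm x⟩

theorem levelAlg_comm (h : ∀ n, IsTL ε n) {m i : ℕ} (h1 : m + 2 ≤ i) (h2 : 3 ≤ i) {y : B}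
    (hy : y ∈ levelAlg h m) : y * ε i = ε i * y := by
  obtain ⟨x, rfl⟩ := hy
  change lift (h m) x * ε i = ε i * lift (h m) x
  induction x using induction_word with
  | hw l hl =>
    rw [lift_wd _ hl]
    rcases eq_or_ne l [] with rfl | hne
    · simp
    · exact (h i).wd_comm ⟨l, hl, hne, rfl⟩ h1 h2 le_rfl
  | hadd x y hx hy => rw [map_add, add_mul, mul_add, hx, hy]
  | hsmul c x hx => rw [map_smul, smul_mul_assoc, mul_smul_comm, hx]

theorem smul_eq_zero_of_dl {y : B} (h : (dl * dl) • y = y) : y = 0 := by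
  by_contra h0
  exact dl_sq_ne_one (smul_left_injective Cq h0 (h.trans (one_smul Cq y).symm))

/-- Right multiplication by adjacent generators cannot both scale an element by `δ`. -/
theorem IsTL.eq_zero_of_adj {n i j : ℕ} (h : IsTL ε n) (hi : i ≤ n) (hj : j ≤ n) (hij : Adj i j)
    {z : B} (h1 : z * ε i = dl • z) (h2 : z * ε j = dl • z) : z = 0 := by
  have h3 : z * (ε i * ε j * ε i) = z * ε i := by rw [h.braid i j hi hj hij]
  rw [← mul_assoc, ← mul_assoc, h1, smul_mul_assoc, h2, smul_mul_assoc, smul_mul_assoc, h1] at h3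
  apply smul_eq_zero_of_dl
  have h4 := smul_right_injective B dl_ne_zero h3
  rwa [smul_smul] at h4

/-- Sandwich `y * ε (n + 2) = dl • y` between two factors `ε (n + 3)`, which commute with `y`. The
braid relation gives y ε_{n+3} = δ² y ε_{n+3}; hence this product vanishes and can be cancelled. -/
theorem IsSeparated.eq_zero_of_scaled (h : IsSeparated ε) {n : ℕ} {y : B}
    (hy : y ∈ levelAlg h.isTL (n + 1)) (h1 : y * ε (n + 2) = dl • y) : y = 0 := by
  apply h.cancel (n := n + 1) (levelAlg_mono h.isTL (by omega) hy)
  have hc := levelAlg_comm h.isTL (i := n + 3) (by omega) (by omega) hy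
  have hb := (h.isTL (n + 3)).braid (n + 3) (n + 2) (by omega) (by omega) (by unfold Adj; omega)
  have hs := (h.isTL (n + 3)).sq (n + 3) (by omega)
  apply smul_eq_zero_of_dl
  have h2 : ε (n + 3) * (y * ε (n + 2)) * ε (n + 3) = ε (n + 3) * (dl • y) * ε (n + 3) := by
    rw [h1]
  rw [← mul_assoc, ← hc, mul_assoc, mul_assoc, ← mul_assoc (ε (n + 3)), hb, mul_smul_comm, ← hc,
    smul_mul_assoc, mul_assoc, hs, mul_smul_comm, smul_smul] at h2
  exact h2.symm

theorem mem_gen (h : ∀ n, IsTL ε n) {m i : ℕ} (hi : i ≤ m) : ε i ∈ levelAlg h m :=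
  (isWord_gen hi).mem h

/-- Cancellation of `ε_n ε_{n-1} ⋯`. -/
theorem IsSeparated.cancel_down (h : IsSeparated ε) {n k : ℕ} (hk : k < n + 2) {y : B}
    (hy : y ∈ levelAlg h.isTL (n + 1)) (h1 : y * down ε (n + 2) k = 0) : y = 0 := by
  have hT := h.isTL (n + 2)
  induction k with
  | zero => simpa [down] using h1
  | succ k ih =>
    cases k with
    | zero =>
      apply h.cancel hy
      simpa [down] using h1
    | succ k =>
      apply ih (by omega)
      rw [← hT.down_back (by omega), ← mul_assoc, h1, zero_mul]

theorem IsSeparated.cancel_fork (h : IsSeparated ε) {n a : ℕ} (ha : a ≤ 1) {y : B}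
    (hy : y ∈ levelAlg h.isTL (n + 1)) (h1 : y * (down ε (n + 2) (n + 1) * ε a) = 0) : y = 0 := by
  apply h.cancel_down (k := n + 1) (by omega) hy
  have := (h.isTL (n + 2)).fork_two (by omega) ha
  rw [show n + 2 - 1 = n + 1 by omega] at this
  rw [← this, ← mul_assoc, h1, zero_mul]

theorem zB_stay (h : ∀ n, IsTL ε n) (k : ℕ) : zB ε (k + 1) * ε (k + 3) = dl • zB ε (k + 1) := by
  rw [zB_succ, mul_assoc, (h (k + 3)).sq _ le_rfl, mul_smul_comm]

theorem zC_stay (h : ∀ n, IsTL ε n) (k : ℕ) : zC ε (k + 1) * ε (k + 2) = dl • zC ε (k + 1) := by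
  rw [zC_succ, mul_assoc, (h (k + 2)).sq _ le_rfl, mul_smul_comm]

theorem zC_back (h : ∀ n, IsTL ε n) (k : ℕ) :
    zC ε (k + 1) * ε (k + 3) = zC ε k * ε (k + 3) := by
  rw [zC_succ, mul_assoc, mul_assoc, ← mul_assoc (ε (k + 3)),
    (h (k + 3)).braid _ _ (by omega) (by omega) (by unfold Adj; omega)]

theorem IsSeparated.zB_ne_zero (h : IsSeparated ε) (h0 : ε 0 * ε 1 ≠ 0) (k : ℕ) :
    zB ε k ≠ 0 := by
  induction k with
  | zero => exact h0
  | succ k ih => exact fun h1 => ih (h.cancel (n := k + 1) ((isWord_zB k).mem h.isTL) h1)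

theorem IsSeparated.zC_ne_zero (h : IsSeparated ε) (h0 : ε 0 * ε 1 ≠ 0) (k : ℕ) :
    zC ε k ≠ 0 := by
  induction k with
  | zero => exact h0
  | succ k ih =>
    intro h1
    apply ih (h.cancel (n := k + 1) ((isWord_zC k).mem h.isTL) _)
    rw [← zC_back h.isTL, h1, zero_mul]

theorem IsSeparated.zero_descent (h : IsSeparated ε) (h0 : ε 0 * ε 1 ≠ 0) :
    ε 0 * ε 1 * ε 2 ≠ dl • (ε 0 * ε 1) := by
  intro h1
  have h2 : ε 0 * ε 1 * ε 1 = dl • (ε 0 * ε 1) := by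
    rw [mul_assoc, (h.isTL 1).sq 1 le_rfl, mul_smul_comm]
  exact h0 ((h.isTL 2).eq_zero_of_adj (by omega) le_rfl (by unfold Adj; omega) h2 h1)

/-- The last letter k + 3 is a descent, so its neighbour k + 2 is not. Smaller letters commute past
it, and cancelling it reduces to the shorter word. -/
theorem IsSeparated.descent_zB (h : IsSeparated ε) (h0 : ε 0 * ε 1 ≠ 0) {k j : ℕ}
    (hj : j ≤ k + 2) (h1 : zB ε k * ε j = dl • zB ε k) : j ≤ 1 ∨ (k ≠ 0 ∧ j = k + 2) := by
  induction k with
  | zero =>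
    rcases hj.eq_or_lt with rfl | hj
    · exact (h.zero_descent h0 h1).elim
    · omega
  | succ k ih =>
    rcases lt_or_ge j (k + 2) with h2 | h2
    · have h3 : zB ε k * ε j = dl • zB ε k := by
        have hz := (isWord_zB k).mem h.isTL
        rw [zB_succ, mul_assoc, (h.isTL (k + 3)).comm (k + 3) j le_rfl (by omega)
          (by unfold Adj; omega), ← mul_assoc, ← smul_mul_assoc, ← sub_eq_zero, ← sub_mul] at h1
        refine sub_eq_zero.1 (h.cancel (n := k + 1) ?_ h1)
        exact sub_mem (mul_mem hz (mem_gen _ (by omega))) ((levelAlg _ _).smul_mem hz _)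
      have := ih (by omega) h3
      omega
    · rcases hj.eq_or_lt with rfl | hj
      · omega
      · obtain rfl : j = k + 2 := by omega
        exact (h.zB_ne_zero h0 (k + 1) ((h.isTL (k + 3)).eq_zero_of_adj (by omega) (by omega)
          (by unfold Adj; omega) h1 (zB_stay h.isTL k))).elim

/-- The last letter k + 2 is a descent, which rules out its neighbours. For a smaller letter,
multiplication by the top generator turns `zC` into the previous zigzag by `zC_back`, and
cancellation contradicts the induction hypothesis. -/
theorem IsSeparated.descent_zC (h : IsSeparated ε) (h0 : ε 0 * ε 1 ≠ 0) {k j : ℕ}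
    (hj : j ≤ k + 3) (h1 : zC ε (k + 1) * ε j = dl • zC ε (k + 1)) : j = k + 2 := by
  have hadj : ∀ k j, j ≤ k + 3 → zC ε (k + 1) * ε j = dl • zC ε (k + 1) → ¬ Adj j (k + 2) :=
    fun k j hj h1 ha => h.zC_ne_zero h0 (k + 1)
      ((h.isTL (k + 3)).eq_zero_of_adj hj (by omega) ha h1 (zC_stay h.isTL k))
  induction k generalizing j with
  | zero =>
    have := hadj 0 j hj h1
    unfold Adj at this
    omega
  | succ k ih =>
    by_contra hne
    have h2 := hadj (k + 1) j hj h1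
    have h3 : j ≤ k + 1 := by
      unfold Adj at h2
      omega
    have h4 : zC ε (k + 1) * ε j = dl • zC ε (k + 1) := by
      have hz := (isWord_zC (k + 1)).mem h.isTL
      have hT := h.isTL (k + 4)
      have h5 := congrArg (· * ε (k + 4)) h1
      rw [mul_assoc, hT.comm j (k + 4) (by omega) le_rfl (by unfold Adj; omega), ← mul_assoc,
        smul_mul_assoc, zC_back h.isTL, mul_assoc, hT.comm (k + 4) j le_rfl (by omega)
        (by unfold Adj; omega), ← mul_assoc, ← smul_mul_assoc, ← sub_eq_zero, ← sub_mul] at h5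
      refine sub_eq_zero.1 (h.cancel (n := k + 2) ?_ h5)
      exact sub_mem (mul_mem hz (mem_gen _ (by omega))) ((levelAlg _ _).smul_mem hz _)
    have := ih (by omega) h4
    omega

theorem IsSeparated.descent_zA (h : IsSeparated ε) (h0 : ε 0 * ε 1 ≠ 0) {j : ℕ}
    (h1 : zB ε 1 * ε j = dl • zB ε 1) : j ≤ 1 ∨ j = 3 := by
  rcases lt_or_ge j 4 with h2 | h2
  · have := h.descent_zB h0 (k := 1) (by omega) h1
    omega
  · obtain ⟨n, rfl⟩ : ∃ n, j = n + 2 := ⟨j - 2, by omega⟩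
    exact (h.zB_ne_zero h0 1 (h.eq_zero_of_scaled
      (levelAlg_mono _ (by omega) ((isWord_zB 1).mem h.isTL)) h1)).elim

/-- `zC` does not come from the lower level. -/
theorem IsSeparated.zC_not_mem (h : IsSeparated ε) (h0 : ε 0 * ε 1 ≠ 0) (k : ℕ) {c : Cq}
    (hc : c ≠ 0) : c • zC ε (k + 1) ∉ levelAlg h.isTL (k + 2) := by
  intro hm
  have hz := (isWord_zC k).mem h.isTL
  have hm' : zC ε (k + 1) ∈ levelAlg h.isTL (k + 2) := by
    have := (levelAlg h.isTL (k + 2)).smul_mem hm c⁻¹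
    rwa [smul_smul, inv_mul_cancel₀ hc, one_smul] at this
  -- If `zC ε (k + 1)` came from level k + 2, `ε (k + 3)` could be cancelled in `zC_back`. Then `zC
  -- ε k` would have the forbidden descent k + 2.
  have h1 : zC ε (k + 1) = zC ε k := by
    refine sub_eq_zero.1 (h.cancel (n := k + 1) (sub_mem hm' hz) ?_)
    rw [sub_mul, zC_back h.isTL, sub_self]
  have h2 := zC_stay h.isTL k
  rw [h1] at h2
  cases k with
  | zero => exact h.zero_descent h0 h2
  | succ k =>
    have := h.descent_zC h0 (by omega) h2
    omega

end Separated

/-! ### The product representation -/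

/-- The product of the two representations. -/
def eT (i : ℕ) : Op × Op := (eA i, eB i)

theorem isTL_eT (n : ℕ) : IsTL eT n where
  sq i hi := Prod.ext ((isTL_eA n).sq i hi) ((isTL_eB n).sq i hi)
  braid i j hi hj h := Prod.ext ((isTL_eA n).braid i j hi hj h) ((isTL_eB n).braid i j hi hj h)
  comm i j hi hj h := Prod.ext ((isTL_eA n).comm i j hi hj h) ((isTL_eB n).comm i j hi hj h)

theorem commute_levelAlg {B : Type*} [Ring B] [Algebra Cq B] {ε : ℕ → B} (h : ∀ n, IsTL ε n)
    {m : ℕ} {t y : B} (ht : ∀ i ≤ m, Commute t (ε i)) (hy : y ∈ levelAlg h m) : Commute t y := by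
  obtain ⟨x, rfl⟩ := hy
  change Commute t (lift (h m) x)
  induction x using induction_word with
  | hw l hl =>
    rw [lift_wd _ hl]
    exact Commute.list_prod_right _ _ fun y hy => by
      obtain ⟨i, hi, rfl⟩ := List.mem_map.1 hy
      exact ht i (hl i hi)
  | hadd x y hx hy => rw [map_add]; exact hx.add_right hy
  | hsmul c x hx => rw [map_smul]; exact hx.smul_right c

/-- The image of `TL (n + 1)` touches no bit beyond n + 2, so it commutes with all operators on bit
n + 3. That is the hypothesis of `eq_zero_of_mul_opU`. -/
theorem isSeparated_eA : IsSeparated eA where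
  isTL := isTL_eA
  cancel {n y} hy h := by
    rw [eA_pos (by omega)] at h
    exact eq_zero_of_mul_opU (fun a s => commute_levelAlg isTL_eA
      (fun i hi => opT_comm_eA (by omega) (by omega) a s) hy) h

theorem isSeparated_eB : IsSeparated eB where
  isTL := isTL_eB
  cancel {n y} hy h := by
    rw [eB_pos (by omega)] at h
    exact eq_zero_of_mul_opU (fun a s => commute_levelAlg isTL_eB
      (fun i hi => opT_comm_eB (by omega) (by omega) a s) hy) h

theorem fst_lift_eT {n : ℕ} (x : TL n) : (lift (isTL_eT n) x).1 = lift (isTL_eA n) x := by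
  have : (AlgHom.fst Cq Op Op).comp (lift (isTL_eT n)) = lift (isTL_eA n) :=
    hom_ext fun i hi => by
      rw [AlgHom.comp_apply, lift_gen _ hi, lift_gen _ hi]
      rfl
  exact DFunLike.congr_fun this x

theorem snd_lift_eT {n : ℕ} (x : TL n) : (lift (isTL_eT n) x).2 = lift (isTL_eB n) x := by
  have : (AlgHom.snd Cq Op Op).comp (lift (isTL_eT n)) = lift (isTL_eB n) :=
    hom_ext fun i hi => by
      rw [AlgHom.comp_apply, lift_gen _ hi, lift_gen _ hi]
      rfl
  exact DFunLike.congr_fun this x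

theorem isSeparated_eT : IsSeparated eT where
  isTL := isTL_eT
  cancel {n y} hy h := by
    obtain ⟨x, rfl⟩ := hy
    refine Prod.ext ?_ ?_
    · exact isSeparated_eA.cancel ⟨x, (fst_lift_eT x).symm⟩ (congrArg Prod.fst h)
    · exact isSeparated_eB.cancel ⟨x, (snd_lift_eT x).symm⟩ (congrArg Prod.snd h)

theorem eA_zero_mul_one : eA 0 * eA 1 = dl • opU 1 := opU_sq 1

theorem eA_ne_zero : eA 0 * eA 1 ≠ 0 := by
  rw [eA_zero_mul_one]
  exact smul_ne_zero dl_ne_zero (opU_ne_zero 1)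

theorem eT_ne_zero : eT 0 * eT 1 ≠ 0 := fun h => eA_ne_zero (congrArg Prod.fst h)

/-! ### Coefficients as linear functionals -/

section Coefficient

variable {B : Type*} [Ring B] [Algebra Cq B]

open Classical in
/-- The coefficient of `z` in `v`, if `v` is a multiple of `z`, and `0` otherwise. -/
def coef (z v : B) : Cq := if h : ∃ c : Cq, v = c • z then h.choose else 0

theorem coef_smul_self {z : B} (hz : z ≠ 0) (c : Cq) : coef z (c • z) = c := by
  have h : ∃ c' : Cq, c • z = c' • z := ⟨c, rfl⟩
  rw [coef, dif_pos h]
  exact (smul_left_injective Cq hz h.choose_spec).symm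

theorem coef_self {z : B} (hz : z ≠ 0) : coef z z = 1 := by
  simpa using coef_smul_self hz 1

theorem coef_eq_zero {z v : B} (h : ∀ c : Cq, c ≠ 0 → v ≠ c • z) : coef z v = 0 := by
  by_cases h1 : ∃ c : Cq, v = c • z
  · rw [coef, dif_pos h1]
    by_contra h2
    exact h _ h2 h1.choose_spec
  · rw [coef, dif_neg h1]

theorem eq_coef_smul {z v : B} (h : coef z v ≠ 0) : v = coef z v • z := by
  by_cases h1 : ∃ c : Cq, v = c • z
  · rw [coef, dif_pos h1]
    exact h1.choose_spec
  · exact (h (by rw [coef, dif_neg h1])).elim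

theorem coef_congr {B' : Type*} [Ring B'] [Algebra Cq B'] {z v : B} {z' v' : B'} {b : Cq}
    (hb : b ≠ 0) (hz : z ≠ 0) (hz' : z' ≠ 0) (h : ∀ c : Cq, v' = c • z' ↔ v = (b * c) • z) :
    coef z v = b * coef z' v' := by
  by_cases h1 : ∃ c : Cq, v' = c • z'
  · obtain ⟨c, hc⟩ := h1
    rw [(h c).1 hc, hc, coef_smul_self hz, coef_smul_self hz']
  · rw [coef_eq_zero, coef_eq_zero, mul_zero]
    · exact fun c _ hc => h1 ⟨c, hc⟩
    · intro c _ hc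
      exact h1 ⟨b⁻¹ * c, (h _).2 (by rw [hc, mul_inv_cancel_left₀ hb])⟩

theorem coef_smul {z : B} (hz : z ≠ 0) (a : Cq) (v : B) : coef z (a • v) = a * coef z v := by
  rcases eq_or_ne a 0 with rfl | ha
  · simpa using coef_smul_self hz 0
  · refine coef_congr ha hz hz fun c => ?_
    rw [mul_smul]
    exact (smul_right_injective B ha).eq_iff.symm

end Coefficient

/-- The homogeneous functions on `TL n`. -/
def homogeneous (n : ℕ) : Submodule Cq (TL n → Cq) where
  carrier := {F | ∀ (a : Cq) (x : TL n), F (a • x) = a * F x}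
  add_mem' {F G} hF hG a x := by rw [Pi.add_apply, hF, hG, Pi.add_apply, mul_add]
  zero_mem' a x := by simp
  smul_mem' c F hF a x := by
    rw [Pi.smul_apply, hF, Pi.smul_apply, smul_eq_mul, smul_eq_mul, mul_left_comm]

/-- The action of a generator on homogeneous functions by translation of the argument. -/
def translate (n i : ℕ) : Module.End Cq (homogeneous n) where
  toFun F := ⟨fun x => F.1 (x * gen n i), fun a x => by beta_reduce; rw [smul_mul_assoc, F.2]⟩
  map_add' _ _ := rfl
  map_smul' _ _ := rfl

theorem translate_apply {n i : ℕ} (F : homogeneous n) (x : TL n) :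
    (translate n i F).1 x = F.1 (x * gen n i) := rfl

/-- The relations equate words up to scalars, and a homogeneous function turns a scalar in its
argument into a factor, so translations obey the relations. The action of the whole algebra obtained
this way is linear in the algebra element, and this is the source of `linearize`. -/
theorem isTL_translate (n : ℕ) : IsTL (translate n) n where
  sq i hi := by
    refine LinearMap.ext fun F => Subtype.ext (funext fun x => ?_)
    change F.1 (x * gen n i * gen n i) = dl * F.1 (x * gen n i)
    rw [mul_assoc, (isTL_gen n).sq i hi, mul_smul_comm, F.2]
  braid i j hi hj h := by
    refine LinearMap.ext fun F => Subtype.ext (funext fun x => ?_)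
    change F.1 (x * gen n i * gen n j * gen n i) = F.1 (x * gen n i)
    rw [mul_assoc, mul_assoc, ← mul_assoc (gen n i), (isTL_gen n).braid i j hi hj h]
  comm i j hi hj h := by
    refine LinearMap.ext fun F => Subtype.ext (funext fun x => ?_)
    change F.1 (x * gen n i * gen n j) = F.1 (x * gen n j * gen n i)
    rw [mul_assoc, (isTL_gen n).comm i j hi hj h, mul_assoc]

theorem wd_translate {n : ℕ} (l : List ℕ) (F : homogeneous n) (x : TL n) :
    (wd (translate n) l F).1 x = F.1 (x * wd (gen n) l) := by
  induction l generalizing x with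
  | nil => simp
  | cons i l ih =>
    rw [wd_cons, Module.End.mul_apply, translate_apply, ih, wd_cons, mul_assoc]

/-- The linear functional that agrees on words with a homogeneous function. -/
def linearize {n : ℕ} (F : homogeneous n) : TL n →ₗ[Cq] Cq where
  toFun x := (lift (isTL_translate n) x F).1 1
  map_add' x y := by rw [map_add]; rfl
  map_smul' c x := by rw [map_smul]; rfl

theorem linearize_wd {n : ℕ} (F : homogeneous n) {l : List ℕ} (hl : ∀ i ∈ l, i ≤ n) :
    linearize F (wd (gen n) l) = F.1 (wd (gen n) l) := by
  change (lift (isTL_translate n) (wd (gen n) l) F).1 1 = _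
  rw [lift_wd _ hl, wd_translate, one_mul]

section Functional

variable {B : Type*} [Ring B] [Algebra Cq B] {ε : ℕ → B}

/-- The linear functional on `TL n` whose value on a word is the coefficient of `z` in its
image. -/
def coefFun (h : ∀ n, IsTL ε n) (n : ℕ) {z : B} (hz : z ≠ 0) : TL n →ₗ[Cq] Cq :=
  linearize ⟨fun x => coef z (lift (h n) x), fun a x => by beta_reduce; rw [map_smul, coef_smul hz]⟩

theorem coefFun_wd (h : ∀ n, IsTL ε n) {n : ℕ} {z : B} (hz : z ≠ 0) {l : List ℕ}
    (hl : ∀ i ∈ l, i ≤ n) : coefFun h n hz (wd (gen n) l) = coef z (wd ε l) := by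
  rw [coefFun, linearize_wd _ hl]
  change coef z (lift (h n) (wd (gen n) l)) = _
  rw [lift_wd _ hl]

/-- Words, including the empty one. -/
def IsMonomial {A : Type*} [Ring A] (e : ℕ → A) (n : ℕ) (x : A) : Prop :=
  ∃ l : List ℕ, (∀ i ∈ l, i ≤ n) ∧ x = wd e l

theorem IsWord.isMonomial {A : Type*} [Ring A] {e : ℕ → A} {n : ℕ} {x : A} (h : IsWord e n x) :
    IsMonomial e n x := by
  obtain ⟨l, h1, -, h2⟩ := h
  exact ⟨l, h1, h2⟩

theorem isMonomial_down {A : Type*} [Ring A] {e : ℕ → A} {n : ℕ} (k : ℕ) :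
    IsMonomial e n (down e n k) := by
  rcases eq_or_ne k 0 with rfl | hk
  · exact ⟨[], by simp, rfl⟩
  · exact (IsWord.down hk).isMonomial

theorem IsMonomial.mul {A : Type*} [Ring A] {e : ℕ → A} {n : ℕ} {x y : A}
    (hx : IsMonomial e n x) (hy : IsMonomial e n y) : IsMonomial e n (x * y) := by
  obtain ⟨l, h1, rfl⟩ := hx
  obtain ⟨l', h1', rfl⟩ := hy
  refine ⟨l ++ l', ?_, (wd_append _ _).symm⟩
  intro i hi
  rcases List.mem_append.1 hi with hi | hi
  exacts [h1 i hi, h1' i hi]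

theorem coefFun_incl_mul (h : ∀ n, IsTL ε n) {m n : ℕ} (hm : m ≤ n) {z : B} (hz : z ≠ 0)
    {l : List ℕ} (hl : ∀ i ∈ l, i ≤ m) {u : TL n} (hu : IsMonomial (gen n) n u) :
    coefFun h n hz (incl hm (wd (gen m) l) * u) = coef z (wd ε l * lift (h n) u) := by
  obtain ⟨l', hl', rfl⟩ := hu
  rw [incl_wd hm hl, ← wd_append, coefFun_wd, wd_append, lift_wd _ hl']
  intro i hi
  rcases List.mem_append.1 hi with hi | hi
  exacts [(hl i hi).trans hm, hl' i hi]

/-- As z = z' u and u can be cancelled, y u = c z exactly when y = c z'. The coefficient thus passes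
to the lower level. -/
theorem coefFun_transfer (h : ∀ n, IsTL ε n) {m n : ℕ} (hm : m ≤ n) {z z' : B} (hz : z ≠ 0)
    (hz' : z' ≠ 0) (hz'm : z' ∈ levelAlg h m) {u : TL n} (hu : IsMonomial (gen n) n u)
    (huz : z' * lift (h n) u = z)
    (hinj : ∀ y ∈ levelAlg h m, y * lift (h n) u = 0 → y = 0) (x : TL m) :
    coefFun h n hz (incl hm x * u) = coefFun h m hz' x := by
  induction x using induction_word with
  | hw l hl =>
    rw [coefFun_incl_mul h hm hz hl hu, coefFun_wd h hz' hl, ← one_mul (coef z' _)]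
    refine coef_congr one_ne_zero hz hz' fun c => ?_
    rw [one_mul, ← huz, ← smul_mul_assoc]
    refine ⟨fun h1 => by rw [h1], fun h1 => ?_⟩
    rw [← sub_eq_zero, ← sub_mul] at h1
    exact sub_eq_zero.1 (hinj _ (sub_mem (wd_mem h hl) ((levelAlg h m).smul_mem hz'm _)) h1)
  | hadd x y hx hy => rw [map_add, add_mul, map_add, map_add, hx, hy]
  | hsmul c x hx => rw [map_smul, smul_mul_assoc, map_smul, map_smul, hx]

theorem coefFun_eq_zero (h : ∀ n, IsTL ε n) {m n : ℕ} (hm : m ≤ n) {z : B} (hz : z ≠ 0)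
    {u : TL n} (hu : IsMonomial (gen n) n u)
    (hne : ∀ y ∈ levelAlg h m, ∀ c : Cq, c ≠ 0 → y * lift (h n) u ≠ c • z) (x : TL m) :
    coefFun h n hz (incl hm x * u) = 0 := by
  induction x using induction_word with
  | hw l hl =>
    rw [coefFun_incl_mul h hm hz hl hu]
    exact coef_eq_zero (hne _ (wd_mem h hl))
  | hadd x y hx hy => rw [map_add, add_mul, map_add, hx, hy, add_zero]
  | hsmul c x hx => rw [map_smul, smul_mul_assoc, map_smul, hx, smul_zero]

/-- A right descent of u is one of y u, hence would be one of z. -/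
theorem ne_smul_of_descent {z y u : B} {j : ℕ} (hu : u * ε j = dl • u)
    (hz : z * ε j ≠ dl • z) {c : Cq} (hc : c ≠ 0) : y * u ≠ c • z := by
  intro h1
  apply hz
  apply smul_right_injective B hc
  change c • (z * ε j) = c • dl • z
  rw [smul_comm, ← h1, ← smul_mul_assoc, ← h1, mul_assoc, hu, mul_smul_comm]

end Functional

/-! ### Dotted loops in the two representations -/

theorem eB_up {j : ℕ} (hj : 1 ≤ j) : up eB j = 0 := by
  induction j, hj using Nat.le_induction with
  | base => exact eB_zero_mul_one
  | succ j hj ih => rw [up_succ, ih, zero_mul]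

theorem eB_vee {n j : ℕ} (hj : 1 ≤ j) : vee eB n j = 0 := by
  rw [vee, eB_up hj, mul_zero]

theorem eB_zB (k : ℕ) : zB eB k = 0 := by
  induction k with
  | zero => exact eB_zero_mul_one
  | succ k ih => rw [zB_succ, ih, zero_mul]

theorem eB_zC (k : ℕ) : zC eB k = 0 := by
  induction k with
  | zero => exact eB_zero_mul_one
  | succ k ih => rw [zC_succ, ih, zero_mul, zero_mul]

/-- In the representation without dots, a dotted loop is a loop. -/
theorem eA_vee {n j : ℕ} (hj : 1 ≤ j) (hjn : j ≤ n) :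
    vee eA n j = dl • down eA n (n + 1 - j) := by
  obtain ⟨k, rfl⟩ : ∃ k, n = j + k := ⟨n - j, by omega⟩
  have h1 : vee eA (j + k) 1 = dl • down eA (j + k) (j + k) := by
    have : down eA (j + k) (j + k) = down eA (j + k) (j + k - 1) * eA 1 := by
      obtain ⟨m, hm⟩ : ∃ m, j + k = m + 1 := ⟨j + k - 1, by omega⟩
      rw [hm, down_succ]
      congr 2
      omega
    rw [this, vee, ← mul_smul_comm]
    congr 1
    exact opU_sq 1
  clear hjn
  induction j, hj using Nat.le_induction generalizing k with
  | base => rw [h1]; congr 2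
  | succ j hj ih =>
    have h2 := ih (k + 1) (by rw [show j + (k + 1) = j + 1 + k by omega]; exact h1)
    rw [show j + (k + 1) = j + 1 + k by omega] at h2
    -- Each further letter of `vee` undoes the last letter of the descending word. At j = 1 the
    -- relation needed is the one at the fork of the diagram.
    have h3 : down eA (j + 1 + k) (k + 2) * eA (j + 1) = down eA (j + 1 + k) (k + 1) := by
      rcases hj.eq_or_lt with rfl | hj
      · have h4 := (isTL_eA (1 + 1 + k)).fork_two (by omega) le_rfl
        rw [show 1 + 1 + k - 1 = k + 1 by omega] at h4
        rw [down_succ, show 1 + 1 + k - (k + 1) = 1 by omega, h4]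
      · have h4 := (isTL_eA (j + 1 + k)).down_back (k := k) (by omega)
        rwa [show j + 1 + k - k = j + 1 by omega] at h4
    rw [vee_succ, h2, show j + 1 + k + 1 - j = k + 2 by omega,
      show j + 1 + k + 1 - (j + 1) = k + 1 by omega, smul_mul_assoc, h3]

/-! ### How representatives connect the families of words -/

section Identities

variable {A : Type*} [Ring A] [Algebra Cq A] {e : ℕ → A} {n : ℕ}

theorem IsTL.up_one_fork (h : IsTL e n) (hn : 2 ≤ n) {a : ℕ} (ha : a ≤ 1) :
    e 0 * e 1 * (e 2 * e a) = e 0 * e 1 := by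
  rw [← mul_assoc]
  interval_cases a
  · exact h.up_two_zero hn
  · exact h.up_back (j := 0) hn

theorem IsTL.zB_one_fork (h : IsTL e n) (hn : 3 ≤ n) {a : ℕ} (ha : a ≤ 1) :
    zB e 1 * (e 2 * e a) = zB e 1 := by
  have h1 : e 0 * e 1 * e 3 = e 3 * (e 0 * e 1) :=
    h.wd_comm ((isWord_gen (m := 1) (by omega)).mul (isWord_gen le_rfl)) le_rfl le_rfl hn
  change e 0 * e 1 * e 3 * (e 2 * e a) = e 0 * e 1 * e 3
  rw [h1, mul_assoc, h.up_one_fork (by omega) ha]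

/-- One layer of the zigzag is peeled off: `e (k + 2)` passes `e (k + 4)` and is absorbed by e_{k+2}
e_{k+3} e_{k+2} = e_{k+2}. Iteration straightens `zC` into `zB` in `IsTL.zC_fork`. -/
theorem IsTL.zC_down (h : IsTL e n) {k : ℕ} (hk : k + 4 ≤ n) :
    zC e (k + 1) * down e (k + 4) (k + 3) = zC e k * down e (k + 3) (k + 2) * e (k + 4) := by
  have h1 : e (k + 2) * e (k + 3) * e (k + 2) = e (k + 2) :=
    h.braid _ _ (by omega) (by omega) (by unfold Adj; omega)
  have h2 : e (k + 2) * e (k + 4) = e (k + 4) * e (k + 2) :=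
    h.comm _ _ (by omega) (by omega) (by unfold Adj; omega)
  have h3 : down e (k + 2) (k + 1) * e (k + 4) = e (k + 4) * down e (k + 2) (k + 1) :=
    h.wd_comm (IsWord.down (by omega)) (by omega) (by omega) hk
  rw [down_succ_left (k + 3) (k + 2), down_succ_left (k + 2) (k + 1), mul_assoc (zC e k),
    mul_assoc (e (k + 3)), h3, down_succ_left (k + 1) k, zC_succ]
  calc zC e k * e (k + 3) * e (k + 2) * (e (k + 4) * (e (k + 3) * (e (k + 2) * down e (k + 1) k)))
      = zC e k * e (k + 3) * (e (k + 2) * e (k + 4)) * e (k + 3) * e (k + 2)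
          * down e (k + 1) k := by simp only [mul_assoc]
    _ = zC e k * e (k + 3) * e (k + 4) * (e (k + 2) * e (k + 3) * e (k + 2))
          * down e (k + 1) k := by rw [h2]; simp only [mul_assoc]
    _ = _ := by rw [h1]; simp only [mul_assoc]

theorem IsTL.zC_fork (h : IsTL e n) {k : ℕ} (hk : k + 3 ≤ n) {a : ℕ} (ha : a ≤ 1) :
    zC e k * (down e (k + 3) (k + 2) * e a) = zB e (k + 1) := by
  induction k with
  | zero =>
    have : down e (0 + 3) (0 + 2) = e 3 * e 2 := by simp [down]
    rw [this, mul_assoc, ← mul_assoc (zC e 0)]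
    exact h.zB_one_fork hk ha
  | succ k ih =>
    rw [← mul_assoc, h.zC_down (by omega), mul_assoc,
      ← h.comm a (k + 4) (by omega) hk (by unfold Adj; omega), ← mul_assoc, mul_assoc (zC e k),
      ih (by omega)]
    rfl

/-- In e_3 ⋯ e_{k+3} · e_{k+4} e_{k+3} ⋯ e_3 the innermost triple collapses, again and again, until
e_3 is left. -/
theorem IsTL.zB_down (h : IsTL e n) {k : ℕ} (hk : k + 4 ≤ n) :
    zB e (k + 1) * down e (k + 4) (k + 2) = zB e 1 := by
  have hb : ∀ k, k + 4 ≤ n → e (k + 3) * e (k + 4) * e (k + 3) = e (k + 3) := fun k hk =>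
    h.braid _ _ (by omega) (by omega) (by unfold Adj; omega)
  induction k with
  | zero =>
    have : down e (0 + 4) (0 + 2) = e 4 * e 3 := by simp [down]
    rw [this, zB_succ, mul_assoc, ← mul_assoc (e (0 + 3)), hb 0 hk]
  | succ k ih =>
    rw [← ih (by omega), zB_succ, down_succ_left (k + 4) (k + 2), down_succ_left (k + 3) (k + 1),
      mul_assoc, ← mul_assoc (e _) (e (k + 4 + 1)), ← mul_assoc (e _ * e _), hb (k + 1) hk]

theorem IsTL.zB_fork (h : IsTL e n) {k : ℕ} (hk : k + 4 ≤ n) {a : ℕ} (ha : a ≤ 1) :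
    zB e (k + 1) * (down e (k + 4) (k + 3) * e a) = zB e 1 := by
  rw [down_succ, mul_assoc, ← mul_assoc, h.zB_down hk, show k + 4 - (k + 2) = 2 by omega,
    h.zB_one_fork (by omega) ha]

end Identities

/-! ### Representatives that cannot produce a given word -/

section NoHit

variable {B : Type*} [Ring B] [Algebra Cq B] {ε : ℕ → B}

/-- No nonzero multiple of `z` is a product `y * u` with `y` in the image of `TL m`. -/
def Misses (h : ∀ n, IsTL ε n) (m : ℕ) (u z : B) : Prop :=
  ∀ y ∈ levelAlg h m, ∀ c : Cq, c ≠ 0 → y * u ≠ c • z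

theorem down_stay' (h : ∀ n, IsTL ε n) {n k : ℕ} (hk : k ≠ 0) (hkn : k ≤ n) :
    down ε n k * ε (n + 1 - k) = dl • down ε n k := by
  obtain ⟨k, rfl⟩ := Nat.exists_eq_succ_of_ne_zero hk
  rw [← (h n).down_stay k]
  congr 2
  omega

theorem fork_stay (h : ∀ n, IsTL ε n) (x : B) (a : ℕ) : x * ε a * ε a = dl • (x * ε a) := by
  rw [mul_assoc, (h a).sq a le_rfl, mul_smul_comm]

theorem smul_mem_iff {S : Subalgebra Cq B} {c : Cq} (hc : c ≠ 0) {z : B} : c • z ∈ S ↔ z ∈ S := by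
  refine ⟨fun h => ?_, fun h => S.smul_mem h c⟩
  simpa [smul_smul, inv_mul_cancel₀ hc] using S.smul_mem h c⁻¹

theorem misses_one {h : ∀ n, IsTL ε n} {m : ℕ} {z : B} (hz : z ∉ levelAlg h m) :
    Misses h m 1 z := by
  intro y hy c hc h1
  rw [mul_one] at h1
  exact hz ((smul_mem_iff hc).1 (h1 ▸ hy))

/-- For j ≠ 0 the descending word has the descent k + 4 - j, which `zB` does not have. For j = 0 the
target would lie in the lower level although it is scaled by `ε (k + 3)`. -/
theorem IsSeparated.misses_zB_down (h : IsSeparated ε) (h0 : ε 0 * ε 1 ≠ 0) {k j : ℕ}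
    (hj : j < k + 3) (hj1 : j ≠ 1) :
    Misses h.isTL (k + 2) (down ε (k + 3) j) (zB ε (k + 1)) := by
  rcases eq_or_ne j 0 with rfl | hj0
  · exact misses_one fun hm => h.zB_ne_zero h0 (k + 1)
      (h.eq_zero_of_scaled (n := k + 1) hm (zB_stay h.isTL k))
  · intro y _ c hc
    refine ne_smul_of_descent (down_stay' h.isTL hj0 (by omega)) (fun h1 => ?_) hc
    have := h.descent_zB h0 (by omega) h1
    omega

theorem IsSeparated.misses_zC_down (h : IsSeparated ε) (h0 : ε 0 * ε 1 ≠ 0) {k j : ℕ}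
    (hj : j < k + 3) (hj2 : j ≠ 2) :
    Misses h.isTL (k + 2) (down ε (k + 3) j) (zC ε (k + 1)) := by
  rcases eq_or_ne j 0 with rfl | hj0
  · refine misses_one fun hm => ?_
    exact h.zC_not_mem h0 k one_ne_zero (by rwa [one_smul])
  · intro y _ c hc
    refine ne_smul_of_descent (down_stay' h.isTL hj0 (by omega)) (fun h1 => ?_) hc
    have := h.descent_zC h0 (by omega) h1
    omega

theorem IsSeparated.misses_zC_fork (h : IsSeparated ε) (h0 : ε 0 * ε 1 ≠ 0) {k a : ℕ}
    (ha : a ≤ 1) (x : B) :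
    Misses h.isTL (k + 2) (x * ε a) (zC ε (k + 1)) := by
  intro y _ c hc
  refine ne_smul_of_descent (fork_stay h.isTL x a) (fun h1 => ?_) hc
  have := h.descent_zC h0 (by omega) h1
  omega

theorem IsSeparated.misses_zA_down (h : IsSeparated ε) (h0 : ε 0 * ε 1 ≠ 0) {k j : ℕ}
    (hj : j < k + 4) (hj0 : j ≠ 0) (hj2 : j ≠ k + 2) :
    Misses h.isTL (k + 3) (down ε (k + 4) j) (zB ε 1) := by
  intro y _ c hc
  refine ne_smul_of_descent (down_stay' h.isTL hj0 (by omega)) (fun h1 => ?_) hc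
  have := h.descent_zA h0 h1
  omega

theorem IsSeparated.misses_zero_down (h : IsSeparated ε) (h0 : ε 0 * ε 1 ≠ 0) :
    Misses h.isTL 1 (down ε 2 1) (ε 0 * ε 1) := by
  intro y _ c hc
  exact ne_smul_of_descent (down_stay' h.isTL (by omega) (by omega)) (h.zero_descent h0) hc

end NoHit

/-! ### Words determined by their image -/

/-- The element `z` of `TL n` is determined, among the words and up to scalars, by its image. -/
def IsFaithful (n : ℕ) (z : TL n) : Prop :=
  ∀ x, IsMonomial (gen n) n x → ∀ c : Cq, c ≠ 0 →
    lift (isTL_eT n) x = c • lift (isTL_eT n) z → x = c • z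

theorem eA_zero_ne : eA 0 ≠ dl • 1 := by
  intro h
  have h1 := congrFun (LinearMap.congr_fun h fun _ => 1) fun _ => false
  rw [eA_zero, opU_apply, cup_self, zero_mul] at h1
  apply dl_ne_zero
  simpa using h1.symm

theorem eA_zero_mul_down_ne {m k : ℕ} (hk : k ≤ m + 2) :
    eA 0 * down eA (m + 2) k ≠ dl • down eA (m + 2) k := by
  intro h
  rw [← sub_eq_zero, ← one_mul (down eA (m + 2) k), ← mul_assoc, ← smul_mul_assoc, ← sub_mul,
    mul_one] at h
  have hmem : eA 0 - dl • 1 ∈ levelAlg isTL_eA (m + 1) :=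
    sub_mem (mem_gen isTL_eA (by omega)) ((levelAlg isTL_eA (m + 1)).smul_mem (one_mem _) _)
  apply eA_zero_ne
  apply sub_eq_zero.1
  rcases hk.eq_or_lt with rfl | hk
  · rw [down_succ, show m + 2 - (m + 1) = 1 by omega] at h
    exact isSeparated_eA.cancel_fork (n := m) le_rfl hmem h
  · exact isSeparated_eA.cancel_down (n := m) hk hmem h

/-- A word is factored through a representative u. If z = z' u, then u is cancelled in the
representation and faithfulness of z' applies. If u misses z, this u does not occur. Dotted
representatives become loop-free once a nonempty lower word stands before them. -/
theorem isFaithful_step {m : ℕ} {z : TL (m + 2)}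
    (hz : lift (isTL_eT (m + 2)) z ≠ 0)
    (h0 : eT 0 * lift (isTL_eT (m + 2)) z = dl • lift (isTL_eT (m + 2)) z)
    (hu : ∀ u : TL (m + 2), ((∃ k < m + 2, u = down (gen (m + 2)) (m + 2) k) ∨
        ∃ a ≤ 1, u = down (gen (m + 2)) (m + 2) (m + 1) * gen (m + 2) a) →
      (∃ z' : TL (m + 1), IsFaithful (m + 1) z' ∧ incl (Nat.le_succ _) z' * u = z) ∨
      Misses isTL_eT (m + 1) (lift (isTL_eT (m + 2)) u) (lift (isTL_eT (m + 2)) z)) :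
    IsFaithful (m + 2) z := by
  have hT := isTL_gen (m + 2)
  have hm : m + 1 ≤ m + 2 := Nat.le_succ _
  -- the representatives without a dotted loop
  have key : ∀ u : TL (m + 2), ((∃ k < m + 2, u = down (gen (m + 2)) (m + 2) k) ∨
        ∃ a ≤ 1, u = down (gen (m + 2)) (m + 2) (m + 1) * gen (m + 2) a) →
      ∀ l : List ℕ, (∀ i ∈ l, i ≤ m + 1) → ∀ c : Cq, c ≠ 0 →
      lift (isTL_eT (m + 2)) (wd (gen (m + 2)) l * u) = c • lift (isTL_eT (m + 2)) z →
      wd (gen (m + 2)) l * u = c • z := by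
    intro u hu' l hl c hc h1
    have hy : wd eT l ∈ levelAlg isTL_eT (m + 1) := wd_mem isTL_eT hl
    rw [map_mul, lift_wd _ fun i hi => (hl i hi).trans hm] at h1
    rcases hu u hu' with ⟨z', hz', rfl⟩ | hmiss
    · have h2 : lift (isTL_eT (m + 1)) (wd (gen (m + 1)) l) = c • lift (isTL_eT (m + 1)) z' := by
        rw [lift_wd _ hl]
        rw [map_mul, lift_incl, ← smul_mul_assoc, ← sub_eq_zero, ← sub_mul] at h1
        have hmem : wd eT l - c • lift (isTL_eT (m + 1)) z' ∈ levelAlg isTL_eT (m + 1) :=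
          sub_mem hy ((levelAlg isTL_eT (m + 1)).smul_mem ⟨z', rfl⟩ _)
        apply sub_eq_zero.1
        rcases hu' with ⟨k, hk, rfl⟩ | ⟨a, ha, rfl⟩
        · rw [map_down _ fun i hi => lift_gen (isTL_eT (m + 2)) hi] at h1
          exact isSeparated_eT.cancel_down (n := m) hk hmem h1
        · rw [map_mul, map_down _ fun i hi => lift_gen (isTL_eT (m + 2)) hi,
            lift_gen _ (by omega)] at h1
          exact isSeparated_eT.cancel_fork (n := m) ha hmem h1
      have h3 := hz' _ ⟨l, hl, rfl⟩ c hc h2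
      rw [← incl_wd hm hl, h3, map_smul, smul_mul_assoc]
    · exact (hmiss _ hy c hc h1).elim
  rintro _ ⟨l, hl, rfl⟩ c hc h1
  obtain ⟨c', l', u, hl', hu', h2⟩ := hT.exists_coset (by omega) l hl
  have hc' : c' ≠ 0 := by
    rintro rfl
    rw [h2, zero_smul, map_zero] at h1
    exact smul_ne_zero hc hz h1.symm
  have hcc : c'⁻¹ * c ≠ 0 := mul_ne_zero (inv_ne_zero hc') hc
  have h3 : lift (isTL_eT (m + 2)) (wd (gen (m + 2)) l' * u)
      = (c'⁻¹ * c) • lift (isTL_eT (m + 2)) z := by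
    rw [mul_smul, ← h1, h2, map_smul, smul_smul, inv_mul_cancel₀ hc', one_smul]
  suffices h4 : wd (gen (m + 2)) l' * u = (c'⁻¹ * c) • z by
    rw [h2, h4, smul_smul, mul_inv_cancel_left₀ hc']
  clear h1 h2
  cases hu' with
  | down k hk => exact key _ (.inl ⟨k, hk, rfl⟩) l' hl' _ hcc h3
  | fork a ha => exact key _ (.inr ⟨a, ha, rfl⟩) l' hl' _ hcc h3
  | vee j hj1 hj =>
    rcases eq_or_ne l' [] with rfl | hne
    -- A bare dotted representative inherits from z the relation E_0 x = δ x. In `eA` it is δ times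
    -- a descending word, and cancelling that word would make `eA 0` a scalar.
    · exfalso
      rw [wd_nil, one_mul, map_vee _ hj fun i hi => lift_gen (isTL_eT (m + 2)) hi] at h3
      have h4 : eT 0 * vee eT (m + 2) j = dl • vee eT (m + 2) j := by
        rw [h3, mul_smul_comm, h0, smul_comm]
      have h5 := congrArg Prod.fst h4
      have h6 : (vee eT (m + 2) j).1 = vee eA (m + 2) j :=
        map_vee (AlgHom.fst Cq Op Op) hj fun i _ => rfl
      rw [Prod.fst_mul, Prod.smul_fst, h6, eA_vee hj1 hj, mul_smul_comm] at h5
      exact eA_zero_mul_down_ne (by omega) (smul_right_injective Op dl_ne_zero h5)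
    · obtain ⟨y, ⟨l'', hl'', -, rfl⟩, h4⟩ := hT.word_mul_vee (by omega) ⟨l', hl', hne, rfl⟩
      rw [h4 j hj1 hj] at h3 ⊢
      refine key _ ?_ l'' hl'' _ hcc h3
      rcases hj1.eq_or_lt with rfl | hj1
      · refine .inr ⟨1, le_rfl, ?_⟩
        rw [show m + 2 + 1 - 1 = (m + 1) + 1 by omega, down_succ,
          show m + 2 - (m + 1) = 1 by omega]
      · exact .inl ⟨_, by omega, rfl⟩

theorem eT_fst_zB (k : ℕ) : (zB eT k).1 = zB eA k := map_zB (AlgHom.fst Cq Op Op) fun _ _ => rfl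

theorem zB_left {A : Type*} [Ring A] [Algebra Cq A] {e : ℕ → A} (h : ∀ n, IsTL e n) (k : ℕ) :
    e 0 * zB e k = dl • zB e k := by
  induction k with
  | zero => rw [zB, ← mul_assoc, (h 0).sq 0 le_rfl, smul_mul_assoc]
  | succ k ih => rw [zB_succ, ← mul_assoc, ih, smul_mul_assoc]

theorem zC_left {A : Type*} [Ring A] [Algebra Cq A] {e : ℕ → A} (h : ∀ n, IsTL e n) (k : ℕ) :
    e 0 * zC e k = dl • zC e k := by
  induction k with
  | zero => rw [zC, ← mul_assoc, (h 0).sq 0 le_rfl, smul_mul_assoc]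
  | succ k ih => rw [zC_succ, ← mul_assoc, ← mul_assoc, ih, smul_mul_assoc, smul_mul_assoc]

theorem lift_zB {k n : ℕ} (hk : k + 2 ≤ n) :
    lift (isTL_eT n) (zB (gen n) k) = zB eT k :=
  map_zB _ fun _ hi => lift_gen _ (by omega)

theorem lift_zC {k n : ℕ} (hk : k + 2 ≤ n) :
    lift (isTL_eT n) (zC (gen n) k) = zC eT k :=
  map_zC _ fun _ hi => lift_gen _ (by omega)

theorem incl_zB {k m n : ℕ} (h : m ≤ n) (hk : k + 2 ≤ m) :
    incl h (zB (gen m) k) = zB (gen n) k :=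
  map_zB _ fun _ hi => incl_gen h (by omega)

theorem incl_zC {k m n : ℕ} (h : m ≤ n) (hk : k + 2 ≤ m) :
    incl h (zC (gen m) k) = zC (gen n) k :=
  map_zC _ fun _ hi => incl_gen h (by omega)

theorem lift_down {B : Type*} [Ring B] [Algebra Cq B] {ε : ℕ → B} (h : ∀ n, IsTL ε n) {n k : ℕ} :
    lift (h n) (down (gen n) n k) = down ε n k :=
  map_down _ fun _ hi => lift_gen _ hi

theorem eB_one_ne : eB 1 ≠ 0 := by
  rw [eB_pos le_rfl]
  exact opU_ne_zero 1

theorem eB_zero_ne : eB 0 ≠ 0 := by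
  intro h
  have h1 : eB 2 * eB 0 * eB 2 = eB 2 :=
    (isTL_eB 2).braid 2 0 le_rfl (by omega) (by unfold Adj; omega)
  rw [h, mul_zero, zero_mul, eB_pos (by omega)] at h1
  exact opU_ne_zero 2 h1.symm

theorem op_one_ne : (1 : Op) ≠ 0 := fun h => eB_one_ne (by rw [← one_mul (eB 1), h, zero_mul])

/-- Up to scalars the words are 1, E_0, E_1 and E_0 E_1. Only the last vanishes in `eB`. -/
theorem isFaithful_one : IsFaithful 1 (gen 1 0 * gen 1 1) := by
  have hT := isTL_gen 1
  have hB0 := eB_one_ne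
  have hB1 := eB_zero_ne
  have h1 := op_one_ne
  -- the words of `TL 1`
  have key : ∀ l : List ℕ, (∀ i ∈ l, i ≤ 1) → ∃ (c : Cq) (u : TL 1),
      wd (gen 1) l = c • u ∧ (u = gen 1 0 * gen 1 1 ∨ lift (isTL_eB 1) u ≠ 0) := by
    have key' : ∀ l : List ℕ, (∀ i ∈ l, i ≤ 1) → ∃ c : Cq,
        wd (gen 1) l = c • 1 ∨ wd (gen 1) l = c • gen 1 0 ∨ wd (gen 1) l = c • gen 1 1 ∨
          wd (gen 1) l = c • (gen 1 0 * gen 1 1) := by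
      intro l hl
      induction l with
      | nil => exact ⟨1, .inl (by simp)⟩
      | cons i l ih =>
        obtain ⟨c, hc⟩ := ih fun j hj => hl j (by simp [hj])
        have hi := hl i (by simp)
        rw [wd_cons]
        have s0 := hT.sq 0 (by omega)
        have s1 := hT.sq 1 (by omega)
        have cm := hT.comm01 le_rfl
        have hi' : i = 0 ∨ i = 1 := by omega
        rcases hi' with rfl | rfl <;> rcases hc with hc | hc | hc | hc <;> rw [hc, mul_smul_comm]
        · exact ⟨c, .inr (.inl (by rw [mul_one]))⟩
        · exact ⟨c * dl, .inr (.inl (by rw [s0, smul_smul]))⟩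
        · exact ⟨c, .inr (.inr (.inr rfl))⟩
        · exact ⟨c * dl, .inr (.inr (.inr (by rw [← mul_assoc, s0, smul_mul_assoc, smul_smul])))⟩
        · exact ⟨c, .inr (.inr (.inl (by rw [mul_one])))⟩
        · exact ⟨c, .inr (.inr (.inr (by rw [cm])))⟩
        · exact ⟨c * dl, .inr (.inr (.inl (by rw [s1, smul_smul])))⟩
        · exact ⟨c * dl, .inr (.inr (.inr (by
            rw [cm, ← mul_assoc, s1, smul_mul_assoc, smul_smul])))⟩
    intro l hl
    obtain ⟨c, hc | hc | hc | hc⟩ := key' l hl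
    · exact ⟨c, 1, hc, .inr (by rwa [map_one])⟩
    · exact ⟨c, _, hc, .inr (by rwa [lift_gen _ (by omega)])⟩
    · exact ⟨c, _, hc, .inr (by rwa [lift_gen _ (by omega)])⟩
    · exact ⟨c, _, hc, .inl rfl⟩
  rintro _ ⟨l, hl, rfl⟩ c hc h2
  have hz : lift (isTL_eT 1) (gen 1 0 * gen 1 1) = eT 0 * eT 1 := by
    rw [map_mul, lift_gen _ (by omega), lift_gen _ le_rfl]
  obtain ⟨c', u, h3, rfl | hu⟩ := key l hl
  · rw [h3, map_smul, hz] at h2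
    rw [h3, smul_left_injective Cq eT_ne_zero h2]
  · exfalso
    rw [hz] at h2
    have h4 := congrArg Prod.snd h2
    rw [snd_lift_eT, h3, map_smul, Prod.smul_snd] at h4
    have h5 : (eT 0 * eT 1).2 = 0 := eB_zero_mul_one
    rw [h5, smul_zero] at h4
    have h6 := (smul_eq_zero.1 h4).resolve_right hu
    rw [h3, h6, zero_smul, map_zero] at h2
    exact smul_ne_zero hc eT_ne_zero h2.symm

theorem isFaithful_two : IsFaithful 2 (zB (gen 2) 0) := by
  apply isFaithful_step (m := 0)
  · rw [lift_zB (by omega)]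
    exact isSeparated_eT.zB_ne_zero eT_ne_zero 0
  · rw [lift_zB (by omega)]
    exact zB_left isTL_eT 0
  · have hi : incl (Nat.le_succ 1) (gen 1 0 * gen 1 1) = gen 2 0 * gen 2 1 := by
      rw [map_mul, incl_gen _ (by omega), incl_gen _ le_rfl]
    rw [lift_zB (by omega)]
    rintro u (⟨k, hk, rfl⟩ | ⟨a, ha, rfl⟩)
    · have hk' : k = 0 ∨ k = 1 := by omega
      rcases hk' with rfl | rfl
      · exact .inl ⟨_, isFaithful_one, by rw [hi, down, mul_one]; rfl⟩
      · right
        rw [lift_down]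
        exact isSeparated_eT.misses_zero_down eT_ne_zero
    · refine .inl ⟨_, isFaithful_one, ?_⟩
      rw [hi]
      have := (isTL_gen 2).up_one_fork le_rfl ha
      simpa [down, zB] using this

theorem isFaithful_zC (k : ℕ) : IsFaithful (k + 2) (zC (gen (k + 2)) k) := by
  induction k with
  | zero => exact isFaithful_two
  | succ k ih =>
    apply isFaithful_step (m := k + 1)
    · rw [lift_zC (by omega)]
      exact isSeparated_eT.zC_ne_zero eT_ne_zero _
    · rw [lift_zC (by omega)]
      exact zC_left isTL_eT _
    · rw [lift_zC (by omega)]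
      rintro u (⟨j, hj, rfl⟩ | ⟨a, ha, rfl⟩)
      · rw [lift_down]
        rcases eq_or_ne j 2 with rfl | hj2
        · refine .inl ⟨_, ih, ?_⟩
          rw [incl_zC _ le_rfl, down, down, down, one_mul, zC_succ, mul_assoc]
          rfl
        · exact .inr (isSeparated_eT.misses_zC_down eT_ne_zero hj hj2)
      · right
        rw [map_mul, lift_gen _ (by omega)]
        exact isSeparated_eT.misses_zC_fork eT_ne_zero ha _

theorem isFaithful_zB (k : ℕ) : IsFaithful (k + 2) (zB (gen (k + 2)) k) := by
  induction k with
  | zero => exact isFaithful_two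
  | succ k ih =>
    apply isFaithful_step (m := k + 1)
    · rw [lift_zB (by omega)]
      exact isSeparated_eT.zB_ne_zero eT_ne_zero _
    · rw [lift_zB (by omega)]
      exact zB_left isTL_eT _
    · rw [lift_zB (by omega)]
      rintro u (⟨j, hj, rfl⟩ | ⟨a, ha, rfl⟩)
      · rw [lift_down]
        rcases eq_or_ne j 1 with rfl | hj1
        · refine .inl ⟨_, ih, ?_⟩
          rw [incl_zB _ le_rfl, down, down, one_mul, zB_succ]
          rfl
        · exact .inr (isSeparated_eT.misses_zB_down eT_ne_zero hj hj1)
      · refine .inl ⟨_, isFaithful_zC k, ?_⟩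
        rw [incl_zC _ le_rfl]
        exact (isTL_gen (k + 3)).zC_fork le_rfl ha

/-- E_0 E_1 E_3 arises from itself one level below, or from `zB`, whose tail is undone by a long
descending word or by a fork. -/
theorem isFaithful_zA (k : ℕ) : IsFaithful (k + 3) (zB (gen (k + 3)) 1) := by
  induction k with
  | zero => exact isFaithful_zB 1
  | succ k ih =>
    apply isFaithful_step (m := k + 2)
    · rw [lift_zB (by omega)]
      exact isSeparated_eT.zB_ne_zero eT_ne_zero _
    · rw [lift_zB (by omega)]
      exact zB_left isTL_eT _
    · rw [lift_zB (by omega)]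
      rintro u (⟨j, hj, rfl⟩ | ⟨a, ha, rfl⟩)
      · rw [lift_down]
        rcases eq_or_ne j 0 with rfl | hj0
        · exact .inl ⟨_, ih, by rw [incl_zB _ (by omega), down, mul_one]⟩
        rcases eq_or_ne j (k + 2) with rfl | hj2
        · refine .inl ⟨_, isFaithful_zB (k + 1), ?_⟩
          rw [incl_zB _ le_rfl]
          exact (isTL_gen (k + 4)).zB_down le_rfl
        · exact .inr (isSeparated_eT.misses_zA_down eT_ne_zero hj hj0 hj2)
      · refine .inl ⟨_, isFaithful_zB (k + 1), ?_⟩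
        rw [incl_zB _ le_rfl]
        exact (isTL_gen (k + 4)).zB_fork le_rfl ha

theorem mul_word_eq_zero {A : Type*} [Ring A] {e : ℕ → A} {m : ℕ} {y t : A}
    (hy : ∀ i ≤ m, y * e i = 0) (ht : IsWord e m t) :
    y * t = 0 := by
  obtain ⟨l, hl, hne, rfl⟩ := ht
  obtain ⟨i, l, rfl⟩ := List.exists_cons_of_ne_nil hne
  rw [wd_cons, ← mul_assoc, hy i (hl i (by simp)), zero_mul]

/-! ### The recursion for the projections -/

section Wenzl

variable {A : Type*} [Ring A] [Algebra Cq A] {e : ℕ → A} {n : ℕ}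

/-- The coefficient of `e_n ⋯ e_2 e_0 e_1 ⋯ e_j` in the recursion for the projections. -/
def veeCoeff (n j : ℕ) : Cq := qInt (n + 1 - j) / (qInt (n + 1) * pInt n)

/-- The sum of the representatives through which the projections are defined recursively. -/
def wenzl (e : ℕ → A) (n : ℕ) : A :=
  ∑ k ∈ Finset.range n, (pInt (n - k) / pInt n) • down e n k
    + (pInt n)⁻¹ • (down e n (n - 1) * e 0 + down e n (n - 1) * e 1)
    + ∑ j ∈ Finset.Icc 1 n, veeCoeff n j • vee e n j

theorem mul_wenzl (y : A) (i : ℕ) : y * wenzl e n * e i =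
    ∑ k ∈ Finset.range n, (pInt (n - k) / pInt n) • (y * (down e n k * e i))
    + (pInt n)⁻¹ • (y * (down e n (n - 1) * e 0 * e i) + y * (down e n (n - 1) * e 1 * e i))
    + ∑ j ∈ Finset.Icc 1 n, veeCoeff n j • (y * (vee e n j * e i)) := by
  simp only [wenzl, mul_add, add_mul, Finset.mul_sum, Finset.sum_mul, mul_smul_comm,
    smul_mul_assoc, mul_assoc, smul_add]

theorem veeCoeff_rec (n j : ℕ) :
    veeCoeff n j + dl * veeCoeff n (j + 1) + veeCoeff n (j + 2) = 0 := by
  have h := qInt_rec (n + 1 - (j + 1))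
  rw [show (n : ℤ) + 1 - (j + 1) + 1 = n + 1 - j by ring,
    show (n : ℤ) + 1 - (j + 1) - 1 = n + 1 - (j + 2) by ring] at h
  simp only [veeCoeff, dl]
  push_cast
  linear_combination (1 / (qInt (n + 1) * pInt n)) * h

theorem veeCoeff_zero (n : ℕ) : veeCoeff n 0 = (pInt n)⁻¹ := by
  have h : qInt (n + 1) ≠ 0 := qInt_ne_zero (by omega)
  rw [veeCoeff, Nat.cast_zero, sub_zero, div_mul_eq_div_div, div_self h, one_div]

theorem veeCoeff_top (n : ℕ) : veeCoeff n (n + 1) = 0 := by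
  rw [veeCoeff]
  push_cast
  rw [sub_self, qInt_zero, zero_div]

/-- For j ≥ 3 a lower word splits off and is killed by y. The terms j = 1, 2 both give `vee e n 1`,
and the recurrence sums their weights to minus the would-be weight at j = 0, which is 1/(q^n +
q^{-n}). -/
theorem IsTL.sum_vee_mul_low (h : IsTL e n) (hn : 2 ≤ n) {y : A} (hy : ∀ i ≤ n - 1, y * e i = 0)
    {i : ℕ} (hi : i ≤ 1) :
    ∑ j ∈ Finset.Icc 1 n, veeCoeff n j • (y * (vee e n j * e i))
      = -(pInt n)⁻¹ • (y * vee e n 1) := by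
  rw [Finset.sum_eq_add (a := 1) (b := 2) (by omega)]
  · have h1 : vee e n 1 * e i = dl • vee e n 1 := by
      rw [vee, mul_assoc, ← mul_smul_comm]
      interval_cases i
      · rw [h.up_one_zero (by omega)]
      · rw [h.up_stay (by omega)]
    have h2 : vee e n 2 * e i = vee e n 1 := by
      rw [vee, vee, mul_assoc]
      interval_cases i
      · rw [h.up_two_zero hn]
      · rw [h.up_back hn]
    have h3 := veeCoeff_rec n 0
    rw [veeCoeff_zero] at h3
    rw [h1, h2, mul_smul_comm, smul_smul, ← add_smul]
    congr 1
    linear_combination h3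
  · intro j hj hne
    rw [Finset.mem_Icc] at hj
    obtain ⟨t, ht, h1⟩ := h.vee_low (i := i) (j := j) (by omega) (by omega) hj.2
    rw [h1, ← mul_assoc, mul_word_eq_zero hy ht, zero_mul, smul_zero]
  · intro h1
    exact (h1 (Finset.mem_Icc.2 (by omega))).elim
  · intro h1
    exact (h1 (Finset.mem_Icc.2 (by omega))).elim

/-- Only j = i - 1, i, i + 1 survive. All three give `vee e n i`, with weights that cancel by the
recurrence. For i = n the absent term j = n + 1 has weight 0. -/
theorem IsTL.sum_vee_mul_high (h : IsTL e n) {y : A} (hy : ∀ i ≤ n - 1, y * e i = 0)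
    {i : ℕ} (hi : 2 ≤ i) (hin : i ≤ n) :
    ∑ j ∈ Finset.Icc 1 n, veeCoeff n j • (y * (vee e n j * e i)) = 0 := by
  obtain ⟨a, rfl⟩ : ∃ a, i = a + 2 := ⟨i - 2, by omega⟩
  have h1 : vee e n (a + 1) * e (a + 2) = vee e n (a + 2) := (vee_succ (a + 1)).symm
  have h2 : vee e n (a + 2) * e (a + 2) = dl • vee e n (a + 2) := by
    rw [vee, mul_assoc, h.up_stay hin, mul_smul_comm]
  have hsub : ({a + 1, a + 2, a + 3} : Finset ℕ) ∩ Finset.Icc 1 n ⊆ Finset.Icc 1 n :=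
    Finset.inter_subset_right
  rw [← Finset.sum_subset hsub]
  · have h3 := veeCoeff_rec n (a + 1)
    rcases hin.eq_or_lt with rfl | hlt
    · have : ({a + 1, a + 2, a + 3} : Finset ℕ) ∩ Finset.Icc 1 (a + 2) = {a + 1, a + 2} := by
        ext x
        simp only [Finset.mem_inter, Finset.mem_insert, Finset.mem_singleton, Finset.mem_Icc]
        omega
      rw [this, Finset.sum_pair (by omega), h1, h2, mul_smul_comm, smul_smul, ← add_smul]
      rw [show a + 1 + 2 = a + 2 + 1 by ring, veeCoeff_top, add_zero] at h3
      rw [mul_comm (veeCoeff _ (a + 2)), h3, zero_smul]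
    · have : ({a + 1, a + 2, a + 3} : Finset ℕ) ∩ Finset.Icc 1 n = {a + 1, a + 2, a + 3} := by
        ext x
        simp only [Finset.mem_inter, Finset.mem_insert, Finset.mem_singleton, Finset.mem_Icc]
        omega
      have h4 : vee e n (a + 3) * e (a + 2) = vee e n (a + 2) := by
        rw [vee, mul_assoc, h.up_back (by omega), vee]
      rw [this, Finset.sum_insert (by simp), Finset.sum_pair (by omega), h1, h2, h4, mul_smul_comm,
        smul_smul, ← add_smul, ← add_smul]
      have h5 : veeCoeff n (a + 1) + (veeCoeff n (a + 2) * dl + veeCoeff n (a + 3)) = 0 := by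
        linear_combination h3
      rw [h5, zero_smul]
  · intro j hj hne
    have hne' : j ≠ a + 1 ∧ j ≠ a + 2 ∧ j ≠ a + 3 := by
      refine ⟨?_, ?_, ?_⟩ <;> rintro rfl <;> exact hne (Finset.mem_inter.2 ⟨by simp, hj⟩)
    rw [Finset.mem_Icc] at hj
    have : ∃ t k, IsWord e (n - 1) t ∧ vee e n j * e (a + 2) = t * down e n k := by
      rcases lt_or_ge j (a + 1) with h3 | h3
      · obtain ⟨t, ht, h4⟩ := h.vee_high (i := a + 2) (j := j) (by omega) (by omega) hin
        exact ⟨t, _, ht, h4⟩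
      · obtain ⟨t, ht, h4⟩ := h.vee_low (i := a + 2) (j := j) (by omega) (by omega) hj.2
        exact ⟨t, _, ht, h4⟩
    obtain ⟨t, k, ht, h3⟩ := this
    rw [h3, ← mul_assoc, mul_word_eq_zero hy ht, zero_mul, smul_zero]

/-- The descending word of length n - 1 cancels against the fork with the same last letter, squared.
The other fork yields the dotted word `vee e n 1`, which cancels against the dotted sum. -/
theorem IsTL.mul_wenzl_low (h : IsTL e n) (hn : 2 ≤ n) {y : A} (hy : ∀ i ≤ n - 1, y * e i = 0)
    {i : ℕ} (hi : i ≤ 1) : y * wenzl e n * e i = 0 := by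
  have hp : pInt n ≠ 0 := pInt_ne_zero (by omega)
  rw [mul_wenzl, h.sum_vee_mul_low hn hy hi, Finset.sum_eq_single (n - 1)]
  · have h1 : pInt (n - (n - 1 : ℕ)) / pInt n = -((pInt n)⁻¹ * dl) := by
      rw [Nat.cast_sub (by omega), Nat.cast_one, sub_sub_cancel, ← qInt_two]
      simp only [dl]
      ring
    have h2 : ∀ a ≤ 1, y * (down e n (n - 1) * e a * e a)
        = dl • (y * (down e n (n - 1) * e a)) := by
      intro a ha
      rw [mul_assoc _ (e a), h.sq a (by omega), mul_smul_comm, mul_smul_comm]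
    have h3 : down e n (n - 1) * e 0 * e 1 = vee e n 1 := mul_assoc _ _ _
    have h4 : down e n (n - 1) * e 1 * e 0 = vee e n 1 := by
      rw [mul_assoc, ← h.comm01 (by omega), ← mul_assoc, h3]
    rw [h1]
    interval_cases i
    · rw [h2 0 (by omega), h4, smul_add, smul_smul, neg_smul, neg_smul]
      abel
    · rw [h2 1 (by omega), h3, smul_add, smul_smul, neg_smul, neg_smul]
      abel
  · intro k hk hne
    rw [Finset.mem_range] at hk
    rw [h.down_comm (by omega) (by omega), ← mul_assoc, hy i (by omega), zero_mul, smul_zero]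
  · intro h1
    exact (h1 (Finset.mem_range.2 (by omega))).elim

theorem IsTL.mul_wenzl_two (h : IsTL e n) (hn : 2 ≤ n) {y : A} (hy : ∀ i ≤ n - 1, y * e i = 0) :
    y * wenzl e n * e 2 = 0 := by
  have hp : pInt n ≠ 0 := pInt_ne_zero (by omega)
  obtain ⟨m, rfl⟩ : ∃ m, n = m + 2 := ⟨n - 2, by omega⟩
  rw [mul_wenzl, h.sum_vee_mul_high hy le_rfl hn, h.fork_two hn (by omega), h.fork_two hn le_rfl,
    Finset.sum_eq_add (a := m) (b := m + 1) (by omega)]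
  · have h1 : down e (m + 2) m * e 2 = down e (m + 2) (m + 1) := by
      rw [down_succ, show m + 2 - m = 2 by omega]
    have h2 : down e (m + 2) (m + 1) * e 2 = dl • down e (m + 2) (m + 1) := by
      have := h.down_stay m
      rwa [show m + 2 - m = 2 by omega] at this
    -- The two forks both give `down e n (n - 1)`. Together they play the role of the recurrence
    -- term q⁰ + q⁻⁰ = 2.
    have h3 := pInt_rec 1
    rw [show (1 : ℤ) + 1 = 2 by norm_num, sub_self, pInt_zero] at h3
    rw [h1, h2, show m + 2 - 1 = m + 1 by omega, mul_smul_comm, smul_smul, add_zero, ← two_smul Cq,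
      smul_smul, ← add_smul, ← add_smul]
    push_cast
    rw [show (m : ℤ) + 2 - m = 2 by ring, show (m : ℤ) + 2 - (m + 1) = 1 by ring]
    have h4 : pInt 2 / pInt (m + 2) + pInt 1 / pInt (m + 2) * dl + (pInt (m + 2))⁻¹ * 2 = 0 := by
      simp only [dl]
      linear_combination (pInt (m + 2))⁻¹ * h3
    rw [h4, zero_smul]
  · intro k hk hne
    rw [Finset.mem_range] at hk
    rw [h.down_comm (by omega) (by omega), ← mul_assoc, hy 2 (by omega), zero_mul, smul_zero]
  · intro h1
    exact (h1 (Finset.mem_range.2 (by omega))).elim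
  · intro h1
    exact (h1 (Finset.mem_range.2 (by omega))).elim

theorem IsTL.mul_wenzl_high (h : IsTL e n) {y : A} (hy : ∀ i ≤ n - 1, y * e i = 0) {i : ℕ}
    (hi : 3 ≤ i) (hin : i ≤ n) : y * wenzl e n * e i = 0 := by
  have hp : pInt n ≠ 0 := pInt_ne_zero (by omega)
  have hfork : ∀ a ≤ 1, y * (down e n (n - 1) * e a * e i) = 0 := by
    intro a ha
    obtain ⟨t, ht, h1⟩ := h.down_mul_far (isWord_gen (e := e) ha) (by omega) hi hin
    rw [h1, ← mul_assoc, mul_word_eq_zero hy ht, zero_mul]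
  rw [mul_wenzl, h.sum_vee_mul_high hy (by omega) hin, hfork 0 (by omega), hfork 1 le_rfl,
    add_zero, add_zero, smul_zero, add_zero]
  obtain ⟨a, rfl⟩ : ∃ a, i = n - a := ⟨n - i, by omega⟩
  have hsub : ({a, a + 1, a + 2} : Finset ℕ) ⊆ Finset.range n := by
    intro x hx
    simp at hx ⊢
    omega
  rw [← Finset.sum_subset hsub]
  · rw [Finset.sum_insert (by simp), Finset.sum_pair (by omega), h.down_stay,
      h.down_back (by omega), ← down_succ, mul_smul_comm, smul_smul, ← add_smul, ← add_smul]
    have h3 := pInt_rec (n - (a + 1))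
    rw [show (n : ℤ) - (a + 1) + 1 = n - a by ring,
      show (n : ℤ) - (a + 1) - 1 = n - (a + 2) by ring] at h3
    push_cast
    have h4 : pInt (n - a) / pInt n + (pInt (n - (a + 1)) / pInt n * dl
        + pInt (n - (a + 2)) / pInt n) = 0 := by
      simp only [dl]
      linear_combination (pInt n)⁻¹ * h3
    rw [h4, zero_smul]
  · intro k hk hne
    rw [Finset.mem_range] at hk
    simp only [Finset.mem_insert, Finset.mem_singleton, not_or] at hne
    rcases lt_or_ge k a with h1 | h1
    · rw [h.down_comm (by omega) (by omega), ← mul_assoc, hy _ (by omega), zero_mul, smul_zero]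
    · obtain ⟨t, ht, h2⟩ := h.down_far (a := a) (k := k) (by omega) hk
      rw [h2, ← mul_assoc, mul_word_eq_zero hy (ht.mono (by omega)), zero_mul, smul_zero]

theorem IsTL.mul_wenzl_eq_zero (h : IsTL e n) (hn : 2 ≤ n) {y : A}
    (hy : ∀ i ≤ n - 1, y * e i = 0) {i : ℕ} (hi : i ≤ n) : y * wenzl e n * e i = 0 := by
  rcases lt_or_ge i 2 with h1 | h1
  · exact h.mul_wenzl_low hn hy (by omega)
  rcases h1.eq_or_lt with rfl | h1
  · exact h.mul_wenzl_two hn hy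
  · exact h.mul_wenzl_high hy h1 hi

end Wenzl

/-! ### Existence of the projections -/

/-- The projections. -/
def jonesWenzl : (n : ℕ) → TL n
  | 0 => 1 + (qInt 2)⁻¹ • gen 0 0
  | 1 => (1 + (qInt 2)⁻¹ • gen 1 0) * (1 + (qInt 2)⁻¹ • gen 1 1)
  | n + 2 => incl (Nat.le_succ (n + 1)) (jonesWenzl (n + 1)) * wenzl (gen (n + 2)) (n + 2)

theorem jonesWenzl_succ_succ (n : ℕ) : jonesWenzl (n + 2) =
    incl (Nat.le_succ (n + 1)) (jonesWenzl (n + 1)) * wenzl (gen (n + 2)) (n + 2) := rfl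

theorem IsTL.factor_mul {A : Type*} [Ring A] [Algebra Cq A] {e : ℕ → A} {n i : ℕ}
    (h : IsTL e n) (hi : i ≤ n) : (1 + (qInt 2)⁻¹ • e i) * e i = 0 := by
  have hq : qInt 2 ≠ 0 := qInt_ne_zero (by norm_num)
  rw [add_mul, one_mul, smul_mul_assoc, h.sq i hi, smul_smul, mul_neg, inv_mul_cancel₀ hq,
    neg_one_smul, add_neg_cancel]

theorem aug_wenzl (n : ℕ) : aug (n + 2) (wenzl (gen (n + 2)) (n + 2)) = 1 := by
  have hp : pInt (n + 2) ≠ 0 := pInt_ne_zero (by omega)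
  have hword : ∀ {x}, IsWord (gen (n + 2)) (n + 2) x → aug (n + 2) x = 0 := by
    rintro _ ⟨l, hl, hne, rfl⟩
    exact aug_wd hl hne
  have h1 : ∀ a ≤ 1, aug (n + 2) (down (gen (n + 2)) (n + 2) (n + 2 - 1) * gen (n + 2) a) = 0 :=
    fun a ha => by rw [map_mul, aug_gen (by omega), mul_zero]
  have h2 : ∀ j ∈ Finset.Icc 1 (n + 2), aug (n + 2)
      (veeCoeff (n + 2) j • vee (gen (n + 2)) (n + 2) j) = 0 := by
    intro j hj
    rw [Finset.mem_Icc] at hj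
    rw [map_smul, vee, map_mul, hword ((isWord_up j).mono hj.2), mul_zero, smul_zero]
  rw [wenzl, map_add, map_add, map_smul, map_add, h1 0 (by omega), h1 1 le_rfl, map_sum, map_sum,
    Finset.sum_eq_zero h2, Finset.sum_eq_single 0]
  · rw [down, map_smul, map_one]
    push_cast
    rw [sub_zero, div_self hp]
    simp
  · intro k _ hk
    rw [map_smul, hword (IsWord.down hk), smul_zero]
  · intro h3
    simp at h3

theorem jonesWenzl_mul_gen (n : ℕ) : ∀ i, i ≤ n → jonesWenzl n * gen n i = 0 := by
  induction n with
  | zero =>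
    intro i hi
    obtain rfl : i = 0 := by omega
    exact (isTL_gen 0).factor_mul le_rfl
  | succ n ih =>
    cases n with
    | zero =>
      intro i hi
      have hT := isTL_gen 1
      rcases hi.eq_or_lt with rfl | hi
      · rw [jonesWenzl, mul_assoc, hT.factor_mul le_rfl, mul_zero]
      · obtain rfl : i = 0 := by omega
        have hc : (1 + (qInt 2)⁻¹ • gen 1 1) * gen 1 0
            = gen 1 0 * (1 + (qInt 2)⁻¹ • gen 1 1) := by
          rw [add_mul, mul_add, smul_mul_assoc, mul_smul_comm, hT.comm01 le_rfl, one_mul, mul_one]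
        rw [jonesWenzl, mul_assoc, hc, ← mul_assoc, hT.factor_mul (by omega), zero_mul]
    | succ n =>
      intro i hi
      refine (isTL_gen (n + 2)).mul_wenzl_eq_zero (by omega) (fun j hj => ?_) hi
      rw [← incl_gen (Nat.le_succ (n + 1)) (by omega), ← map_mul, ih j (by omega), map_zero]

theorem aug_jonesWenzl (n : ℕ) : aug n (jonesWenzl n) = 1 := by
  induction n with
  | zero => simp [jonesWenzl, aug_gen]
  | succ n ih =>
    cases n with
    | zero => simp [jonesWenzl, aug_gen]
    | succ n => rw [jonesWenzl_succ_succ, map_mul, aug_incl, ih, aug_wenzl, one_mul]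

theorem isJonesWenzl_jonesWenzl : IsJonesWenzl jonesWenzl :=
  isJonesWenzl_of_mul_gen jonesWenzl_mul_gen aug_jonesWenzl

/-! ### Loop-free contributions to the coefficients -/

section Recursion

variable {B : Type*} [Ring B] [Algebra Cq B] {ε : ℕ → B}

/-- The coefficient of `e_0 e_1`, for `TL 1`. -/
def fE (h : IsSeparated ε) (h0 : ε 0 * ε 1 ≠ 0) : TL 1 →ₗ[Cq] Cq := coefFun h.isTL 1 h0

/-- The coefficient of `zB e k`, for `TL (k + 2)`. -/
def fB (h : IsSeparated ε) (h0 : ε 0 * ε 1 ≠ 0) (k : ℕ) : TL (k + 2) →ₗ[Cq] Cq :=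
  coefFun h.isTL (k + 2) (h.zB_ne_zero h0 k)

/-- The coefficient of `zC e k`, for `TL (k + 2)`. -/
def fC (h : IsSeparated ε) (h0 : ε 0 * ε 1 ≠ 0) (k : ℕ) : TL (k + 2) →ₗ[Cq] Cq :=
  coefFun h.isTL (k + 2) (h.zC_ne_zero h0 k)

/-- The coefficient of `e_0 e_1 e_3`, for `TL (k + 3)`. -/
def fA (h : IsSeparated ε) (h0 : ε 0 * ε 1 ≠ 0) (k : ℕ) : TL (k + 3) →ₗ[Cq] Cq :=
  coefFun h.isTL (k + 3) (h.zB_ne_zero h0 1)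

/-- The summands of `wenzl` without dotted loop. -/
def wenzlPlain {A : Type*} [Ring A] [Algebra Cq A] (e : ℕ → A) (n : ℕ) : A :=
  ∑ k ∈ Finset.range n, (pInt (n - k) / pInt n) • down e n k
    + (pInt n)⁻¹ • (down e n (n - 1) * e 0 + down e n (n - 1) * e 1)

/-- The summands of `wenzl` with a dotted loop. -/
def wenzlLoop {A : Type*} [Ring A] [Algebra Cq A] (e : ℕ → A) (n : ℕ) : A :=
  ∑ j ∈ Finset.Icc 1 n, veeCoeff n j • vee e n j

theorem wenzl_eq {A : Type*} [Ring A] [Algebra Cq A] (e : ℕ → A) (n : ℕ) :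
    wenzl e n = wenzlPlain e n + wenzlLoop e n := rfl

theorem map_wenzlPlain {n : ℕ} (φ : TL n →ₗ[Cq] Cq) (y : TL n) :
    φ (y * wenzlPlain (gen n) n) =
      ∑ k ∈ Finset.range n, pInt (n - k) / pInt n * φ (y * down (gen n) n k)
      + (pInt n)⁻¹ * (φ (y * (down (gen n) n (n - 1) * gen n 0))
        + φ (y * (down (gen n) n (n - 1) * gen n 1))) := by
  simp only [wenzlPlain, mul_add, Finset.mul_sum, mul_smul_comm, map_add, map_sum, map_smul,
    smul_add, smul_eq_mul]

theorem map_wenzlLoop {n : ℕ} (φ : TL n →ₗ[Cq] Cq) (y : TL n) :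
    φ (y * wenzlLoop (gen n) n) =
      ∑ j ∈ Finset.Icc 1 n, veeCoeff n j * φ (y * vee (gen n) n j) := by
  simp only [wenzlLoop, Finset.mul_sum, mul_smul_comm, map_sum, map_smul, smul_eq_mul]

theorem lift_fork (h : ∀ n, IsTL ε n) {n k a : ℕ} (ha : a ≤ n) :
    lift (h n) (down (gen n) n k * gen n a) = down ε n k * ε a := by
  rw [map_mul, lift_down, lift_gen _ ha]

theorem isMonomial_gen {n a : ℕ} (ha : a ≤ n) : IsMonomial (gen n) n (gen n a) :=
  (isWord_gen ha).isMonomial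

theorem isMonomial_fork {n k a : ℕ} (ha : a ≤ n) :
    IsMonomial (gen n) n (down (gen n) n k * gen n a) :=
  (isMonomial_down k).mul (isMonomial_gen ha)

theorem isMonomial_vee {n j : ℕ} (hj : j ≤ n) : IsMonomial (gen n) n (vee (gen n) n j) :=
  (isMonomial_down _).mul ((isWord_up j).mono hj).isMonomial

theorem IsSeparated.coefFun_down (h : IsSeparated ε) {m k : ℕ} (hk : k < m + 2) {z z' : B}
    (hz : z ≠ 0) (hz' : z' ≠ 0) (hm : z' ∈ levelAlg h.isTL (m + 1))
    (heq : z' * down ε (m + 2) k = z) (x : TL (m + 1)) :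
    coefFun h.isTL (m + 2) hz (incl (Nat.le_succ (m + 1)) x * down (gen (m + 2)) (m + 2) k)
      = coefFun h.isTL (m + 1) hz' x := by
  refine coefFun_transfer h.isTL _ hz hz' hm (isMonomial_down k) ?_ ?_ x
  · rw [lift_down, heq]
  · intro y hy h1
    rw [lift_down] at h1
    exact h.cancel_down hk hy h1

theorem IsSeparated.coefFun_fork (h : IsSeparated ε) {m a : ℕ} (ha : a ≤ 1) {z z' : B}
    (hz : z ≠ 0) (hz' : z' ≠ 0) (hm : z' ∈ levelAlg h.isTL (m + 1))
    (heq : z' * (down ε (m + 2) (m + 1) * ε a) = z) (x : TL (m + 1)) :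
    coefFun h.isTL (m + 2) hz (incl (Nat.le_succ (m + 1)) x *
      (down (gen (m + 2)) (m + 2) (m + 2 - 1) * gen (m + 2) a)) = coefFun h.isTL (m + 1) hz' x := by
  refine coefFun_transfer h.isTL _ hz hz' hm (isMonomial_fork (by omega)) ?_ ?_ x
  · rw [lift_fork _ (by omega)]
    exact heq
  · intro y hy h1
    rw [lift_fork _ (by omega)] at h1
    exact h.cancel_fork ha hy h1

theorem coefFun_down_misses (h : ∀ n, IsTL ε n) {m k : ℕ} {z : B} (hz : z ≠ 0)
    (hmiss : Misses h (m + 1) (down ε (m + 2) k) z) (x : TL (m + 1)) :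
    coefFun h (m + 2) hz (incl (Nat.le_succ (m + 1)) x * down (gen (m + 2)) (m + 2) k) = 0 := by
  refine coefFun_eq_zero h _ hz (isMonomial_down k) ?_ x
  rw [lift_down]
  exact hmiss

theorem coefFun_fork_misses (h : ∀ n, IsTL ε n) {m k a : ℕ} (ha : a ≤ 1) {z : B} (hz : z ≠ 0)
    (hmiss : Misses h (m + 1) (down ε (m + 2) k * ε a) z) (x : TL (m + 1)) :
    coefFun h (m + 2) hz (incl (Nat.le_succ (m + 1)) x *
      (down (gen (m + 2)) (m + 2) k * gen (m + 2) a)) = 0 := by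
  refine coefFun_eq_zero h _ hz (isMonomial_fork (by omega)) ?_ x
  rw [lift_fork _ (by omega)]
  exact hmiss

section Values

variable (h : IsSeparated ε) (h0 : ε 0 * ε 1 ≠ 0)

theorem fB_down (k j : ℕ) (hj : j < k + 3) (x : TL (k + 2)) :
    fB h h0 (k + 1) (incl (Nat.le_succ (k + 2)) x * down (gen (k + 3)) (k + 3) j)
      = if j = 1 then fB h h0 k x else 0 := by
  split_ifs with h1
  · subst h1
    exact h.coefFun_down (m := k + 1) hj _ _ ((isWord_zB k).mem h.isTL)
      (by rw [down, down, one_mul]; rfl) x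
  · exact coefFun_down_misses h.isTL (m := k + 1) _ (h.misses_zB_down h0 hj h1) x

theorem fB_fork (k a : ℕ) (ha : a ≤ 1) (x : TL (k + 2)) :
    fB h h0 (k + 1) (incl (Nat.le_succ (k + 2)) x *
      (down (gen (k + 3)) (k + 3) (k + 2) * gen (k + 3) a)) = fC h h0 k x :=
  h.coefFun_fork (m := k + 1) ha _ _ ((isWord_zC k).mem h.isTL)
    ((h.isTL (k + 3)).zC_fork le_rfl ha) x

theorem fC_down (k j : ℕ) (hj : j < k + 3) (x : TL (k + 2)) :
    fC h h0 (k + 1) (incl (Nat.le_succ (k + 2)) x * down (gen (k + 3)) (k + 3) j)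
      = if j = 2 then fC h h0 k x else 0 := by
  split_ifs with h1
  · subst h1
    exact h.coefFun_down (m := k + 1) hj _ _ ((isWord_zC k).mem h.isTL)
      (by rw [down, down, down, one_mul, zC_succ, mul_assoc]; rfl) x
  · exact coefFun_down_misses h.isTL (m := k + 1) _ (h.misses_zC_down h0 hj h1) x

theorem fC_fork (k a : ℕ) (ha : a ≤ 1) (x : TL (k + 2)) :
    fC h h0 (k + 1) (incl (Nat.le_succ (k + 2)) x *
      (down (gen (k + 3)) (k + 3) (k + 2) * gen (k + 3) a)) = 0 :=
  coefFun_fork_misses h.isTL (m := k + 1) ha _ (h.misses_zC_fork h0 ha _) x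

theorem fA_down (k j : ℕ) (hj : j < k + 4) (x : TL (k + 3)) :
    fA h h0 (k + 1) (incl (Nat.le_succ (k + 3)) x * down (gen (k + 4)) (k + 4) j)
      = (if j = 0 then fA h h0 k x else 0) + if j = k + 2 then fB h h0 (k + 1) x else 0 := by
  rcases eq_or_ne j 0 with rfl | h1
  · rw [if_pos rfl, if_neg (by omega), add_zero]
    exact h.coefFun_down (m := k + 2) hj _ _
      (levelAlg_mono _ (by omega) ((isWord_zB 1).mem h.isTL)) (by rw [down, mul_one]) x
  rw [if_neg h1, zero_add]
  split_ifs with h2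
  · subst h2
    exact h.coefFun_down (m := k + 2) hj _ _ ((isWord_zB (k + 1)).mem h.isTL)
      ((h.isTL (k + 4)).zB_down le_rfl) x
  · exact coefFun_down_misses h.isTL (m := k + 2) _ (h.misses_zA_down h0 hj h1 h2) x

theorem fA_fork (k a : ℕ) (ha : a ≤ 1) (x : TL (k + 3)) :
    fA h h0 (k + 1) (incl (Nat.le_succ (k + 3)) x *
      (down (gen (k + 4)) (k + 4) (k + 3) * gen (k + 4) a)) = fB h h0 (k + 1) x :=
  h.coefFun_fork (m := k + 2) ha _ _ ((isWord_zB (k + 1)).mem h.isTL)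
    ((h.isTL (k + 4)).zB_fork le_rfl ha) x

theorem fB_zero_down (j : ℕ) (hj : j < 2) (x : TL 1) :
    fB h h0 0 (incl (Nat.le_succ 1) x * down (gen 2) 2 j) = if j = 0 then fE h h0 x else 0 := by
  have hm : ε 0 * ε 1 ∈ levelAlg h.isTL 1 := mul_mem (mem_gen _ (by omega)) (mem_gen _ le_rfl)
  split_ifs with h1
  · subst h1
    exact h.coefFun_down (m := 0) hj _ _ hm (by rw [down, mul_one]; rfl) x
  · obtain rfl : j = 1 := by omega
    exact coefFun_down_misses h.isTL (m := 0) _ (h.misses_zero_down h0) x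

theorem fB_zero_fork (a : ℕ) (ha : a ≤ 1) (x : TL 1) :
    fB h h0 0 (incl (Nat.le_succ 1) x * (down (gen 2) 2 1 * gen 2 a)) = fE h h0 x :=
  h.coefFun_fork (m := 0) ha _ _ (mul_mem (mem_gen _ (by omega)) (mem_gen _ le_rfl))
    (by simpa [down, zB] using (h.isTL 2).up_one_fork le_rfl ha) x

/-- `zB` is reached from the shorter `zB` by one new letter, and from `zC` through either of the two
forks. -/
theorem fB_plain (k : ℕ) (x : TL (k + 2)) :
    fB h h0 (k + 1) (incl (Nat.le_succ (k + 2)) x * wenzlPlain (gen (k + 3)) (k + 3))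
      = pInt (k + 2) / pInt (k + 3) * fB h h0 k x + 2 * (pInt (k + 3))⁻¹ * fC h h0 k x := by
  rw [map_wenzlPlain]
  have h1 := fB_fork h h0 k 0 (by omega) x
  have h2 := fB_fork h h0 k 1 le_rfl x
  erw [h1, h2]
  rw [Finset.sum_congr rfl fun j hj => by
    rw [fB_down h h0 k j (Finset.mem_range.1 hj) x]]
  simp only [mul_ite, mul_zero, Finset.sum_ite_eq', Finset.mem_range]
  rw [if_pos (by omega)]
  push_cast
  rw [show (k : ℤ) + 1 + 2 - 1 = k + 2 by ring, show (k : ℤ) + 1 + 2 = k + 3 by ring]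
  ring

theorem fC_plain (k : ℕ) (x : TL (k + 2)) :
    fC h h0 (k + 1) (incl (Nat.le_succ (k + 2)) x * wenzlPlain (gen (k + 3)) (k + 3))
      = pInt (k + 1) / pInt (k + 3) * fC h h0 k x := by
  rw [map_wenzlPlain]
  have h1 := fC_fork h h0 k 0 (by omega) x
  have h2 := fC_fork h h0 k 1 le_rfl x
  erw [h1, h2]
  rw [Finset.sum_congr rfl fun j hj => by
    rw [fC_down h h0 k j (Finset.mem_range.1 hj) x]]
  simp only [mul_ite, mul_zero, Finset.sum_ite_eq', Finset.mem_range]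
  rw [if_pos (by omega)]
  push_cast
  rw [show (k : ℤ) + 1 + 2 - 2 = k + 1 by ring, show (k : ℤ) + 1 + 2 = k + 3 by ring]
  ring

theorem fA_plain (k : ℕ) (x : TL (k + 3)) :
    fA h h0 (k + 1) (incl (Nat.le_succ (k + 3)) x * wenzlPlain (gen (k + 4)) (k + 4))
      = fA h h0 k x + (pInt 2 + 2) / pInt (k + 4) * fB h h0 (k + 1) x := by
  have hp : pInt (k + 4) ≠ 0 := pInt_ne_zero (by omega)
  rw [map_wenzlPlain]
  have h1 := fA_fork h h0 k 0 (by omega) x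
  have h2 := fA_fork h h0 k 1 le_rfl x
  erw [h1, h2]
  rw [Finset.sum_congr rfl fun j hj => by
    rw [fA_down h h0 k j (Finset.mem_range.1 hj) x]]
  simp only [mul_add, mul_ite, mul_zero, Finset.sum_add_distrib, Finset.sum_ite_eq',
    Finset.mem_range]
  rw [if_pos (by omega), if_pos (by omega)]
  push_cast
  rw [show (k : ℤ) + 1 + 3 - (k + 2) = 2 by ring, sub_zero, show (k : ℤ) + 1 + 3 = k + 4 by ring,
    div_self hp]
  ring

theorem fB_zero_plain (x : TL 1) :
    fB h h0 0 (incl (Nat.le_succ 1) x * wenzlPlain (gen 2) 2)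
      = (pInt 2 + 2) / pInt 2 * fE h h0 x := by
  have hp : pInt 2 ≠ 0 := pInt_ne_zero (by omega)
  rw [map_wenzlPlain]
  have h1 := fB_zero_fork h h0 0 (by omega) x
  have h2 := fB_zero_fork h h0 1 le_rfl x
  erw [h1, h2]
  rw [Finset.sum_congr rfl fun j hj => by
    rw [fB_zero_down h h0 j (Finset.mem_range.1 hj) x]]
  simp only [mul_ite, mul_zero, Finset.sum_ite_eq', Finset.mem_range]
  rw [if_pos (by omega)]
  push_cast
  rw [div_self hp]
  field_simp
  ring

end Values

end Recursion

/-! ### Contributions of dotted loops -/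

/-- Contributions with a dotted loop, in the representation that does not see the dots. -/
theorem coefFun_vee {m j : ℕ} (hj1 : 1 ≤ j) (hj : j ≤ m + 2) {z : Op} (hz : z ≠ 0)
    (x : TL (m + 1)) :
    coefFun isTL_eA (m + 2) hz (incl (Nat.le_succ (m + 1)) x * vee (gen (m + 2)) (m + 2) j)
      = dl * coefFun isTL_eA (m + 2) hz (incl (Nat.le_succ (m + 1)) x *
        if j = 1 then down (gen (m + 2)) (m + 2) (m + 1) * gen (m + 2) 1
        else down (gen (m + 2)) (m + 2) (m + 3 - j)) := by
  set u : TL (m + 2) := if j = 1 then down (gen (m + 2)) (m + 2) (m + 1) * gen (m + 2) 1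
    else down (gen (m + 2)) (m + 2) (m + 3 - j) with hu
  have hmon : IsMonomial (gen (m + 2)) (m + 2) u := by
    rw [hu]
    split_ifs
    · exact isMonomial_fork (by omega)
    · exact isMonomial_down _
  have hlift : lift (isTL_eA (m + 2)) (vee (gen (m + 2)) (m + 2) j)
      = dl • lift (isTL_eA (m + 2)) u := by
    rw [map_vee _ hj fun i hi => lift_gen (isTL_eA (m + 2)) hi, eA_vee hj1 hj, hu]
    congr 1
    split_ifs with h1
    · subst h1
      rw [lift_fork _ (by omega), show m + 2 + 1 - 1 = (m + 1) + 1 by omega, down_succ,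
        show m + 2 - (m + 1) = 1 by omega]
    · rw [lift_down]
  induction x using induction_word with
  | hw l hl =>
    rw [coefFun_incl_mul _ _ hz hl (isMonomial_vee hj), coefFun_incl_mul _ _ hz hl hmon, hlift,
      mul_smul_comm, coef_smul hz]
  | hadd x y hx hy => rw [map_add, add_mul, map_add, hx, hy, add_mul, map_add, mul_add]
  | hsmul c x hx =>
    rw [map_smul, smul_mul_assoc, map_smul, hx, smul_mul_assoc, map_smul, smul_eq_mul, smul_eq_mul]
    ring

/-- The loop contributions are the same in both representations. -/
theorem coefFun_vee_eT {m j : ℕ} (hj1 : 1 ≤ j) (hj : j ≤ m + 2) {z : Op × Op} (hz : z ≠ 0)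
    (hz1 : z.1 ≠ 0) (hz2 : z.2 = 0) (x : TL (m + 1)) :
    coefFun isTL_eT (m + 2) hz (incl (Nat.le_succ (m + 1)) x * vee (gen (m + 2)) (m + 2) j)
      = coefFun isTL_eA (m + 2) hz1
        (incl (Nat.le_succ (m + 1)) x * vee (gen (m + 2)) (m + 2) j) := by
  induction x using induction_word with
  | hw l hl =>
    rw [coefFun_incl_mul _ _ hz hl (isMonomial_vee hj),
      coefFun_incl_mul _ _ hz1 hl (isMonomial_vee hj)]
    have h1 : (wd eT l).1 = wd eA l := map_wd (AlgHom.fst Cq Op Op) eT l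
    -- Both the dotted word and z vanish in `eB`, so `eA` alone decides whether one is a multiple of
    -- the other.
    have h2 : (wd eT l * lift (isTL_eT (m + 2)) (vee (gen (m + 2)) (m + 2) j)).2 = 0 := by
      rw [Prod.snd_mul, snd_lift_eT, map_vee _ hj fun i hi => lift_gen (isTL_eB (m + 2)) hi,
        eB_vee hj1, mul_zero]
    rw [← fst_lift_eT, ← h1, ← Prod.fst_mul, ← one_mul (coef z.1 _)]
    refine coef_congr one_ne_zero hz hz1 fun c => ?_
    rw [one_mul, Prod.ext_iff, h2, Prod.smul_snd, hz2, smul_zero]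
    simp
  | hadd x y hx hy => rw [map_add, add_mul, map_add, hx, hy, map_add]
  | hsmul c x hx => rw [map_smul, smul_mul_assoc, map_smul, hx, map_smul]

theorem fB_vee {k j : ℕ} (hj1 : 1 ≤ j) (hj : j ≤ k + 3) (x : TL (k + 2)) :
    fB isSeparated_eA eA_ne_zero (k + 1)
        (incl (Nat.le_succ (k + 2)) x * vee (gen (k + 3)) (k + 3) j)
      = (if j = 1 then dl * fC isSeparated_eA eA_ne_zero k x else 0)
        + if j = k + 3 then dl * fB isSeparated_eA eA_ne_zero k x else 0 := by
  refine (coefFun_vee (m := k + 1) hj1 hj _ x).trans ?_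
  split_ifs with h1 h2 h2
  · omega
  · rw [add_zero]
    exact congrArg (dl * ·) (fB_fork isSeparated_eA eA_ne_zero k 1 le_rfl x)
  · refine (congrArg (dl * ·) (fB_down isSeparated_eA eA_ne_zero k _ (by omega) x)).trans ?_
    rw [if_pos (by omega), zero_add]
  · refine (congrArg (dl * ·) (fB_down isSeparated_eA eA_ne_zero k _ (by omega) x)).trans ?_
    rw [if_neg (by omega), zero_add, mul_zero]

theorem fC_vee {k j : ℕ} (hj1 : 1 ≤ j) (hj : j ≤ k + 3) (x : TL (k + 2)) :
    fC isSeparated_eA eA_ne_zero (k + 1)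
        (incl (Nat.le_succ (k + 2)) x * vee (gen (k + 3)) (k + 3) j)
      = if j = k + 2 then dl * fC isSeparated_eA eA_ne_zero k x else 0 := by
  refine (coefFun_vee (m := k + 1) hj1 hj _ x).trans ?_
  split_ifs with h1 h2 h2
  · omega
  · refine (congrArg (dl * ·) (fC_fork isSeparated_eA eA_ne_zero k 1 le_rfl x)).trans ?_
    rw [mul_zero]
  · refine (congrArg (dl * ·) (fC_down isSeparated_eA eA_ne_zero k _ (by omega) x)).trans ?_
    rw [if_pos (by omega)]
  · refine (congrArg (dl * ·) (fC_down isSeparated_eA eA_ne_zero k _ (by omega) x)).trans ?_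
    rw [if_neg (by omega), mul_zero]

theorem fA_vee {k j : ℕ} (hj1 : 1 ≤ j) (hj : j ≤ k + 4) (x : TL (k + 3)) :
    fA isSeparated_eA eA_ne_zero (k + 1)
        (incl (Nat.le_succ (k + 3)) x * vee (gen (k + 4)) (k + 4) j)
      = (if j = 1 then dl * fB isSeparated_eA eA_ne_zero (k + 1) x else 0)
        + if j = 3 then dl * fB isSeparated_eA eA_ne_zero (k + 1) x else 0 := by
  refine (coefFun_vee (m := k + 2) hj1 hj _ x).trans ?_
  split_ifs with h1 h2 h2
  · omega
  · rw [add_zero]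
    exact congrArg (dl * ·) (fA_fork isSeparated_eA eA_ne_zero k 1 le_rfl x)
  · refine (congrArg (dl * ·) (fA_down isSeparated_eA eA_ne_zero k _ (by omega) x)).trans ?_
    rw [if_neg (by omega), if_pos (by omega), zero_add, zero_add]
  · refine (congrArg (dl * ·) (fA_down isSeparated_eA eA_ne_zero k _ (by omega) x)).trans ?_
    rw [if_neg (by omega), if_neg (by omega), zero_add, mul_zero]

theorem fB_zero_vee {j : ℕ} (hj1 : 1 ≤ j) (hj : j ≤ 2) (x : TL 1) :
    fB isSeparated_eA eA_ne_zero 0 (incl (Nat.le_succ 1) x * vee (gen 2) 2 j)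
      = if j = 1 then dl * fE isSeparated_eA eA_ne_zero x else 0 := by
  refine (coefFun_vee (m := 0) hj1 hj _ x).trans ?_
  split_ifs with h1
  · exact congrArg (dl * ·) (fB_zero_fork isSeparated_eA eA_ne_zero 1 le_rfl x)
  · refine (congrArg (dl * ·) (fB_zero_down isSeparated_eA eA_ne_zero _ (by omega) x)).trans ?_
    rw [if_neg (by omega), mul_zero]

theorem fB_loop (k : ℕ) (x : TL (k + 2)) :
    fB isSeparated_eA eA_ne_zero (k + 1)
        (incl (Nat.le_succ (k + 2)) x * wenzlLoop (gen (k + 3)) (k + 3))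
      = veeCoeff (k + 3) 1 * (dl * fC isSeparated_eA eA_ne_zero k x)
        + veeCoeff (k + 3) (k + 3) * (dl * fB isSeparated_eA eA_ne_zero k x) := by
  rw [map_wenzlLoop, Finset.sum_congr rfl fun j hj => by
    rw [fB_vee (Finset.mem_Icc.1 hj).1 (Finset.mem_Icc.1 hj).2]]
  simp only [mul_add, mul_ite, mul_zero, Finset.sum_add_distrib, Finset.sum_ite_eq',
    Finset.mem_Icc]
  rw [if_pos (by omega), if_pos (by omega)]

theorem fC_loop (k : ℕ) (x : TL (k + 2)) :
    fC isSeparated_eA eA_ne_zero (k + 1)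
        (incl (Nat.le_succ (k + 2)) x * wenzlLoop (gen (k + 3)) (k + 3))
      = veeCoeff (k + 3) (k + 2) * (dl * fC isSeparated_eA eA_ne_zero k x) := by
  rw [map_wenzlLoop, Finset.sum_congr rfl fun j hj => by
    rw [fC_vee (Finset.mem_Icc.1 hj).1 (Finset.mem_Icc.1 hj).2]]
  simp only [mul_ite, mul_zero, Finset.sum_ite_eq', Finset.mem_Icc]
  rw [if_pos (by omega)]

theorem fA_loop (k : ℕ) (x : TL (k + 3)) :
    fA isSeparated_eA eA_ne_zero (k + 1)
        (incl (Nat.le_succ (k + 3)) x * wenzlLoop (gen (k + 4)) (k + 4))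
      = (veeCoeff (k + 4) 1 + veeCoeff (k + 4) 3) *
        (dl * fB isSeparated_eA eA_ne_zero (k + 1) x) := by
  rw [map_wenzlLoop, Finset.sum_congr rfl fun j hj => by
    rw [fA_vee (Finset.mem_Icc.1 hj).1 (Finset.mem_Icc.1 hj).2]]
  simp only [mul_add, mul_ite, mul_zero, Finset.sum_add_distrib, Finset.sum_ite_eq',
    Finset.mem_Icc]
  rw [if_pos (by omega), if_pos (by omega), add_mul]

theorem fB_zero_loop (x : TL 1) :
    fB isSeparated_eA eA_ne_zero 0 (incl (Nat.le_succ 1) x * wenzlLoop (gen 2) 2)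
      = veeCoeff 2 1 * (dl * fE isSeparated_eA eA_ne_zero x) := by
  rw [map_wenzlLoop, Finset.sum_congr rfl fun j hj => by
    rw [fB_zero_vee (Finset.mem_Icc.1 hj).1 (Finset.mem_Icc.1 hj).2]]
  simp only [mul_ite, mul_zero, Finset.sum_ite_eq', Finset.mem_Icc]
  rw [if_pos (by omega)]

theorem coefFun_loop_eT {m : ℕ} {z : Op × Op} (hz : z ≠ 0)
    {z' : Op} (hz' : z' ≠ 0) (hz1 : z.1 = z') (hz2 : z.2 = 0) (x : TL (m + 1)) :
    coefFun isTL_eT (m + 2) hz (incl (Nat.le_succ (m + 1)) x * wenzlLoop (gen (m + 2)) (m + 2))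
      = coefFun isTL_eA (m + 2) hz'
        (incl (Nat.le_succ (m + 1)) x * wenzlLoop (gen (m + 2)) (m + 2)) := by
  subst hz1
  rw [map_wenzlLoop, map_wenzlLoop]
  refine Finset.sum_congr rfl fun j hj => ?_
  rw [Finset.mem_Icc] at hj
  rw [coefFun_vee_eT hj.1 hj.2 hz hz' hz2]

theorem eT_snd_zB (k : ℕ) : (zB eT k).2 = 0 :=
  (map_zB (AlgHom.snd Cq Op Op) fun _ _ => rfl).trans (eB_zB k)

theorem eT_fst_zC (k : ℕ) : (zC eT k).1 = zC eA k := map_zC (AlgHom.fst Cq Op Op) fun _ _ => rfl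

theorem eT_snd_zC (k : ℕ) : (zC eT k).2 = 0 :=
  (map_zC (AlgHom.snd Cq Op Op) fun _ _ => rfl).trans (eB_zC k)

theorem fB_loop_eT (k : ℕ) (x : TL (k + 1)) :
    fB isSeparated_eT eT_ne_zero k
        (incl (Nat.le_succ (k + 1)) x * wenzlLoop (gen (k + 2)) (k + 2))
      = fB isSeparated_eA eA_ne_zero k
        (incl (Nat.le_succ (k + 1)) x * wenzlLoop (gen (k + 2)) (k + 2)) :=
  coefFun_loop_eT (m := k) _ (isSeparated_eA.zB_ne_zero eA_ne_zero k) (eT_fst_zB k) (eT_snd_zB k) x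

theorem fC_loop_eT (k : ℕ) (x : TL (k + 1)) :
    fC isSeparated_eT eT_ne_zero k
        (incl (Nat.le_succ (k + 1)) x * wenzlLoop (gen (k + 2)) (k + 2))
      = fC isSeparated_eA eA_ne_zero k
        (incl (Nat.le_succ (k + 1)) x * wenzlLoop (gen (k + 2)) (k + 2)) :=
  coefFun_loop_eT (m := k) _ (isSeparated_eA.zC_ne_zero eA_ne_zero k) (eT_fst_zC k) (eT_snd_zC k) x

theorem fA_loop_eT (k : ℕ) (x : TL (k + 2)) :
    fA isSeparated_eT eT_ne_zero k
        (incl (Nat.le_succ (k + 2)) x * wenzlLoop (gen (k + 3)) (k + 3))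
      = fA isSeparated_eA eA_ne_zero k
        (incl (Nat.le_succ (k + 2)) x * wenzlLoop (gen (k + 3)) (k + 3)) :=
  coefFun_loop_eT (m := k + 1) _ (isSeparated_eA.zB_ne_zero eA_ne_zero 1) (eT_fst_zB 1)
    (eT_snd_zB 1) x

/-! ### Closed forms and their recurrences -/

section Numbers

theorem qInt_mul_pInt (a b : ℤ) : qInt a * pInt b = qInt (a + b) + qInt (a - b) := by
  have := X_ne_zero
  simp only [qInt, pInt, neg_add, neg_sub, zpow_add₀ X_ne_zero, zpow_sub₀ X_ne_zero, zpow_neg]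
  field_simp
  ring

theorem qInt_neg (a : ℤ) : qInt (-a) = -qInt a := by
  rw [qInt, qInt, neg_neg]
  ring

theorem qInt_two_mul (a : ℤ) : qInt (2 * a) = qInt a * pInt a := by
  rw [qInt_mul_pInt, sub_self, qInt_zero, add_zero, two_mul]

/-- In `eA` the dotted terms merge with the loop-free ones. After division by [n+1] (q^n + q^{-n}),
this says that the merged weights are [j]/[n+1], as for Jones–Wenzl projections of type A. At j = 1
the two forks supply q⁰ + q⁻⁰ = 2. -/
theorem pInt_mul_qInt_sub (n j : ℤ) :
    pInt (j - 1) * qInt (n + 1) - qInt 2 * qInt (n + 1 - j) = qInt j * pInt n := by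
  have h := qInt_neg (n - j)
  rw [neg_sub] at h
  rw [qInt_two, mul_comm, mul_comm (pInt 1), qInt_mul_pInt, qInt_mul_pInt, qInt_mul_pInt, h]
  ring_nf

theorem X_sub_inv : (RatFunc.X : Cq) - RatFunc.X⁻¹ = (RatFunc.X ^ 2 - 1) * RatFunc.X⁻¹ := by
  have := X_ne_zero
  field_simp

theorem X_sq_sub_one_ne_zero : (RatFunc.X : Cq) ^ 2 - 1 ≠ 0 :=
  sub_ne_zero.2 (X_pow_ne_one (by norm_num))

theorem qInt_mul_qInt_add_one (n : ℤ) : qInt (n + 1) * qInt (n - 1) + 1 = qInt n ^ 2 := by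
  have := X_ne_zero
  have h := X_sq_sub_one_ne_zero
  simp only [qInt, neg_add, neg_sub, zpow_add₀ X_ne_zero, zpow_sub₀ X_ne_zero, zpow_neg, X_sub_inv]
  field_simp
  ring

/-- The building block of `tBVal` and `tCVal`. -/
def hVal (k : ℤ) : Cq := qInt 2 * qInt (k + 1) * qInt k / (qInt (k + 2) * pInt (k + 1))

/-- The value of `dl * fB` on the projection, in the representation `eA`. -/
def aBVal (k : ℤ) : Cq := qInt 2 ^ 2 * qInt (k + 1) / (qInt (k + 2) * qInt (k + 3))

/-- The value of `dl * fC` on the projection, in the representation `eA`. -/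
def aCVal (k : ℤ) : Cq := qInt 2 ^ 2 / (qInt (k + 2) * qInt (k + 3))

/-- The value of `fC` on the projection, in the representation `eT`. -/
def tCVal (k : ℤ) : Cq := hVal (k + 1) - hVal k

/-- The value of `fB` on the projection, in the representation `eT`. -/
def tBVal (k : ℤ) : Cq := (qInt 2 ^ 2 * qInt (k + 1) / qInt (k + 3) + 2 * hVal k) / pInt (k + 2)

/-- The value of `fA` on the projection, in the representation `eT`. -/
def tAVal (k : ℤ) : Cq :=
  qInt 2 ^ 2 * qInt (k + 2) ^ 2 * qInt (k + 1) / (pInt (k + 2) * qInt (k + 4) * qInt (k + 3))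
    + 2 * (qInt 2 * qInt (k + 2) ^ 2 * qInt (k + 1) / (pInt (k + 3) * pInt (k + 2) * qInt (k + 4)))

theorem aCVal_succ (k : ℕ) : aCVal (k + 1) = pInt (k + 1) / pInt (k + 3) * aCVal k
    - veeCoeff (k + 3) (k + 2) * (qInt 2 * aCVal k) := by
  have h2 : qInt (k + 2) ≠ 0 := qInt_ne_zero (by omega)
  have h3 : qInt (k + 3) ≠ 0 := qInt_ne_zero (by omega)
  have h4 : qInt (k + 4) ≠ 0 := qInt_ne_zero (by omega)
  have hp : pInt (k + 3) ≠ 0 := pInt_ne_zero (by omega)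
  have h := pInt_mul_qInt_sub (k + 3) (k + 2)
  simp only [aCVal, veeCoeff]
  push_cast
  ring_nf at h h2 h3 h4 hp ⊢
  field_simp
  linear_combination -qInt 2 ^ 2 * h

theorem aBVal_succ (k : ℕ) : aBVal (k + 1) = pInt (k + 2) / pInt (k + 3) * aBVal k
    + 2 * (pInt (k + 3))⁻¹ * aCVal k
    - (veeCoeff (k + 3) 1 * (qInt 2 * aCVal k)
      + veeCoeff (k + 3) (k + 3) * (qInt 2 * aBVal k)) := by
  have h2 : qInt (k + 2) ≠ 0 := qInt_ne_zero (by omega)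
  have h3 : qInt (k + 3) ≠ 0 := qInt_ne_zero (by omega)
  have h4 : qInt (k + 4) ≠ 0 := qInt_ne_zero (by omega)
  have hp : pInt (k + 3) ≠ 0 := pInt_ne_zero (by omega)
  have hB := pInt_mul_qInt_sub (k + 3) (k + 3)
  have hC := pInt_mul_qInt_sub (k + 3) 1
  have hm := qInt_mul_qInt_add_one (k + 2)
  have h1 := qInt_one
  have hp0 := pInt_zero
  simp only [aCVal, aBVal, veeCoeff]
  push_cast
  ring_nf at h1 hp0 hm hB hC h2 h3 h4 hp ⊢
  rw [h1, hp0] at *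
  field_simp
  grind

theorem pInt_eq (m : ℤ) : pInt m = qInt (m + 1) - qInt (m - 1) := by
  have h := qInt_mul_pInt 1 m
  have h' := qInt_neg (m - 1)
  rw [qInt_one, one_mul] at h
  rw [h, add_comm 1 m, ← neg_sub m 1, h', ← sub_eq_add_neg]

theorem tCVal_succ (k : ℕ) : tCVal (k + 1) = pInt (k + 1) / pInt (k + 3) * tCVal k
    + veeCoeff (k + 3) (k + 2) * aCVal k := by
  have h2 : qInt (k + 2) ≠ 0 := qInt_ne_zero (by omega)
  have h3 : qInt (k + 3) ≠ 0 := qInt_ne_zero (by omega)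
  have h4 : qInt (k + 4) ≠ 0 := qInt_ne_zero (by omega)
  have hp1 : pInt (k + 1) ≠ 0 := pInt_ne_zero (by omega)
  have hp2 : pInt (k + 2) ≠ 0 := pInt_ne_zero (by omega)
  have hp3 : pInt (k + 3) ≠ 0 := pInt_ne_zero (by omega)
  have e1 := pInt_eq (k + 1)
  have e2 := pInt_eq (k + 2)
  have e3 := pInt_eq (k + 3)
  have r1 := eq_sub_of_add_eq' (qInt_rec (k + 1))
  have r2 := eq_sub_of_add_eq' (qInt_rec (k + 2))
  have r3 := eq_sub_of_add_eq (qInt_rec (k + 3))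
  have hm := qInt_mul_qInt_add_one (k + 2)
  simp only [aCVal, tCVal, hVal, veeCoeff]
  push_cast
  simp only [add_assoc, add_sub_assoc] at *
  norm_num1 at *
  simp only [add_zero] at *
  field_simp
  -- Everything is now expressed in [2], [k+2] and [k+3], and `hm` is the quadratic relation between
  -- them.
  rw [e1, e2, e3, r1, r3, r2]
  rw [r2] at hm
  clear * - hm
  grind

/-- After multiplication by `pInt (k + 3)` both parts telescope. The term 2 `tCVal k` is twice an
increment of `hVal`, and the loop terms make up the increment of [2]² [k+1]/[k+3]. -/
theorem tBVal_succ (k : ℕ) : tBVal (k + 1) = pInt (k + 2) / pInt (k + 3) * tBVal k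
    + 2 * (pInt (k + 3))⁻¹ * tCVal k
    + (veeCoeff (k + 3) 1 * aCVal k + veeCoeff (k + 3) (k + 3) * aBVal k) := by
  have h2 : qInt (k + 2) ≠ 0 := qInt_ne_zero (by omega)
  have h3 : qInt (k + 3) ≠ 0 := qInt_ne_zero (by omega)
  have h4 : qInt (k + 4) ≠ 0 := qInt_ne_zero (by omega)
  have hp1 : pInt (k + 1) ≠ 0 := pInt_ne_zero (by omega)
  have hp2 : pInt (k + 2) ≠ 0 := pInt_ne_zero (by omega)
  have hp3 : pInt (k + 3) ≠ 0 := pInt_ne_zero (by omega)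
  have r2 := eq_sub_of_add_eq' (qInt_rec (k + 2))
  have r3 := eq_sub_of_add_eq (qInt_rec (k + 3))
  have hm := qInt_mul_qInt_add_one (k + 2)
  have h1 := qInt_one
  simp only [aCVal, tCVal, aBVal, tBVal, hVal, veeCoeff]
  push_cast
  simp only [add_assoc, add_sub_assoc] at *
  norm_num1 at *
  rw [show (k : ℤ) + (3 + (1 - (k + 3))) = 1 by ring, h1]
  field_simp
  rw [r3, r2]
  rw [r2] at hm
  clear * - hm
  grind

theorem pInt_two_add_two : pInt 2 + 2 = qInt 2 ^ 2 := by
  have := pInt_rec 1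
  rw [← qInt_two, sub_self, pInt_zero] at this
  rw [sq, ← this]
  norm_num

theorem tAVal_succ (k : ℕ) : tAVal (k + 1) = tAVal k + (pInt 2 + 2) / pInt (k + 4) * tBVal (k + 1)
    + (veeCoeff (k + 4) 1 + veeCoeff (k + 4) 3) * aBVal (k + 1) := by
  have h2 : qInt (k + 2) ≠ 0 := qInt_ne_zero (by omega)
  have h3 : qInt (k + 3) ≠ 0 := qInt_ne_zero (by omega)
  have h4 : qInt (k + 4) ≠ 0 := qInt_ne_zero (by omega)
  have h5 : qInt (k + 5) ≠ 0 := qInt_ne_zero (by omega)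
  have hp2 : pInt (k + 2) ≠ 0 := pInt_ne_zero (by omega)
  have hp3 : pInt (k + 3) ≠ 0 := pInt_ne_zero (by omega)
  have hp4 : pInt (k + 4) ≠ 0 := pInt_ne_zero (by omega)
  have e2 := pInt_eq (k + 2)
  have e3 := pInt_eq (k + 3)
  have e4 := pInt_eq (k + 4)
  have r1 := eq_sub_of_add_eq' (qInt_rec (k + 2))
  have r2 := eq_sub_of_add_eq' (qInt_rec (k + 3))
  have r4 := eq_sub_of_add_eq (qInt_rec (k + 4))
  have hm := qInt_mul_qInt_add_one (k + 3)
  rw [pInt_two_add_two]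
  simp only [tAVal, aBVal, tBVal, hVal, veeCoeff]
  push_cast
  simp only [add_assoc, add_sub_assoc] at *
  norm_num1 at *
  field_simp
  -- Reduction to [2], [k+3] and [k+4], tied by `hm`.
  rw [e2, e3, e4, r1, r4, r2]
  rw [r2] at hm
  clear * - hm
  grind

theorem pInt_two : pInt 2 = qInt 3 - 1 := by
  have h := pInt_eq 2
  norm_num [qInt_one] at h
  exact h

theorem hVal_zero : hVal 0 = 0 := by
  rw [hVal, qInt_zero, mul_zero, zero_div]

theorem hVal_one : hVal 1 = qInt 2 ^ 2 / (qInt 3 * pInt 2) := by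
  rw [hVal]
  norm_num [qInt_one, sq]

theorem tBVal_zero : tBVal 0 = qInt 2 ^ 2 / (qInt 3 * pInt 2) := by
  rw [tBVal, hVal_zero]
  norm_num [qInt_one]
  rw [div_div]

theorem tCVal_zero : tCVal 0 = tBVal 0 := by
  rw [tCVal, tBVal_zero, zero_add, hVal_zero, hVal_one, sub_zero]

theorem aBVal_zero : aBVal 0 = qInt 2 / qInt 3 := by
  have h : qInt 2 ≠ 0 := qInt_ne_zero (by norm_num)
  rw [aBVal]
  norm_num [qInt_one]
  field_simp

theorem aCVal_zero : aCVal 0 = aBVal 0 := by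
  rw [aCVal, aBVal]
  norm_num [qInt_one]

theorem tAVal_zero : tAVal 0 = tBVal 1 := by
  have h2 : qInt 2 ≠ 0 := qInt_ne_zero (by norm_num)
  have h3 : qInt 3 ≠ 0 := qInt_ne_zero (by norm_num)
  have h4 : qInt 4 ≠ 0 := qInt_ne_zero (by norm_num)
  have hp2 : pInt 2 ≠ 0 := pInt_ne_zero (by norm_num)
  have hp3 : pInt 3 ≠ 0 := pInt_ne_zero (by norm_num)
  have e3 := pInt_eq 3
  have r2 := eq_sub_of_add_eq (qInt_rec 2)
  have r3 := eq_sub_of_add_eq (qInt_rec 3)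
  rw [tAVal, tBVal, hVal_one]
  norm_num [qInt_one] at e3 r2 r3 ⊢
  field_simp
  rw [e3, pInt_two, r3, r2]
  ring

end Numbers

/-! ### Values of the coefficients on the projections -/

section Base

variable {B : Type*} [Ring B] [Algebra Cq B] {ε : ℕ → B}

theorem fE_jonesWenzl (h : IsSeparated ε) (h0 : ε 0 * ε 1 ≠ 0) :
    fE h h0 (jonesWenzl 1) = coef (ε 0 * ε 1) 1 + (qInt 2)⁻¹ * coef (ε 0 * ε 1) (ε 0)
      + (qInt 2)⁻¹ * coef (ε 0 * ε 1) (ε 1) + (qInt 2)⁻¹ ^ 2 := by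
  have h1 : jonesWenzl 1 = wd (gen 1) [] + (qInt 2)⁻¹ • wd (gen 1) [0]
      + (qInt 2)⁻¹ • wd (gen 1) [1] + (qInt 2)⁻¹ ^ 2 • wd (gen 1) [0, 1] := by
    simp only [jonesWenzl, wd_nil, wd_cons, mul_one, add_mul, mul_add, one_mul, smul_mul_assoc,
      mul_smul_comm, smul_add, smul_smul, sq]
    abel
  rw [h1, fE]
  simp only [map_add, map_smul, smul_eq_mul]
  rw [coefFun_wd _ _ (by simp), coefFun_wd _ _ (by simp), coefFun_wd _ _ (by simp),
    coefFun_wd _ _ (by simp)]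
  simp only [wd_nil, wd_cons, mul_one, coef_self h0]

end Base

theorem fE_eT : fE isSeparated_eT eT_ne_zero (jonesWenzl 1) = (qInt 2)⁻¹ ^ 2 := by
  have key : ∀ v : Op × Op, v.2 ≠ 0 → coef (eT 0 * eT 1) v = 0 := by
    intro v hv
    refine coef_eq_zero fun c _ h => hv ?_
    have h5 : (eT 0 * eT 1).2 = 0 := eB_zero_mul_one
    rw [h, Prod.smul_snd, h5, smul_zero]
  rw [fE_jonesWenzl, key 1 op_one_ne, key (eT 0) eB_zero_ne, key (eT 1) eB_one_ne]
  ring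

/-- In `eA` the generators E_0 and E_1 are both δ⁻¹ E_0 E_1, so every term of the projection except
the unit contributes: 2/[2] - 1/[2]. -/
theorem fE_eA : dl * fE isSeparated_eA eA_ne_zero (jonesWenzl 1) = (qInt 2)⁻¹ := by
  have hq : qInt 2 ≠ 0 := qInt_ne_zero (by norm_num)
  have hz : eA 0 * eA 1 = dl • eA 0 := by rw [eA_zero_mul_one, eA_zero]
  have h1 : eA 1 = eA 0 := by rw [eA_zero, eA_pos le_rfl]
  have hv : coef (eA 0 * eA 1) (eA 0) = dl⁻¹ := by
    have := coef_smul_self eA_ne_zero dl⁻¹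
    rwa [hz, smul_smul, inv_mul_cancel₀ dl_ne_zero, one_smul, ← hz] at this
  have h0 : coef (eA 0 * eA 1) 1 = 0 := by
    refine coef_eq_zero fun c _ h => eA_zero_ne ?_
    rw [hz] at h
    have h2 := congrArg (eA 0 * ·) h
    simp only [mul_one, mul_smul_comm] at h2
    rw [(isTL_eA 0).sq 0 le_rfl, smul_comm c dl, ← h] at h2
    exact h2
  rw [fE_jonesWenzl, h0, hv, (congrArg _ h1).trans hv]
  simp only [dl]
  field_simp
  ring

theorem fB_eT_zero : fB isSeparated_eT eT_ne_zero 0 (jonesWenzl 2) = tBVal 0 := by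
  have h2 : qInt 2 ≠ 0 := qInt_ne_zero (by norm_num)
  have h3 : qInt 3 ≠ 0 := qInt_ne_zero (by norm_num)
  have hp2 : pInt 2 ≠ 0 := pInt_ne_zero (by norm_num)
  rw [jonesWenzl_succ_succ, wenzl_eq, mul_add, map_add]
  refine (congrArg₂ (· + ·) (fB_zero_plain isSeparated_eT eT_ne_zero _)
      ((fB_loop_eT 0 _).trans (fB_zero_loop _))).trans ?_
  rw [fE_eT, fE_eA, tBVal_zero, pInt_two_add_two, veeCoeff]
  norm_num
  field_simp
  rw [← pInt_two_add_two, pInt_two]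
  ring

theorem fB_eA_zero : dl * fB isSeparated_eA eA_ne_zero 0 (jonesWenzl 2) = aBVal 0 := by
  have h2 : qInt 2 ≠ 0 := qInt_ne_zero (by norm_num)
  have h3 : qInt 3 ≠ 0 := qInt_ne_zero (by norm_num)
  have hp2 : pInt 2 ≠ 0 := pInt_ne_zero (by norm_num)
  rw [jonesWenzl_succ_succ, wenzl_eq, mul_add, map_add]
  refine (congrArg (dl * ·) (congrArg₂ (· + ·) (fB_zero_plain isSeparated_eA eA_ne_zero _)
      (fB_zero_loop _))).trans ?_
  rw [mul_add, mul_left_comm, fE_eA, aBVal_zero, pInt_two_add_two, veeCoeff]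
  norm_num [dl]
  field_simp
  rw [pInt_two]
  ring

theorem fC_eA (k : ℕ) : dl * fC isSeparated_eA eA_ne_zero k (jonesWenzl (k + 2)) = aCVal k := by
  induction k with
  | zero => exact fB_eA_zero.trans aCVal_zero.symm
  | succ k ih =>
    rw [jonesWenzl_succ_succ, wenzl_eq, mul_add, map_add]
    refine (congrArg (dl * ·) (congrArg₂ (· + ·) (fC_plain isSeparated_eA eA_ne_zero k _)
      (fC_loop k _))).trans ?_
    push_cast
    rw [aCVal_succ, ih, ← ih]
    simp only [dl]
    ring

theorem fB_eA (k : ℕ) : dl * fB isSeparated_eA eA_ne_zero k (jonesWenzl (k + 2)) = aBVal k := by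
  induction k with
  | zero => exact fB_eA_zero
  | succ k ih =>
    rw [jonesWenzl_succ_succ, wenzl_eq, mul_add, map_add]
    refine (congrArg (dl * ·) (congrArg₂ (· + ·) (fB_plain isSeparated_eA eA_ne_zero k _)
      (fB_loop k _))).trans ?_
    push_cast
    rw [aBVal_succ, ih, ← ih, fC_eA, ← fC_eA]
    simp only [dl]
    ring

theorem fC_eT (k : ℕ) : fC isSeparated_eT eT_ne_zero k (jonesWenzl (k + 2)) = tCVal k := by
  induction k with
  | zero => exact fB_eT_zero.trans tCVal_zero.symm
  | succ k ih =>
    rw [jonesWenzl_succ_succ, wenzl_eq, mul_add, map_add]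
    refine (congrArg₂ (· + ·) (fC_plain isSeparated_eT eT_ne_zero k _)
      ((fC_loop_eT (k + 1) _).trans (fC_loop k _))).trans ?_
    push_cast
    rw [tCVal_succ, ih, fC_eA]

theorem fB_eT (k : ℕ) : fB isSeparated_eT eT_ne_zero k (jonesWenzl (k + 2)) = tBVal k := by
  induction k with
  | zero => exact fB_eT_zero
  | succ k ih =>
    rw [jonesWenzl_succ_succ, wenzl_eq, mul_add, map_add]
    refine (congrArg₂ (· + ·) (fB_plain isSeparated_eT eT_ne_zero k _)
      ((fB_loop_eT (k + 1) _).trans (fB_loop k _))).trans ?_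
    push_cast
    rw [tBVal_succ, ih, fC_eT, fC_eA, fB_eA]

theorem fA_eT (k : ℕ) : fA isSeparated_eT eT_ne_zero k (jonesWenzl (k + 3)) = tAVal k := by
  induction k with
  | zero =>
    have h := fB_eT 1
    rw [Nat.cast_one] at h
    rw [Nat.cast_zero, tAVal_zero, ← h]
    -- In `TL 3` the functionals `fA` and `fB` belong to the same word.
    rfl
  | succ k ih =>
    rw [jonesWenzl_succ_succ, wenzl_eq, mul_add, map_add]
    refine (congrArg₂ (· + ·) (fA_plain isSeparated_eT eT_ne_zero k _)
      ((fA_loop_eT (k + 1) _).trans (fA_loop k _))).trans ?_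
    have h1 := fB_eT (k + 1)
    have h2 := fB_eA (k + 1)
    push_cast at h1 h2 ⊢
    rw [tAVal_succ, ih, h1, h2]

theorem fA_jonesWenzl (k : ℕ) {n : ℕ} (hn : n = k + 3) :
    tAVal k = qInt (n - 1) ^ 3 * qInt (n - 2) * qInt 2 ^ 2 /
            (qInt (2 * n - 2) * qInt (n + 1) * qInt n) +
          2 * (qInt n * qInt (n - 1) ^ 3 * qInt (n - 2) * qInt 2 /
            (qInt (2 * n) * qInt (2 * n - 2) * qInt (n + 1))) := by
  subst hn
  have h2 : qInt (k + 2) ≠ 0 := qInt_ne_zero (by omega)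
  have h3 : qInt (k + 3) ≠ 0 := qInt_ne_zero (by omega)
  have h4 : qInt (k + 4) ≠ 0 := qInt_ne_zero (by omega)
  have hp2 : pInt (k + 2) ≠ 0 := pInt_ne_zero (by omega)
  have hp3 : pInt (k + 3) ≠ 0 := pInt_ne_zero (by omega)
  push_cast
  rw [show 2 * ((k : ℤ) + 3) - 2 = 2 * (k + 2) by ring, qInt_two_mul, qInt_two_mul,
    show (k : ℤ) + 3 - 1 = k + 2 by ring, show (k : ℤ) + 3 - 2 = k + 1 by ring,
    show (k : ℤ) + 3 + 1 = k + 4 by ring, tAVal]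
  field_simp

/-! ### Short words with the image of E_0 E_1 E_3 -/

section Letters

variable {l : List ℕ} {c : Cq}

theorem IsTL.wd_perm {A : Type*} [Ring A] [Algebra Cq A] {e : ℕ → A} {n : ℕ} (h : IsTL e n)
    {k : ℕ} (hk : 3 ≤ k) (hkn : k ≤ n) (hl : l.Perm [0, 1, k]) : wd e l = e 0 * e 1 * e k := by
  have h01 : Commute (e 0) (e 1) := h.comm01 (by omega)
  have h0 : Commute (e 0) (e k) := h.comm 0 k (by omega) hkn (by unfold Adj; omega)
  have h1 : Commute (e 1) (e k) := h.comm 1 k (by omega) hkn (by unfold Adj; omega)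
  have hp : (l.map e).Perm [e 0, e 1, e k] := by simpa using hl.map e
  rw [wd, hp.symm.prod_eq' (by simp [h01, h0, h1]) |>.symm]
  simp [mul_assoc]

theorem wd_eB_of_zero_not_mem (hl : 0 ∉ l) : wd eB l = wd eA l := by
  refine wd_congr fun i hi => ?_
  have : 1 ≤ i := Nat.one_le_iff_ne_zero.2 fun h => hl (h ▸ hi)
  rw [eB_pos this, eA_pos this]

theorem wd_eB_of_one_not_mem (hl : 1 ∉ l) : wd eB l = opB * wd eA l * opB := by
  induction l with
  | nil => rw [wd_nil, wd_nil, mul_one, opB_mul_self]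
  | cons i l ih =>
    simp only [List.mem_cons, not_or] at hl
    have h1 : eB i = opB * eA i * opB := by
      rcases Nat.eq_zero_or_pos i with rfl | hi
      · rfl
      · rw [eB_pos hi, eA_pos hi, opB_comm (by omega), mul_assoc, opB_mul_self, mul_one]
    rw [wd_cons, wd_cons, ih hl.2, h1]
    simp only [mul_assoc, opB_conj]

/-- A word without the letter 0 has equal images in `eA` and `eB`; without the letter 1 the images
are conjugate by `opB`. The target is nonzero in `eA` and zero in `eB`. -/
theorem zero_one_mem_of_wd_eq (hc : c ≠ 0) (h : wd eT l = c • zB eT 1) : 0 ∈ l ∧ 1 ∈ l := by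
  have hA : wd eA l ≠ 0 := by
    have h1 : (wd eT l).1 = wd eA l := map_wd (AlgHom.fst Cq Op Op) eT l
    rw [← h1, h, Prod.smul_fst, eT_fst_zB]
    exact smul_ne_zero hc (isSeparated_eA.zB_ne_zero eA_ne_zero 1)
  have hB : wd eB l = 0 := by
    have h1 : (wd eT l).2 = wd eB l := map_wd (AlgHom.snd Cq Op Op) eT l
    rw [← h1, h, Prod.smul_snd, eT_snd_zB, smul_zero]
  constructor
  · by_contra hl
    exact hA (wd_eB_of_zero_not_mem hl ▸ hB)
  · by_contra hl
    rw [wd_eB_of_one_not_mem hl] at hB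
    apply hA
    have h1 : opB * (opB * wd eA l * opB) * opB = wd eA l := by
      rw [mul_assoc, mul_assoc, mul_assoc, opB_mul_self, mul_one, opB_conj]
    rw [← h1, hB, mul_zero, zero_mul]

/-- Besides 0 and 1 the word needs a letter above 2, since otherwise it lies in level 2 while being
scaled by `ε 3`. This third letter is a descent of E_0 E_1 E_3, hence equals 3. -/
theorem perm_of_wd_eq (hlen : l.length ≤ 3) (hc : c ≠ 0) (h : wd eT l = c • zB eT 1) :
    l.Perm [0, 1, 3] := by
  obtain ⟨h0, h1⟩ := zero_one_mem_of_wd_eq hc h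
  have hz := isSeparated_eT.zB_ne_zero eT_ne_zero 1
  have hstay : wd eT l * eT 3 = dl • wd eT l := by
    rw [h, smul_mul_assoc, zB_stay isTL_eT 0, smul_comm]
  have hbig : ¬ ∀ i ∈ l, i ≤ 2 := fun hl =>
    smul_ne_zero hc hz (h ▸ isSeparated_eT.eq_zero_of_scaled (n := 1) (wd_mem isTL_eT hl) hstay)
  obtain ⟨r, hr⟩ : ∃ r, l.Perm (0 :: 1 :: r) :=
    ⟨_, (List.perm_cons_erase h0).trans
      ((List.perm_cons_erase ((List.mem_erase_of_ne one_ne_zero).2 h1)).cons 0)⟩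
  have hlen' := hr.length_eq
  simp only [List.length_cons] at hlen'
  match r, hr, hlen' with
  | [], hr, _ =>
    refine (hbig fun i hi => ?_).elim
    have := hr.mem_iff.1 hi
    simp at this
    omega
  | [k], hr, _ =>
    have hk : 3 ≤ k := by
      by_contra hk
      refine hbig fun i hi => ?_
      have := hr.mem_iff.1 hi
      simp at this
      omega
    have hw := (isTL_eT k).wd_perm hk le_rfl hr
    have hk1 : wd eT l * eT k = dl • wd eT l := by
      rw [hw, mul_assoc, (isTL_eT k).sq k le_rfl, mul_smul_comm]
    have hk2 : zB eT 1 * eT k = dl • zB eT 1 := by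
      apply smul_right_injective (Op × Op) hc
      simp only
      rw [← smul_mul_assoc, ← h, hk1, h, smul_comm]
    have := isSeparated_eT.descent_zA eT_ne_zero hk2
    obtain rfl : k = 3 := by omega
    exact hr
  | _ :: _ :: _, _, hlen' => simp at hlen'; omega

end Letters

/-! ### Reading off the coefficient from an expansion -/

section Coefficient

variable {k : ℕ}

theorem word_map_le {n : ℕ} (w : List (Fin (n + 1))) : ∀ i ∈ w.map Fin.val, i ≤ n := by
  intro i hi
  obtain ⟨a, -, rfl⟩ := List.mem_map.1 hi
  omega

theorem lift_word {n : ℕ} (w : List (Fin (n + 1))) :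
    lift (isTL_eT n) (word w) = wd eT (w.map Fin.val) := by
  rw [word_eq_wd, lift_wd _ (word_map_le w)]

theorem word_eq_of_lift {w : List (Fin (k + 4))} {c : Cq} (hlen : w.length ≤ 3) (hc : c ≠ 0)
    (h : lift (isTL_eT (k + 3)) (word w) = c • zB eT 1) :
    word w = zB (gen (k + 3)) 1 ∧ w.length = 3 := by
  rw [lift_word] at h
  have hp := perm_of_wd_eq (by simpa using hlen) hc h
  refine ⟨?_, by simpa using hp.length_eq⟩
  rw [word_eq_wd, (isTL_gen (k + 3)).wd_perm le_rfl (by omega) hp]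
  rfl

theorem exists_isReduced {n : ℕ} (w : List (Fin (n + 1))) :
    ∃ (w' : List (Fin (n + 1))) (c : Cq), IsReduced w' ∧ word w = c • word w' := by
  induction hlen : w.length using Nat.strong_induction_on generalizing w with
  | _ m ih =>
    by_cases hw : IsReduced w
    · exact ⟨w, 1, hw, (one_smul _ _).symm⟩
    · simp only [IsReduced, not_forall, not_le] at hw
      obtain ⟨w', c, h1, h2⟩ := hw
      obtain ⟨w'', c', h3, h4⟩ := ih _ (hlen ▸ h2) w' rfl
      exact ⟨w'', c * c', h3, by rw [h1, h4, smul_smul]⟩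

theorem exists_isExpansion {n : ℕ} (x : TL n) : ∃ c, IsExpansion x c := by
  suffices h : x ∈ Submodule.span Cq (monomials n) from Submodule.mem_span_set.1 h
  induction x using induction_word with
  | hw l hl =>
    obtain ⟨w, c, hw, h⟩ := exists_isReduced (l.map (Fin.ofNat (n + 1)))
    rw [wd_eq_word, h]
    exact Submodule.smul_mem _ _ (Submodule.subset_span ⟨w, hw, rfl⟩)
  | hadd x y hx hy => exact add_mem hx hy
  | hsmul c x hx => exact Submodule.smul_mem _ c hx

theorem fA_word (w : List (Fin (k + 4))) :
    fA isSeparated_eT eT_ne_zero k (word w) = coef (zB eT 1) (lift (isTL_eT (k + 3)) (word w)) := by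
  rw [lift_word, word_eq_wd]
  exact coefFun_wd isTL_eT _ (word_map_le w)

theorem exists_word_eq_zB : ∃ w : List (Fin (k + 4)), w.length = 3 ∧ word w = zB (gen (k + 3)) 1 :=
  ⟨_, by simp, (wd_eq_word [0, 1, 3]).symm.trans (by simp [wd_cons, zB, mul_assoc])⟩

theorem zB_mem_monomials : zB (gen (k + 3)) 1 ∈ monomials (k + 3) := by
  obtain ⟨w, hlen, hw⟩ := exists_word_eq_zB (k := k)
  refine ⟨w, fun w' c h => ?_, hw⟩
  rw [hlen]
  by_contra hlt
  have hz := isSeparated_eT.zB_ne_zero eT_ne_zero 1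
  have h1 : zB eT 1 = c • lift (isTL_eT (k + 3)) (word w') := by
    rw [← map_smul, ← h, hw, lift_zB (by omega)]
  have hc : c ≠ 0 := by
    rintro rfl
    exact hz (by rw [h1, zero_smul])
  have h2 := word_eq_of_lift (k := k) (w := w') (by omega) (inv_ne_zero hc)
    (by rw [h1, smul_smul, inv_mul_cancel₀ hc, one_smul])
  omega

theorem fA_zB : fA isSeparated_eT eT_ne_zero k (zB (gen (k + 3)) 1) = 1 := by
  obtain ⟨w, -, hw⟩ := exists_word_eq_zB (k := k)
  rw [← hw, fA_word, hw, lift_zB (by omega)]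
  exact coef_self (isSeparated_eT.zB_ne_zero eT_ne_zero 1)

/-- If the value is nonzero, faithfulness makes the monomial a multiple of E_0 E_1 E_3. Being
reduced, it then has at most three letters, so it is a rearrangement of the commuting letters 0, 1,
3 and equals E_0 E_1 E_3. -/
theorem fA_eq_zero_of_mem_monomials {b : TL (k + 3)} (hb : b ∈ monomials (k + 3))
    (hne : b ≠ zB (gen (k + 3)) 1) : fA isSeparated_eT eT_ne_zero k b = 0 := by
  obtain ⟨w, hred, rfl⟩ := hb
  rw [fA_word]
  by_contra hc
  have h1 := eq_coef_smul hc
  obtain ⟨w₀, hlen, hw₀⟩ := exists_word_eq_zB (k := k)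
  have h2 := isFaithful_zA k (word w) ⟨_, word_map_le w, word_eq_wd w⟩ _ hc
    (by rwa [lift_zB (by omega)])
  have h3 := hred w₀ _ (by rwa [hw₀])
  exact hne (word_eq_of_lift (hlen ▸ h3) hc h1).1

theorem isCoeff_zB (x : TL (k + 3)) :
    IsCoeff (zB (gen (k + 3)) 1) x (fA isSeparated_eT eT_ne_zero k x) := by
  refine ⟨zB_mem_monomials, exists_isExpansion x, ?_⟩
  rintro c ⟨hc, rfl⟩
  rw [map_finsuppSum, Finsupp.sum, Finset.sum_eq_single (zB (gen (k + 3)) 1), map_smul, fA_zB,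
    smul_eq_mul, mul_one]
  · intro b hb hne
    rw [map_smul, fA_eq_zero_of_mem_monomials (hc hb) hne, smul_zero]
  · intro h
    rw [Finsupp.notMem_support_iff.1 h, zero_smul, map_zero]

end Coefficient

end TypeD

end

theorem mainTheorem10 :
    (∃! Q : (n : ℕ) → TypeD.TL n, TypeD.IsJonesWenzl Q) ∧
    ∀ Q : (n : ℕ) → TypeD.TL n, TypeD.IsJonesWenzl Q → ∀ (n : ℕ) (hn : 3 ≤ n),
      TypeD.IsCoeff
        (TypeD.E ⟨0, by omega⟩ * TypeD.E ⟨1, by omega⟩ * TypeD.E ⟨3, by omega⟩) (Q n)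
        (qInt (n - 1) ^ 3 * qInt (n - 2) * qInt 2 ^ 2 /
            (qInt (2 * n - 2) * qInt (n + 1) * qInt n) +
          2 * (qInt n * qInt (n - 1) ^ 3 * qInt (n - 2) * qInt 2 /
            (qInt (2 * n) * qInt (2 * n - 2) * qInt (n + 1)))) := by
  refine ⟨⟨TypeD.jonesWenzl, TypeD.isJonesWenzl_jonesWenzl,
    fun Q hQ => hQ.unique TypeD.isJonesWenzl_jonesWenzl⟩, fun Q hQ n hn => ?_⟩
  obtain rfl := hQ.unique TypeD.isJonesWenzl_jonesWenzl
  obtain ⟨k, rfl⟩ : ∃ k, n = k + 3 := ⟨n - 3, by omega⟩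
  rw [← TypeD.fA_jonesWenzl k rfl, ← TypeD.fA_eT, ← TypeD.gen_eq, ← TypeD.gen_eq, ← TypeD.gen_eq]
  exact TypeD.isCoeff_zB _
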